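/- An instance of connected $k$-center consists of a vertex set $V$ with $n=|V|$, a metric $d$ on $V$, an integer $k$ with $2\le k\le n$, and an undirected graph $G=(V,E)$. A feasible solution is a partition of $V$ into $k$ clusters $P_1,\dots,P_k$ with centers $c_i\in P_i$ such that every $P_i$ induces a connected subgraph of $G$; the objective, to be minimized, is $\max_{i}\max_{v\in P_i} d(v,c_i)$. A nice tree decomposition of $G$ is a tree decomposition (bags $B_t\subseteq V$ on the nodes of a tree that cover all vertices and all edges, such that for every vertex the nodes whose bags contain it induce a connected subtree) whose tree has a root with empty bag and in which every node $t$ is of one of the following types: a leaf (no child, $B_t=\emptyset$); an introduce vertex node (one child $s$, $B_t=B_s\cup\{v\}$ with $v\notin B_s$); an introduce edge node (one child $s$, labeled with an edge $\{u,v\}\in E$, $B_t=B_s\ni u,v$); a forget node (one child $s$, $B_t=B_s\setminus\{v\}$ with $v\in B_s$); a join node (two children, both with bag $B_t$). Every edge is introduced exactly once and every vertex is forgotten exactly once. Its width $w$ is the size of the largest bag minus one. Theorem. There is an algorithm (a program of a unit-cost random access machine whose integer words have length logarithmic in the running time bound and which can compare distances) that, given an instance of connected $k$-center and a nice tree decomposition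 of $G$ of width $w$ with $O(n(w+1))$ nodes, computes a feasible solution whose objective value is at most $6$ times that of any feasible solution (or reports that no feasible solution exists), in time $$O\bigl(n^2\log n+n\log n\,(wk)^{O(w)}\bigr),$$ where for $w=0$ the factor $(wk)^{O(w)}$ is read as $1$. In particular the running time is at most $f(\max(w,k))\cdot n^{c}$ for a computable function $f$ and a constant $c$, that is, the problem of computing such a 6-approximation is in FPT with respect to the parameter $\max(w,k)$. -/

import Mathlib

/-! ### Tree decompositions -/

/-- A tree decomposition of `G` with nodes in `ι`: a tree on `ι` and a bag for every node, such that
the bags cover all vertices and all edges, and the nodes whose bags contain a fixed vertex form a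
connected subtree. -/
structure TreeDecomposition {V : Type} (G : SimpleGraph V) (ι : Type) where
  tree : SimpleGraph ι
  isTree : tree.IsTree
  bag : ι → Finset V
  cover_vertex : ∀ v, ∃ t, v ∈ bag t
  cover_edge : ∀ u v, G.Adj u v → ∃ t, u ∈ bag t ∧ v ∈ bag t
  connected_nodes : ∀ v, (tree.induce {t | v ∈ bag t}).Connected

/-- The width: the size of the largest bag minus one. -/
def TreeDecomposition.width {V ι : Type} [Fintype ι] {G : SimpleGraph V}
    (D : TreeDecomposition G ι) : ℕ :=
  (Finset.univ.sup fun t => (D.bag t).card) - 1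

/-- The type of a node of a nice tree decomposition; `s`, `s₁`, `s₂` name the children. -/
inductive NodeKind (V ι : Type) where
  | leaf : NodeKind V ι
  | introVertex (v : V) (s : ι) : NodeKind V ι
  | introEdge (u v : V) (s : ι) : NodeKind V ι
  | forget (v : V) (s : ι) : NodeKind V ι
  | join (s₁ s₂ : ι) : NodeKind V ι

/-- The children of the node `t` when the tree `T` is rooted at `z`. -/
def childSet {ι : Type} (T : SimpleGraph ι) (z t : ι) : Set ι :=
  {s | T.Adj t s ∧ T.dist z s = T.dist z t + 1}

/-- The requirement that a node `t` of type `κ` has to fulfil, where `children` is the set of its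
children. -/
def NodeKind.Valid {V ι : Type} [DecidableEq V] (G : SimpleGraph V) (bag : ι → Finset V)
    (children : Set ι) (t : ι) : NodeKind V ι → Prop
  | .leaf => children = ∅ ∧ bag t = ∅
  | .introVertex v s => children = {s} ∧ v ∉ bag s ∧ bag t = insert v (bag s)
  | .introEdge u v s => children = {s} ∧ G.Adj u v ∧ bag t = bag s ∧ u ∈ bag t ∧ v ∈ bag t
  | .forget v s => children = {s} ∧ v ∈ bag s ∧ bag t = (bag s).erase v
  | .join s₁ s₂ => s₁ ≠ s₂ ∧ children = {s₁, s₂} ∧ bag s₁ = bag t ∧ bag s₂ = bag t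

/-- A node of this type introduces the edge `e`. -/
def NodeKind.IntroducesEdge {V ι : Type} (e : Sym2 V) : NodeKind V ι → Prop
  | .introEdge u v _ => s(u, v) = e
  | _ => False

/-- A node of this type forgets the vertex `x`. -/
def NodeKind.Forgets {V ι : Type} (x : V) : NodeKind V ι → Prop
  | .forget v _ => v = x
  | _ => False

/-- A nice tree decomposition (with introduce edge nodes). -/
structure NiceTreeDecomposition {V : Type} [DecidableEq V] (G : SimpleGraph V) (ι : Type) extends
    TreeDecomposition G ι where
  root : ι
  bag_root : bag root = ∅
  kind : ι → NodeKind V ι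
  valid : ∀ t, (kind t).Valid G bag (childSet tree root t) t
  introduced_once : ∀ e ∈ G.edgeSet, ∃! t, (kind t).IntroducesEdge e
  forgotten_once : ∀ v, ∃! t, (kind t).Forgets v

/-! ### Connected `k`-center -/

/-- A feasible solution: a partition of the vertices into `k` clusters (`cluster v` is the index of
the cluster of `v`), each inducing a connected subgraph and containing its center. -/
structure ConnectedClustering {n : ℕ} (G : SimpleGraph (Fin n)) (k : ℕ) where
  cluster : Fin n → Fin k
  center : Fin k → Fin n
  connected : ∀ i, (G.induce {v | cluster v = i}).Connected
  center_mem : ∀ i, cluster (center i) = i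

/-- An instance of connected `k`-center on the vertices `0, …, n - 1` together with a nice tree
decomposition of the connectivity graph with nodes `0, …, N - 1`. -/
structure KCenterInstance where
  n : ℕ
  k : ℕ
  N : ℕ
  two_le_k : 2 ≤ k
  k_le_n : k ≤ n
  metric : MetricSpace (Fin n)
  G : SimpleGraph (Fin n)
  decomp : NiceTreeDecomposition G (Fin N)

namespace KCenterInstance

/-- The width of the given decomposition. -/
def w (I : KCenterInstance) : ℕ := I.decomp.width

/-- The distance metric. -/
def d (I : KCenterInstance) (u v : Fin I.n) : ℝ := I.metric.dist u v

/-- The `k`-center objective: the largest distance of a vertex to the center of its cluster. -/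
noncomputable def radius (I : KCenterInstance) (S : ConnectedClustering I.G I.k) : ℝ :=
  ⨆ v : Fin I.n, I.d v (S.center (S.cluster v))

/-- The feasible solution `S` is an `α`-approximation. -/
def IsApprox (I : KCenterInstance) (α : ℝ) (S : ConnectedClustering I.G I.k) : Prop :=
  ∀ S' : ConnectedClustering I.G I.k, I.radius S ≤ α * I.radius S'

end KCenterInstance

/-! ### The machine model

A unit-cost random access machine, programmed in a structured language.  A program uses finitely
many integer variables and finitely many integer arrays with indirect addressing, all of whose
entries are words of `W` bits: a program that computes a larger number has no execution.  Besides,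
there is a read-only array of real numbers; the only operation on reals is the comparison of two
entries of that array.  Every operation and every access to a variable or an array costs one step. -/

namespace RAM

/-- Contents of the integer variables and of the integer arrays. -/
structure State where
  var : ℕ → ℕ
  arr : ℕ → ℕ → ℕ

/-- Integer expressions; `get a i` reads entry `i` of the array `a`. -/
inductive Expr where
  | const (c : ℕ) : Expr
  | var (x : ℕ) : Expr
  | get (a : ℕ) (i : Expr) : Expr
  | add (e₁ e₂ : Expr) : Expr
  | sub (e₁ e₂ : Expr) : Expr
  | mul (e₁ e₂ : Expr) : Expr
  | div (e₁ e₂ : Expr) : Expr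
  | mod (e₁ e₂ : Expr) : Expr

namespace Expr

/-- The value of an expression; subtraction is truncated. -/
def eval (σ : State) : Expr → ℕ
  | const c => c
  | var x => σ.var x
  | get a i => σ.arr a (i.eval σ)
  | add e₁ e₂ => e₁.eval σ + e₂.eval σ
  | sub e₁ e₂ => e₁.eval σ - e₂.eval σ
  | mul e₁ e₂ => e₁.eval σ * e₂.eval σ
  | div e₁ e₂ => e₁.eval σ / e₂.eval σ
  | mod e₁ e₂ => e₁.eval σ % e₂.eval σ

/-- The number of operations of an expression. -/
def cost : Expr → ℕ
  | const _ => 1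
  | var _ => 1
  | get _ i => i.cost + 1
  | add e₁ e₂ => e₁.cost + e₂.cost + 1
  | sub e₁ e₂ => e₁.cost + e₂.cost + 1
  | mul e₁ e₂ => e₁.cost + e₂.cost + 1
  | div e₁ e₂ => e₁.cost + e₂.cost + 1
  | mod e₁ e₂ => e₁.cost + e₂.cost + 1

/-- All numbers that occur in the evaluation of an expression are words of `W` bits. -/
def Fits (W : ℕ) (σ : State) : Expr → Prop
  | const c => c < 2 ^ W
  | var x => σ.var x < 2 ^ W
  | get a i => i.Fits W σ ∧ σ.arr a (i.eval σ) < 2 ^ W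
  | add e₁ e₂ => e₁.Fits W σ ∧ e₂.Fits W σ ∧ e₁.eval σ + e₂.eval σ < 2 ^ W
  | sub e₁ e₂ => e₁.Fits W σ ∧ e₂.Fits W σ
  | mul e₁ e₂ => e₁.Fits W σ ∧ e₂.Fits W σ ∧ e₁.eval σ * e₂.eval σ < 2 ^ W
  | div e₁ e₂ => e₁.Fits W σ ∧ e₂.Fits W σ
  | mod e₁ e₂ => e₁.Fits W σ ∧ e₂.Fits W σ

end Expr

/-- Tests; `distLe e₁ e₂` compares two entries of the array of reals. -/
inductive Test where
  | lt (e₁ e₂ : Expr) : Test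
  | eq (e₁ e₂ : Expr) : Test
  | distLe (e₁ e₂ : Expr) : Test
  | not (b : Test) : Test
  | and (b₁ b₂ : Test) : Test

namespace Test

/-- The truth value of a test, where `D` is the array of reals. -/
def Holds (D : ℕ → ℝ) (σ : State) : Test → Prop
  | lt e₁ e₂ => e₁.eval σ < e₂.eval σ
  | eq e₁ e₂ => e₁.eval σ = e₂.eval σ
  | distLe e₁ e₂ => D (e₁.eval σ) ≤ D (e₂.eval σ)
  | not b => ¬ b.Holds D σ
  | and b₁ b₂ => b₁.Holds D σ ∧ b₂.Holds D σ

/-- The number of operations of a test. -/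
def cost : Test → ℕ
  | lt e₁ e₂ => e₁.cost + e₂.cost + 1
  | eq e₁ e₂ => e₁.cost + e₂.cost + 1
  | distLe e₁ e₂ => e₁.cost + e₂.cost + 1
  | not b => b.cost + 1
  | and b₁ b₂ => b₁.cost + b₂.cost + 1

/-- All integers that occur in the evaluation of a test are words of `W` bits. -/
def Fits (W : ℕ) (σ : State) : Test → Prop
  | lt e₁ e₂ => e₁.Fits W σ ∧ e₂.Fits W σ
  | eq e₁ e₂ => e₁.Fits W σ ∧ e₂.Fits W σ
  | distLe e₁ e₂ => e₁.Fits W σ ∧ e₂.Fits W σ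
  | not b => b.Fits W σ
  | and b₁ b₂ => b₁.Fits W σ ∧ b₂.Fits W σ

end Test

/-- Programs. -/
inductive Program where
  | skip : Program
  | assign (x : ℕ) (e : Expr) : Program
  | store (a : ℕ) (i e : Expr) : Program
  | seq (p q : Program) : Program
  | ite (b : Test) (p q : Program) : Program
  | loop (b : Test) (p : Program) : Program

/-- The state after the assignment of `c` to the variable `x`. -/
def State.setVar (σ : State) (x c : ℕ) : State :=
  { σ with var := Function.update σ.var x c }

/-- The state after writing `c` to entry `i` of the array `a`. -/
def State.setArr (σ : State) (a i c : ℕ) : State :=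
  { σ with arr := Function.update σ.arr a (Function.update (σ.arr a) i c) }

/-- `Exec W D p σ t σ'`: on a machine with words of `W` bits and the array `D` of reals, the program
`p` started in the state `σ` halts after `t` steps in the state `σ'`. -/
inductive Exec (W : ℕ) (D : ℕ → ℝ) : Program → State → ℕ → State → Prop where
  | skip (σ : State) : Exec W D .skip σ 1 σ
  | assign (σ : State) (x : ℕ) (e : Expr) (he : e.Fits W σ) :
      Exec W D (.assign x e) σ (e.cost + 1) (σ.setVar x (e.eval σ))
  | store (σ : State) (a : ℕ) (i e : Expr) (hi : i.Fits W σ) (he : e.Fits W σ) :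
      Exec W D (.store a i e) σ (i.cost + e.cost + 1) (σ.setArr a (i.eval σ) (e.eval σ))
  | seq {σ₁ σ₂ σ₃ : State} {p q : Program} {t₁ t₂ : ℕ} (h₁ : Exec W D p σ₁ t₁ σ₂)
      (h₂ : Exec W D q σ₂ t₂ σ₃) : Exec W D (.seq p q) σ₁ (t₁ + t₂) σ₃
  | ite_true {σ₁ σ₂ : State} {b : Test} {p q : Program} {t : ℕ} (hf : b.Fits W σ₁)
      (hb : b.Holds D σ₁) (h : Exec W D p σ₁ t σ₂) :
      Exec W D (.ite b p q) σ₁ (b.cost + 1 + t) σ₂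
  | ite_false {σ₁ σ₂ : State} {b : Test} {p q : Program} {t : ℕ} (hf : b.Fits W σ₁)
      (hb : ¬ b.Holds D σ₁) (h : Exec W D q σ₁ t σ₂) :
      Exec W D (.ite b p q) σ₁ (b.cost + 1 + t) σ₂
  | loop_true {σ₁ σ₂ σ₃ : State} {b : Test} {p : Program} {t₁ t₂ : ℕ} (hf : b.Fits W σ₁)
      (hb : b.Holds D σ₁) (h₁ : Exec W D p σ₁ t₁ σ₂) (h₂ : Exec W D (.loop b p) σ₂ t₂ σ₃) :
      Exec W D (.loop b p) σ₁ (b.cost + 1 + t₁ + t₂) σ₃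
  | loop_false {σ : State} {b : Test} {p : Program} (hf : b.Fits W σ) (hb : ¬ b.Holds D σ) :
      Exec W D (.loop b p) σ (b.cost + 1) σ

end RAM

/-! ### Input and output -/

namespace NodeKind

/-- The number by which the type of a node is given to the machine. -/
def code {V ι : Type} : NodeKind V ι → ℕ
  | .leaf => 0
  | .introVertex _ _ => 1
  | .introEdge _ _ _ => 2
  | .forget _ _ => 3
  | .join _ _ => 4

/-- The first child (`0` if there is none). -/
def child₁ {n N : ℕ} : NodeKind (Fin n) (Fin N) → ℕ
  | .leaf => 0
  | .introVertex _ s => s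
  | .introEdge _ _ s => s
  | .forget _ s => s
  | .join s₁ _ => s₁

/-- The second child (`0` if there is none). -/
def child₂ {n N : ℕ} : NodeKind (Fin n) (Fin N) → ℕ
  | .join _ s₂ => s₂
  | _ => 0

/-- The introduced or forgotten vertex, or the first end of the introduced edge (`0` if there is
none). -/
def label₁ {n N : ℕ} : NodeKind (Fin n) (Fin N) → ℕ
  | .introVertex v _ => v
  | .introEdge u _ _ => u
  | .forget v _ => v
  | _ => 0

/-- The second end of the introduced edge (`0` if there is none). -/
def label₂ {n N : ℕ} : NodeKind (Fin n) (Fin N) → ℕ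
  | .introEdge _ v _ => v
  | _ => 0

end NodeKind

namespace KCenterInstance

/-- The `n × n` distance matrix, row by row. -/
noncomputable def distArray (I : KCenterInstance) (a : ℕ) : ℝ :=
  if h : a / I.n < I.n ∧ a % I.n < I.n then I.d ⟨a / I.n, h.1⟩ ⟨a % I.n, h.2⟩ else 0

/-- The array with entries `f 0, …, f (m - 1)`, followed by zeros. -/
def arrayOf {m : ℕ} (f : Fin m → ℕ) (a : ℕ) : ℕ :=
  if h : a < m then f ⟨a, h⟩ else 0

open Classical in
/-- The initial state.  The variables `0, 1, 2, 3` hold `n`, `k`, the number of nodes and the root.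
The arrays hold: `0` the adjacency matrix (row by row); `1` the types of the nodes; `2` and `3` their
children; `4` and `5` their labels; `6` the sizes of the bags; `7` the bags in increasing order, that
of the node `t` from position `t * n` on.  Everything else is zero. -/
noncomputable def input (I : KCenterInstance) : RAM.State where
  var x := match x with
    | 0 => I.n
    | 1 => I.k
    | 2 => I.N
    | 3 => I.decomp.root
    | _ => 0
  arr a := match a with
    | 0 => fun p => if ∃ u v : Fin I.n, p = u * I.n + v ∧ I.G.Adj u v then 1 else 0
    | 1 => arrayOf fun t => (I.decomp.kind t).code
    | 2 => arrayOf fun t => (I.decomp.kind t).child₁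
    | 3 => arrayOf fun t => (I.decomp.kind t).child₂
    | 4 => arrayOf fun t => (I.decomp.kind t).label₁
    | 5 => arrayOf fun t => (I.decomp.kind t).label₂
    | 6 => arrayOf fun t => (I.decomp.bag t).card
    | 7 => fun p => arrayOf (fun t =>
        (((I.decomp.bag t).sort (· ≤ ·)).map Fin.val).getD (p % I.n) 0) (p / I.n)
    | _ => fun _ => 0

/-- The state `σ` represents the solution `S`: array `8` holds the index of the cluster of every
vertex and array `9` the center of every cluster. -/
def Outputs (I : KCenterInstance) (σ : RAM.State) (S : ConnectedClustering I.G I.k) : Prop :=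
  (∀ v : Fin I.n, σ.arr 8 v = S.cluster v) ∧ ∀ i : Fin I.k, σ.arr 9 i = S.center i

/-- The final state `σ` answers the `α`-approximation problem: if there is a feasible solution,
variable `4` is `1` and an `α`-approximation has been output; otherwise variable `4` is `0`. -/
def Solves (I : KCenterInstance) (α : ℝ) (σ : RAM.State) : Prop :=
  (Nonempty (ConnectedClustering I.G I.k) →
    σ.var 4 = 1 ∧ ∃ S, I.Outputs σ S ∧ I.IsApprox α S) ∧
  (IsEmpty (ConnectedClustering I.G I.k) → σ.var 4 = 0)

/-- `C (n² log n + n log n (wk)^(C w))`. -/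
noncomputable def timeBound (I : KCenterInstance) (C : ℕ) : ℝ :=
  C * ((I.n : ℝ) ^ 2 * Real.log I.n +
    I.n * Real.log I.n * ((I.w : ℝ) * (I.k : ℝ)) ^ (C * I.w))

end KCenterInstance

/-! Let `r` be the radius of some feasible solution. Farthest-first traversal selects `k` points
such that every vertex is within `2r` of one of them (`exists_near`): either the points lie in `k`
different clusters, so that each cluster contains one, or two of them share a cluster, hence are at
distance at most `2r`, and their distance is at least that of any vertex to its nearest selected
point. Label every vertex with a selected point near the center of its cluster. By the triangle
inequality each vertex is within `3r` of its label, and since labels are constant on the connected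
clusters, the graph of all edges with equally labelled ends (`labelGraph`) has at most `k`
components.

The algorithm minimizes the largest distance of a vertex to its label over all labelings with at
most `k` such components (`run_labelVertices`); the optimum is at most `3r`, so equally labelled
vertices are within `6r` of each other, whichever of them serves as center. To get exactly `k`
clusters, clusters are merged along equally labelled edges, starting from singletons, as long as
there are more than `k`. With at most `k` components this stops at `k`. If no feasible solution
exists it cannot stop at `k`, because the outcome would be one; so the final number of clusters
decides feasibility.

The optimal labeling comes from a dynamic program over the nice tree decomposition. A state of a
node is a coloring of its bag with `k(w + 1)` colors together with a number of closed components, at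
most `k`. The residue of a color modulo `k` is the label; equal colors record a common component. A
closed component is one whose last vertex has been forgotten. Soundness (`IsRun.hitting_aux`) needs
only that equal colors imply connectedness; completeness (`exists_state`) needs only that vertices
connected by introduced edges have equal colors and that the count does not exceed the true number
of closed components. The value of a state is a bottleneck distance, stored as one plus its position
in the distance matrix (zero for an absent state), so that comparisons of distances suffice.

Every node tries all pairs of the `(k(w + 1)) ^ (w + 1) * (k + 1)` states, each in time polynomial
in `w`. There is no search over radii, so the logarithmic factors of the bound are not needed. For
`w = 0` the graph has no edges and the dynamic program is skipped. On the machine side, `Run` is a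
total-correctness judgment with running time, `Bdd` takes care of word sizes and `Agree` of the
variables that a program leaves alone. -/

namespace RAM

infixr:65 ";;" => Program.seq

/-! ### Reasoning about programs -/

/-- All entries of the state are words of `W` bits. -/
def Bdd (W : ℕ) (σ : State) : Prop :=
  (∀ x, σ.var x < 2 ^ W) ∧ ∀ a i, σ.arr a i < 2 ^ W

/-- The constants, sums and products in an expression are words of `W` bits. -/
def Expr.Safe (W : ℕ) (σ : State) : Expr → Prop
  | .const c => c < 2 ^ W
  | .var _ => True
  | .get _ i => i.Safe W σ
  | .add e₁ e₂ => e₁.Safe W σ ∧ e₂.Safe W σ ∧ e₁.eval σ + e₂.eval σ < 2 ^ W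
  | .sub e₁ e₂ => e₁.Safe W σ ∧ e₂.Safe W σ
  | .mul e₁ e₂ => e₁.Safe W σ ∧ e₂.Safe W σ ∧ e₁.eval σ * e₂.eval σ < 2 ^ W
  | .div e₁ e₂ => e₁.Safe W σ ∧ e₂.Safe W σ
  | .mod e₁ e₂ => e₁.Safe W σ ∧ e₂.Safe W σ

/-- The constants, sums and products in a test are words of `W` bits. -/
def Test.Safe (W : ℕ) (σ : State) : Test → Prop
  | .lt e₁ e₂ => e₁.Safe W σ ∧ e₂.Safe W σ
  | .eq e₁ e₂ => e₁.Safe W σ ∧ e₂.Safe W σ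
  | .distLe e₁ e₂ => e₁.Safe W σ ∧ e₂.Safe W σ
  | .not b => b.Safe W σ
  | .and b₁ b₂ => b₁.Safe W σ ∧ b₂.Safe W σ

variable {W : ℕ} {D : ℕ → ℝ}

/-- Differences, quotients and remainders do not exceed their first operand, and stored values are
bounded by `Bdd`; so only constants, sums and products have to be examined in the programs. -/
theorem Expr.fits_of_safe {σ : State} (hσ : Bdd W σ) :
    ∀ {e : Expr}, e.Safe W σ → e.Fits W σ
  | .const _, h => h
  | .var x, _ => hσ.1 x
  | .get a _, h => ⟨Expr.fits_of_safe hσ h, hσ.2 a _⟩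
  | .add _ _, h => ⟨Expr.fits_of_safe hσ h.1, Expr.fits_of_safe hσ h.2.1, h.2.2⟩
  | .sub _ _, h => ⟨Expr.fits_of_safe hσ h.1, Expr.fits_of_safe hσ h.2⟩
  | .mul _ _, h => ⟨Expr.fits_of_safe hσ h.1, Expr.fits_of_safe hσ h.2.1, h.2.2⟩
  | .div _ _, h => ⟨Expr.fits_of_safe hσ h.1, Expr.fits_of_safe hσ h.2⟩
  | .mod _ _, h => ⟨Expr.fits_of_safe hσ h.1, Expr.fits_of_safe hσ h.2⟩

theorem Test.fits_of_safe {σ : State} (hσ : Bdd W σ) {b : Test} (h : b.Safe W σ) :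
    b.Fits W σ := by
  induction b with
  | lt | eq | distLe => exact ⟨Expr.fits_of_safe hσ h.1, Expr.fits_of_safe hσ h.2⟩
  | not b ih => exact ih h
  | and _ _ ih₁ ih₂ => exact ⟨ih₁ h.1, ih₂ h.2⟩

theorem Expr.eval_lt {σ : State} : ∀ {e : Expr}, e.Fits W σ → e.eval σ < 2 ^ W
  | .const _, h => h
  | .var _, h => h
  | .get _ _, h => h.2
  | .add _ _, h => h.2.2
  | .sub _ _, h => (Nat.sub_le _ _).trans_lt (Expr.eval_lt h.1)
  | .mul _ _, h => h.2.2
  | .div _ _, h => (Nat.div_le_self _ _).trans_lt (Expr.eval_lt h.1)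
  | .mod _ _, h => (Nat.mod_le _ _).trans_lt (Expr.eval_lt h.1)

theorem Bdd.setVar {σ : State} (hσ : Bdd W σ) {x c : ℕ} (hc : c < 2 ^ W) :
    Bdd W (σ.setVar x c) := by
  refine ⟨fun y => ?_, hσ.2⟩
  simp only [State.setVar, Function.update_apply]
  split_ifs
  exacts [hc, hσ.1 y]

theorem Bdd.setArr {σ : State} (hσ : Bdd W σ) {a i c : ℕ} (hc : c < 2 ^ W) :
    Bdd W (σ.setArr a i c) := by
  refine ⟨hσ.1, fun b j => ?_⟩
  simp only [State.setArr, Function.update_apply]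
  split_ifs
  · simp only [Function.update_apply]
    split_ifs
    exacts [hc, hσ.2 a j]
  · exact hσ.2 b j

theorem Bdd.exec {p : Program} {σ σ' : State} {t : ℕ} (h : Exec W D p σ t σ') (hσ : Bdd W σ) :
    Bdd W σ' := by
  induction h with
  | skip => exact hσ
  | assign _ _ _ he => exact hσ.setVar (Expr.eval_lt he)
  | store _ _ _ _ _ he => exact hσ.setArr (Expr.eval_lt he)
  | seq _ _ ih₁ ih₂ => exact ih₂ (ih₁ hσ)
  | ite_true _ _ _ ih => exact ih hσ
  | ite_false _ _ _ ih => exact ih hσ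
  | loop_true _ _ _ _ ih₁ ih₂ => exact ih₂ (ih₁ hσ)
  | loop_false => exact hσ

/-- The variables a program may assign to. -/
def Program.wv : Program → List ℕ
  | .skip => []
  | .assign x _ => [x]
  | .store _ _ _ => []
  | .seq p q => p.wv ++ q.wv
  | .ite _ p q => p.wv ++ q.wv
  | .loop _ p => p.wv

/-- The arrays a program may write to. -/
def Program.wa : Program → List ℕ
  | .skip => []
  | .assign _ _ => []
  | .store a _ _ => [a]
  | .seq p q => p.wa ++ q.wa
  | .ite _ p q => p.wa ++ q.wa
  | .loop _ p => p.wa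

/-- The states agree outside of the variables `vs` and the arrays `as`. -/
def Agree (vs as : List ℕ) (σ σ' : State) : Prop :=
  (∀ x, x ∉ vs → σ'.var x = σ.var x) ∧ ∀ a, a ∉ as → σ'.arr a = σ.arr a

theorem Agree.refl (vs as : List ℕ) (σ : State) : Agree vs as σ σ :=
  ⟨fun _ _ => rfl, fun _ _ => rfl⟩

theorem Agree.trans {vs as : List ℕ} {σ₁ σ₂ σ₃ : State} (h : Agree vs as σ₁ σ₂)
    (h' : Agree vs as σ₂ σ₃) : Agree vs as σ₁ σ₃ :=
  ⟨fun x hx => (h'.1 x hx).trans (h.1 x hx), fun a ha => (h'.2 a ha).trans (h.2 a ha)⟩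

theorem Agree.mono {vs as vs' as' : List ℕ} {σ σ' : State} (h : Agree vs as σ σ')
    (hv : vs ⊆ vs') (ha : as ⊆ as') : Agree vs' as' σ σ' :=
  ⟨fun x hx => h.1 x fun hx' => hx (hv hx'), fun a hx => h.2 a fun hx' => hx (ha hx')⟩

/-- The frame rule. The write sets are explicit lists, so whether a variable or array survives a
program is settled by `decide`. -/
theorem Exec.agree {p : Program} {σ σ' : State} {t : ℕ} (h : Exec W D p σ t σ') :
    Agree p.wv p.wa σ σ' := by
  induction h with
  | skip => exact Agree.refl _ _ _
  | assign σ x e _ =>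
    refine ⟨fun y hy => ?_, fun _ _ => rfl⟩
    simp only [Program.wv, List.mem_singleton] at hy
    simp [State.setVar, hy]
  | store σ a i e _ _ =>
    refine ⟨fun _ _ => rfl, fun b hb => ?_⟩
    simp only [Program.wa, List.mem_singleton] at hb
    simp [State.setArr, hb]
  | seq _ _ ih₁ ih₂ =>
    exact (ih₁.mono (by simp [Program.wv]) (by simp [Program.wa])).trans
      (ih₂.mono (by simp [Program.wv]) (by simp [Program.wa]))
  | ite_true _ _ _ ih => exact ih.mono (by simp [Program.wv]) (by simp [Program.wa])
  | ite_false _ _ _ ih => exact ih.mono (by simp [Program.wv]) (by simp [Program.wa])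
  | loop_true _ _ _ _ ih₁ ih₂ => exact ih₁.trans ih₂
  | loop_false => exact Agree.refl _ _ _

/-- The program halts, and its running time and final state satisfy `Q`. -/
def Run (W : ℕ) (D : ℕ → ℝ) (p : Program) (σ : State) (Q : ℕ → State → Prop) : Prop :=
  ∃ t σ', Exec W D p σ t σ' ∧ Q t σ'

variable {σ : State} {Q : ℕ → State → Prop}

theorem Run.mono {p : Program} {R : ℕ → State → Prop} (h : Run W D p σ R)
    (hRQ : ∀ t σ', R t σ' → Q t σ') : Run W D p σ Q :=
  let ⟨t, σ', he, hR⟩ := h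
  ⟨t, σ', he, hRQ t σ' hR⟩

theorem run_skip : Run W D .skip σ Q ↔ Q 1 σ := by
  constructor
  · rintro ⟨t, σ', h, hQ⟩
    cases h
    exact hQ
  · exact fun h => ⟨1, σ, .skip σ, h⟩

theorem run_assign (hσ : Bdd W σ) {x : ℕ} {e : Expr} (he : e.Safe W σ)
    (hQ : Q (e.cost + 1) (σ.setVar x (e.eval σ))) : Run W D (.assign x e) σ Q :=
  ⟨_, _, .assign σ x e (Expr.fits_of_safe hσ he), hQ⟩

theorem run_store (hσ : Bdd W σ) {a : ℕ} {i e : Expr} (hi : i.Safe W σ) (he : e.Safe W σ)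
    (hQ : Q (i.cost + e.cost + 1) (σ.setArr a (i.eval σ) (e.eval σ))) :
    Run W D (.store a i e) σ Q :=
  ⟨_, _, .store σ a i e (Expr.fits_of_safe hσ hi) (Expr.fits_of_safe hσ he), hQ⟩

/-- Besides the postcondition `R`, the second program receives the word bound and the frame for
free, so postconditions need not mention what is unchanged. -/
theorem Run.seq {p q : Program} {R : ℕ → State → Prop} (hσ : Bdd W σ) (hp : Run W D p σ R)
    (hq : ∀ t σ', R t σ' → Bdd W σ' → Agree p.wv p.wa σ σ' →
      Run W D q σ' fun t' σ'' => Q (t + t') σ'') : Run W D (.seq p q) σ Q := by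
  obtain ⟨t, σ', he, hR⟩ := hp
  obtain ⟨t', σ'', he', hQ⟩ := hq t σ' hR (Bdd.exec he hσ) he.agree
  exact ⟨_, _, .seq he he', hQ⟩

theorem run_assign_seq (hσ : Bdd W σ) {x : ℕ} {e : Expr} {q : Program} (he : e.Safe W σ)
    (hq : Bdd W (σ.setVar x (e.eval σ)) →
      Run W D q (σ.setVar x (e.eval σ)) fun t' σ'' => Q (e.cost + 1 + t') σ'') :
    Run W D (.seq (.assign x e) q) σ Q := by
  obtain ⟨t', σ'', he', hQ⟩ := hq (hσ.setVar (Expr.eval_lt (Expr.fits_of_safe hσ he)))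
  exact ⟨_, _, .seq (.assign σ x e (Expr.fits_of_safe hσ he)) he', hQ⟩

theorem run_store_seq (hσ : Bdd W σ) {a : ℕ} {i e : Expr} {q : Program} (hi : i.Safe W σ)
    (he : e.Safe W σ)
    (hq : Bdd W (σ.setArr a (i.eval σ) (e.eval σ)) →
      Run W D q (σ.setArr a (i.eval σ) (e.eval σ))
        fun t' σ'' => Q (i.cost + e.cost + 1 + t') σ'') :
    Run W D (.seq (.store a i e) q) σ Q := by
  obtain ⟨t', σ'', he', hQ⟩ := hq (hσ.setArr (Expr.eval_lt (Expr.fits_of_safe hσ he)))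
  exact ⟨_, _, .seq (.store σ a i e (Expr.fits_of_safe hσ hi) (Expr.fits_of_safe hσ he)) he', hQ⟩

theorem run_ite (hσ : Bdd W σ) {b : Test} {p q : Program} (hb : b.Safe W σ)
    (hp : b.Holds D σ → Run W D p σ fun t σ' => Q (b.cost + 1 + t) σ')
    (hq : ¬ b.Holds D σ → Run W D q σ fun t σ' => Q (b.cost + 1 + t) σ') :
    Run W D (.ite b p q) σ Q := by
  by_cases h : b.Holds D σ
  · obtain ⟨t, σ', he, hQ⟩ := hp h
    exact ⟨_, _, .ite_true (Test.fits_of_safe hσ hb) h he, hQ⟩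
  · obtain ⟨t, σ', he, hQ⟩ := hq h
    exact ⟨_, _, .ite_false (Test.fits_of_safe hσ hb) h he, hQ⟩

/-- `p` is executed with the variable `i` running through the numbers less than the variable `m`. -/
def Program.forLoop (i m : ℕ) (p : Program) : Program :=
  .seq (.assign i (.const 0))
    (.loop (.lt (.var i) (.var m)) (.seq p (.assign i (.add (.var i) (.const 1)))))

/-- The rule for loops with amortized running time: `Φ` is the potential. -/
theorem run_forLoop_amortized {i m T c : ℕ} {p : Program} (hσ : Bdd W σ)
    (I : ℕ → State → Prop) (Φ : State → ℕ) (hc : σ.var m = c)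
    (hi : i ∉ p.wv) (hm : m ∉ p.wv) (him : m ≠ i)
    (hΦ : ∀ τ j, Φ (τ.setVar i j) = Φ τ)
    (h0 : I 0 (σ.setVar i 0))
    (hstep : ∀ j τ, j < c → Bdd W τ → Agree (i :: p.wv) p.wa σ τ → τ.var i = j → I j τ →
      Run W D p τ fun t τ' => t + Φ τ' ≤ T + Φ τ ∧ I (j + 1) (τ'.setVar i (j + 1)))
    (hQ : ∀ t τ, t + Φ τ ≤ c * (T + 8) + 6 + Φ σ → Bdd W τ → Agree (i :: p.wv) p.wa σ τ →
      τ.var i = c → I c τ → Q t τ) :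
    Run W D (.forLoop i m p) σ Q := by
  have h1 : (0 : ℕ) < 2 ^ W := (Nat.zero_le _).trans_lt (hσ.1 0)
  -- The test costs 4 steps and the increment 4, hence `T + 8` per iteration; the initial assignment
  -- (2) and the failing last test (4) give the constant 6.
  have main : ∀ r j τ, j + r = c → Bdd W τ → Agree (i :: p.wv) p.wa σ τ → τ.var i = j → I j τ →
      Run W D (.loop (.lt (.var i) (.var m)) (.seq p (.assign i (.add (.var i) (.const 1))))) τ
        fun t τ' => t + Φ τ' ≤ r * (T + 8) + 4 + Φ τ ∧ Bdd W τ' ∧ Agree (i :: p.wv) p.wa σ τ' ∧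
          τ'.var i = c ∧ I c τ' := by
    intro r
    induction r with
    | zero =>
      intro j τ hj hτ hA hij hI
      have hmc : τ.var m = c := by rw [hA.1 m (by simp [him, hm]), hc]
      refine ⟨_, _, .loop_false (Test.fits_of_safe hτ ⟨trivial, trivial⟩) ?_, ?_, hτ, hA, ?_, ?_⟩
      · simp [Test.Holds, Expr.eval, hij, hmc]; omega
      · simp [Test.cost, Expr.cost]
      · omega
      · rwa [show c = j by omega]
    | succ r ih =>
      intro j τ hj hτ hA hij hI
      have hmc : τ.var m = c := by rw [hA.1 m (by simp [him, hm]), hc]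
      obtain ⟨t, τ', he, ht, hI'⟩ := hstep j τ (by omega) hτ hA hij hI
      have hτ' := Bdd.exec he hτ
      have hij' : τ'.var i = j := by rw [he.agree.1 i hi, hij]
      have hcW : c < 2 ^ W := hmc ▸ hτ.1 m
      have hsafe : (Expr.add (.var i) (.const 1)).Safe W τ' := by
        simp only [Expr.Safe, Expr.eval, hij', true_and]; omega
      have hj1 : (Expr.add (.var i) (.const 1)).eval τ' = j + 1 := by simp [Expr.eval, hij']
      have he2 := Exec.assign (D := D) τ' i _ (Expr.fits_of_safe hτ' hsafe)
      rw [hj1] at he2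
      have hA' : Agree (i :: p.wv) p.wa σ (τ'.setVar i (j + 1)) := by
        refine hA.trans ((he.agree.mono (by simp) (by simp)).trans ⟨fun x hx => ?_, fun _ _ => rfl⟩)
        have : x ≠ i := fun h => hx (by simp [h])
        simp [State.setVar, this]
      obtain ⟨t', τ'', he', ht', hR⟩ := ih (j + 1) (τ'.setVar i (j + 1)) (by omega)
        (Bdd.exec he2 hτ') hA' (by simp [State.setVar]) hI'
      refine ⟨_, _, .loop_true (Test.fits_of_safe hτ ⟨trivial, trivial⟩) ?_ (.seq he he2) he', ?_, hR⟩
      · simp [Test.Holds, Expr.eval, hij, hmc]; omega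
      · rw [hΦ] at ht'
        simp only [Test.cost, Expr.cost]
        rw [Nat.succ_mul]
        omega
  have he1 := Exec.assign (D := D) σ i (.const 0) (show (0 : ℕ) < 2 ^ W from h1)
  obtain ⟨t, τ, he, ht, hR⟩ := main c 0 (σ.setVar i 0) (by omega) (hσ.setVar h1)
    ⟨fun x hx => by
      have : x ≠ i := fun h => hx (by simp [h])
      simp [State.setVar, this], fun _ _ => rfl⟩ (by simp [State.setVar]) h0
  refine ⟨_, _, .seq he1 he, hQ _ _ ?_ hR.1 hR.2.1 hR.2.2.1 hR.2.2.2⟩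
  rw [hΦ] at ht
  simp only [Expr.cost]
  omega

/-- The rule for loops all of whose iterations take at most `T` steps. -/
theorem run_forLoop {i m c : ℕ} {p : Program} (T : ℕ) (hσ : Bdd W σ)
    (I : ℕ → State → Prop) (hc : σ.var m = c)
    (hi : i ∉ p.wv) (hm : m ∉ p.wv) (him : m ≠ i)
    (h0 : I 0 (σ.setVar i 0))
    (hstep : ∀ j τ, j < c → Bdd W τ → Agree (i :: p.wv) p.wa σ τ → τ.var i = j → I j τ →
      Run W D p τ fun t τ' => t ≤ T ∧ I (j + 1) (τ'.setVar i (j + 1)))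
    (hQ : ∀ t τ, t ≤ c * (T + 8) + 6 → Bdd W τ → Agree (i :: p.wv) p.wa σ τ →
      τ.var i = c → I c τ → Q t τ) :
    Run W D (.forLoop i m p) σ Q :=
  run_forLoop_amortized hσ I (fun _ => 0) hc hi hm him (fun _ _ => rfl) h0 hstep hQ

@[simp] theorem setVar_var {x c y : ℕ} : (σ.setVar x c).var y = if y = x then c else σ.var y := by
  simp [State.setVar, Function.update_apply]

@[simp] theorem setVar_arr {x c : ℕ} : (σ.setVar x c).arr = σ.arr := rfl

@[simp] theorem setArr_var {a i c : ℕ} : (σ.setArr a i c).var = σ.var := rfl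

@[simp] theorem setArr_arr {a i c b : ℕ} :
    (σ.setArr a i c).arr b = if b = a then Function.update (σ.arr a) i c else σ.arr b := by
  simp only [State.setArr, Function.update_apply]

end RAM

/-! ### Farthest-first traversal. -/

namespace RAM
variable {W : ℕ} {D : ℕ → ℝ}

/-- Farthest-first traversal: array `10` receives the `k` selected points; entry `v` of array `11` is
the position of the distance of `v` to the nearest point selected so far. -/
def farthestFirst : Program :=
  .forLoop 8 1
    (.assign 10 (.const 0) ;;
    .forLoop 9 0
      (.ite (.distLe (.get 11 (.var 9)) (.get 11 (.var 10))) .skip (.assign 10 (.var 9))) ;;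
    .store 10 (.var 8) (.var 10) ;;
    .forLoop 9 0
      (.ite (.and (.not (.eq (.var 8) (.const 0)))
          (.distLe (.get 11 (.var 9)) (.add (.mul (.var 9) (.var 0)) (.var 10))))
        .skip
        (.store 11 (.var 9) (.add (.mul (.var 9) (.var 0)) (.var 10)))))

theorem mul_add_lt_mul {a b n m : ℕ} (ha : a < m) (hb : b < n) : a * n + b < m * n :=
  calc a * n + b < a * n + n := by omega
    _ = (a + 1) * n := by ring
    _ ≤ m * n := Nat.mul_le_mul_right _ ha

/-- The invariant after `j` rounds: the distance `D (τ.arr 11 v)` of `v` to the selected points is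
at most the distance between any two selected points. The array `11` holds no distances before the
first round, so in that round the first point is arbitrary and the test on variable `8` forces all
entries to be overwritten. -/
theorem run_farthestFirst {σ : State} {n k : ℕ} (hσ : Bdd W σ) (hn : 0 < n) (h0 : σ.var 0 = n)
    (h1 : σ.var 1 = k) (hW : n * n < 2 ^ W) :
    Run W D farthestFirst σ fun t τ => t ≤ k * (45 * n + 25) + 6 ∧
      (∀ i < k, τ.arr 10 i < n) ∧
      (0 < k → ∀ v < n, ∃ i < k, ∀ b < k, ∀ a < b,
        D (v * n + τ.arr 10 i) ≤ D (τ.arr 10 b * n + τ.arr 10 a)) := by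
  have hW0 : 0 < 2 ^ W := by omega
  have hsafe : ∀ u v, u < n → v < n → u * n < 2 ^ W ∧ u * n + v < 2 ^ W := fun u v hu hv => by
    have := mul_add_lt_mul hu hv
    omega
  refine run_forLoop (45 * n + 17) hσ (fun j τ => (∀ i < j, τ.arr 10 i < n) ∧
    (0 < j → ∀ v < n, (∃ i < j, τ.arr 11 v = v * n + τ.arr 10 i) ∧
      (∀ i < j, D (τ.arr 11 v) ≤ D (v * n + τ.arr 10 i)) ∧
      ∀ b < j, ∀ a < b, D (τ.arr 11 v) ≤ D (τ.arr 10 b * n + τ.arr 10 a))) h1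
    (by decide) (by decide) (by decide) (by simp) ?_ ?_
  · intro j τ hj hτ hA hi hI
    have hn0 : τ.var 0 = n := by rw [hA.1 0 (by decide), h0]
    refine run_assign_seq hτ hW0 fun hB => ?_
    refine Run.seq hB (run_forLoop 8 hB (fun v ρ => ρ.var 10 < n ∧
      ∀ u < v, D (τ.arr 11 u) ≤ D (τ.arr 11 (ρ.var 10)))
      (show _ = n by simp [hn0]) (by decide) (by decide) (by decide) (by simp [Expr.eval, hn]) ?_
      (Q := fun t ρ => t ≤ n * 16 + 6 ∧ ρ.var 10 < n ∧
        ∀ u < n, D (τ.arr 11 u) ≤ D (τ.arr 11 (ρ.var 10))) ?_) ?_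
    · intro v ρ hv hρ hA' hv9 hI'
      have h11 : ρ.arr 11 = τ.arr 11 := by rw [hA'.2 11 (by decide)]; simp
      refine run_ite hρ ⟨trivial, trivial⟩ (fun hh => run_skip.2 ?_)
        (fun hh => run_assign hρ trivial ?_)
      · simp only [Test.Holds, Expr.eval, h11, hv9] at hh
        refine ⟨by simp [Test.cost, Expr.cost], by simpa using hI'.1, fun u hu => ?_⟩
        obtain hu | rfl := Nat.lt_succ_iff_lt_or_eq.1 hu
        · simpa using hI'.2 u hu
        · simpa using hh
      · simp only [Test.Holds, Expr.eval, h11, hv9] at hh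
        refine ⟨by simp [Test.cost, Expr.cost], by simpa [Expr.eval, hv9] using hv, fun u hu => ?_⟩
        obtain hu | rfl := Nat.lt_succ_iff_lt_or_eq.1 hu
        · simpa [Expr.eval, hv9] using (hI'.2 u hu).trans (not_le.1 hh).le
        · simp [Expr.eval, hv9]
    · exact fun t ρ ht _ _ _ hI' => ⟨ht, hI'⟩
    · rintro t ρ ⟨ht, hf, hmax⟩ hρ hA'
      have hj8 : ρ.var 8 = j := by rw [hA'.1 8 (by decide)]; simp [hi]
      have h11 : ρ.arr 11 = τ.arr 11 := by rw [hA'.2 11 (by decide)]; simp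
      have h10 : ρ.arr 10 = τ.arr 10 := by rw [hA'.2 10 (by decide)]; simp
      have hn0' : ρ.var 0 = n := by rw [hA'.1 0 (by decide)]; simp [hn0]
      obtain ⟨f, hf10⟩ : ∃ f, ρ.var 10 = f := ⟨_, rfl⟩
      rw [hf10] at hf hmax
      refine run_store_seq hρ trivial trivial fun hB' => ?_
      simp only [Expr.eval, hj8, hf10] at hB' ⊢
      refine run_forLoop 21 hB' (fun v ρ' =>
        (∀ u < v, (ρ'.arr 11 u = u * n + f ∨ 0 < j ∧ ρ'.arr 11 u = τ.arr 11 u) ∧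
          D (ρ'.arr 11 u) ≤ D (u * n + f) ∧ (0 < j → D (ρ'.arr 11 u) ≤ D (τ.arr 11 u))) ∧
        ∀ u, v ≤ u → ρ'.arr 11 u = τ.arr 11 u)
        (show _ = n by simp [hn0']) (by decide) (by decide) (by decide) (by simp [h11]) ?_ ?_
      · intro v ρ' hv hρ' hA'' hv9 hI'
        have e0 : ρ'.var 0 = n := by rw [hA''.1 0 (by decide)]; simp [hn0']
        have e10 : ρ'.var 10 = f := by rw [hA''.1 10 (by decide)]; simp [hf10]
        have e8 : ρ'.var 8 = j := by rw [hA''.1 8 (by decide)]; simp [hj8]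
        have hs : (Expr.add (.mul (.var 9) (.var 0)) (.var 10)).Safe W ρ' := by
          simpa [Expr.Safe, Expr.eval, e0, e10, hv9] using hsafe v f hv hf
        have hstep : ∀ x, (x = v * n + f ∨ 0 < j ∧ x = τ.arr 11 v) → D x ≤ D (v * n + f) →
            (0 < j → D x ≤ D (τ.arr 11 v)) → (∀ u < v + 1,
              (Function.update (ρ'.arr 11) v x u = u * n + f ∨
                0 < j ∧ Function.update (ρ'.arr 11) v x u = τ.arr 11 u) ∧
              D (Function.update (ρ'.arr 11) v x u) ≤ D (u * n + f) ∧
              (0 < j → D (Function.update (ρ'.arr 11) v x u) ≤ D (τ.arr 11 u))) ∧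
            ∀ u, v + 1 ≤ u → Function.update (ρ'.arr 11) v x u = τ.arr 11 u := by
          intro x hx hx1 hx2
          refine ⟨fun u hu => ?_, fun u hu => ?_⟩
          · obtain hu | rfl := Nat.lt_succ_iff_lt_or_eq.1 hu
            · simpa [Function.update_apply, hu.ne] using hI'.1 u hu
            · simpa using ⟨hx, hx1, hx2⟩
          · rw [Function.update_of_ne (by omega)]
            exact hI'.2 u (by omega)
        refine run_ite hρ' ⟨⟨trivial, hW0⟩, trivial, hs⟩ (fun hh => run_skip.2 ?_)
          (fun hh => run_store hρ' trivial hs ?_)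
        · refine ⟨by simp [Test.cost, Expr.cost], ?_⟩
          simp only [Test.Holds, Expr.eval, hv9, e0, e8, e10, hI'.2 v le_rfl] at hh
          have := hstep (ρ'.arr 11 v) (.inr ⟨by omega, hI'.2 v le_rfl⟩)
            (by rw [hI'.2 v le_rfl]; exact hh.2) (by simp [hI'.2 v le_rfl])
          simpa only [Function.update_eq_self, setVar_arr] using this
        · refine ⟨by simp [Test.cost, Expr.cost], ?_⟩
          simp only [Test.Holds, Expr.eval, hv9, e0, e8, e10, hI'.2 v le_rfl, not_and, not_le] at hh
          simpa [Expr.eval, hv9, e0, e10] using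
            hstep (v * n + f) (.inl rfl) le_rfl fun hj => (hh (by omega)).le
      · intro t' ρ' ht' hρ' hA'' _ hI'
        have e10 : ρ'.arr 10 = Function.update (τ.arr 10) j f := by
          rw [hA''.2 10 (by decide)]; simp [h10]
        refine ⟨by simp only [Expr.cost]; omega, ?_⟩
        simp only [setVar_arr, e10]
        have hlt : ∀ i < j, Function.update (τ.arr 10) j f i = τ.arr 10 i := fun i hi =>
          Function.update_of_ne hi.ne _ _
        refine ⟨fun i hi => ?_, fun _ v hv => ?_⟩
        · obtain hi | rfl := Nat.lt_succ_iff_lt_or_eq.1 hi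
          · rw [hlt i hi]; exact hI.1 i hi
          · simpa using hf
        obtain ⟨h_a, h_b, h_c⟩ := hI'.1 v hv
        refine ⟨?_, ?_, ?_⟩
        · obtain h | ⟨hj0, h⟩ := h_a
          · exact ⟨j, by omega, by simpa using h⟩
          · obtain ⟨i, hi, he⟩ := (hI.2 hj0 v hv).1
            exact ⟨i, by omega, by rw [hlt i hi, h, he]⟩
        · intro i hi
          obtain hi | rfl := Nat.lt_succ_iff_lt_or_eq.1 hi
          · rw [hlt i hi]
            exact (h_c (by omega)).trans ((hI.2 (by omega) v hv).2.1 i hi)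
          · simpa using h_b
        · intro b hb a ha
          rw [hlt a (by omega)]
          obtain hb | rfl := Nat.lt_succ_iff_lt_or_eq.1 hb
          · rw [hlt b hb]
            exact (h_c (by omega)).trans ((hI.2 (by omega) v hv).2.2 b hb a ha)
          -- A pair consisting of the new point `f` and an earlier one: `f` maximized the old
          -- distance to the selection, and that distance is at most its distance to each earlier
          -- point.
          · rw [Function.update_self]
            exact ((h_c (by omega)).trans (hmax v hv)).trans ((hI.2 (by omega) f hf).2.1 a ha)
  · intro t τ ht _ _ _ hI
    refine ⟨by linarith, hI.1, fun hk v hv => ?_⟩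
    obtain ⟨⟨i, hi, he⟩, -, hp⟩ := hI.2 hk v hv
    exact ⟨i, hi, he ▸ hp⟩
end RAM

/-! ### Merging equally labelled clusters. -/

/-- The edges of `G` whose ends have the same label. -/
def labelGraph {V : Type} (G : SimpleGraph V) (lab : V → ℕ) : SimpleGraph V where
  Adj u v := G.Adj u v ∧ lab u = lab v
  symm := ⟨fun _ _ h => ⟨h.1.symm, h.2.symm⟩⟩
  loopless := ⟨fun _ h => G.irrefl h.1⟩

/-- `rep` maps every vertex to the representative of its cluster; there are `c` clusters, each
connected and with a common label. -/
structure IsMerging {n : ℕ} (G : SimpleGraph (Fin n)) (lab rep : ℕ → ℕ) (c : ℕ) : Prop where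
  lt : ∀ v < n, rep v < n
  idem : ∀ v < n, rep (rep v) = rep v
  lab_rep : ∀ v < n, lab (rep v) = lab v
  connected : ∀ r < n, rep r = r → (G.induce {v : Fin n | rep v = r}).Connected
  card : ((Finset.range n).filter fun r => rep r = r).card = c

theorem IsMerging.id {n : ℕ} (G : SimpleGraph (Fin n)) (lab : ℕ → ℕ) {rep : ℕ → ℕ}
    (h : ∀ v < n, rep v = v) : IsMerging G lab rep n where
  lt v hv := by rwa [h v hv]
  idem v hv := by rw [h v hv, h v hv]
  lab_rep v hv := by rw [h v hv]
  connected r hr _ := by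
    have : {v : Fin n | rep v = r} = {⟨r, hr⟩} := by
      ext v
      simp [h v v.2, Fin.ext_iff]
    rw [this]
    have : Nonempty ({⟨r, hr⟩} : Set (Fin n)) := ⟨⟨⟨r, hr⟩, rfl⟩⟩
    exact ⟨fun _ _ => SimpleGraph.Reachable.of_subsingleton⟩
  card := by
    rw [Finset.filter_true_of_mem fun r hr => h r (by simpa using hr), Finset.card_range]

/-- Two connected sets joined by an edge have a connected union, and `rep b` is the only
representative that disappears. -/
theorem IsMerging.merge {n : ℕ} {G : SimpleGraph (Fin n)} {lab rep rep' : ℕ → ℕ} {c : ℕ}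
    (h : IsMerging G lab rep c) {a b : Fin n} (hab : G.Adj a b) (hlab : lab a = lab b)
    (hne : rep a ≠ rep b) (hrep : ∀ v < n, rep' v = if rep v = rep b then rep a else rep v) :
    IsMerging G lab rep' (c - 1) where
  lt v hv := by
    rw [hrep v hv]
    split_ifs
    exacts [h.lt _ a.2, h.lt v hv]
  idem v hv := by
    rw [hrep v hv]
    split_ifs with h1
    · rw [hrep _ (h.lt _ a.2), h.idem _ a.2, if_neg hne]
    · rw [hrep _ (h.lt _ hv), h.idem _ hv, if_neg h1]
  lab_rep v hv := by
    rw [hrep v hv]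
    split_ifs with h1
    · rw [h.lab_rep _ a.2, hlab, ← h.lab_rep _ b.2, ← h1, h.lab_rep _ hv]
    · rw [h.lab_rep _ hv]
  connected r hr hr' := by
    rw [hrep r hr] at hr'
    by_cases hra : r = rep a
    · have : {v : Fin n | rep' v = r} = {v : Fin n | rep v = rep a} ∪ {v : Fin n | rep v = rep b} := by
        ext v
        simp only [Set.mem_ofPred_eq, Set.mem_union, hrep v v.2]
        split_ifs with h1 <;> simp [h1, hra]
      rw [this]
      exact SimpleGraph.connected_induce_union
        (h.connected _ (h.lt _ a.2) (h.idem _ a.2)).preconnected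
        (h.connected _ (h.lt _ b.2) (h.idem _ b.2)).preconnected rfl rfl hab
    · split_ifs at hr' with h1
      · exact absurd hr'.symm hra
      · have : {v : Fin n | rep' v = r} = {v : Fin n | rep v = r} := by
          ext v
          simp only [Set.mem_ofPred_eq, hrep v v.2]
          split_ifs with h2
          · constructor
            · intro h3; exact absurd h3.symm hra
            · intro h3; exact absurd (by rw [hr', ← h3, h2]) h1
          · rfl
        rw [this]
        exact h.connected r hr hr'
  card := by
    rw [← h.card, ← Finset.card_erase_of_mem (a := rep b)
      (by simp [h.lt b b.2, h.idem b b.2])]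
    congr 1
    ext r
    simp only [Finset.mem_filter, Finset.mem_range, Finset.mem_erase]
    constructor
    · rintro ⟨hr, hr'⟩
      rw [hrep r hr] at hr'
      split_ifs at hr' with h1
      · rw [← hr', h.idem a a.2] at h1; exact absurd h1 hne
      · exact ⟨fun h2 => h1 (by rw [hr', h2]), hr, hr'⟩
    · rintro ⟨h1, hr, h2⟩
      exact ⟨hr, by rw [hrep r hr, if_neg (by rwa [h2]), h2]⟩

/-- If no equally labelled edge is left between two clusters, representatives are constant along
paths of `labelGraph`. Hence a set that meets every component also meets every cluster. -/
theorem IsMerging.le_card_of_hitting {n : ℕ} {G : SimpleGraph (Fin n)} {lab rep : ℕ → ℕ} {c : ℕ}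
    (h : IsMerging G lab rep c)
    (hadj : ∀ u v : Fin n, G.Adj u v → lab u = lab v → rep u = rep v) {Z : Finset (Fin n)}
    (hZ : ∀ v, ∃ z ∈ Z, (labelGraph G fun v => lab v).Reachable v z) : c ≤ Z.card := by
  have hreach : ∀ u v : Fin n, (labelGraph G fun v => lab v).Reachable u v → rep u = rep v := by
    intro u v huv
    rw [SimpleGraph.reachable_iff_reflTransGen] at huv
    induction huv with
    | refl => rfl
    | tail _ hbc ih => exact ih.trans (hadj _ _ hbc.1 hbc.2)
  rw [← h.card]
  refine (Finset.card_le_card (t := Z.image fun z : Fin n => rep z) fun r hr => ?_).trans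
    Finset.card_image_le
  simp only [Finset.mem_filter, Finset.mem_range] at hr
  obtain ⟨z, hz, hr'⟩ := hZ ⟨r, hr.1⟩
  exact Finset.mem_image.2 ⟨z, hz, by rw [← hreach _ _ hr']; exact hr.2⟩

/-- Numbering the clusters of a merging. -/
theorem IsMerging.exists_clustering {n k : ℕ} {G : SimpleGraph (Fin n)} {lab rep num cen : ℕ → ℕ}
    (h : IsMerging G lab rep k) (hnum : ∀ r < n, rep r = r → num r < k ∧ cen (num r) = r)
    (hcen : ∀ i < k, cen i < n ∧ rep (cen i) = cen i ∧ num (cen i) = i) :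
    ∃ S : ConnectedClustering G k, (∀ v : Fin n, num (rep v) = S.cluster v) ∧
      (∀ i : Fin k, cen i = S.center i) ∧ ∀ v : Fin n, lab v = lab (S.center (S.cluster v)) := by
  refine ⟨⟨fun v => ⟨num (rep v), (hnum _ (h.lt v v.2) (h.idem v v.2)).1⟩,
    fun i => ⟨cen i, (hcen i i.2).1⟩, fun i => ?_, fun i => ?_⟩, fun v => rfl, fun i => rfl, ?_⟩
  · have hset : {v : Fin n | rep v = cen i} =
        {v : Fin n | (⟨num (rep v), (hnum _ (h.lt v v.2) (h.idem v v.2)).1⟩ : Fin k) = i} := by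
      ext v
      simp only [Fin.ext_iff, Set.mem_ofPred_eq]
      constructor
      · intro h1; rw [h1, (hcen i i.2).2.2]
      · intro h1; rw [← h1, (hnum _ (h.lt v v.2) (h.idem v v.2)).2]
    exact hset ▸ h.connected (cen i) (hcen i i.2).1 (hcen i i.2).2.1
  · ext
    simp [(hcen i i.2).2.1, (hcen i i.2).2.2]
  · intro v
    simp [(hnum _ (h.lt v v.2) (h.idem v v.2)).2, h.lab_rep v v.2]

namespace RAM
variable {W : ℕ} {D : ℕ → ℝ}

/-- Merges the clusters of the variables `8` and `10` if these vertices are adjacent and have the same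
label and if there are still more than `k` clusters. -/
def tryMerge : Program :=
  .ite (.and (.and (.eq (.get 0 (.add (.mul (.var 8) (.var 0)) (.var 10))) (.const 1))
      (.eq (.get 18 (.var 8)) (.get 18 (.var 10))))
      (.and (.not (.eq (.get 19 (.var 8)) (.get 19 (.var 10)))) (.lt (.var 1) (.var 9))))
    (.assign 11 (.get 19 (.var 8)) ;;
    .assign 12 (.get 19 (.var 10)) ;;
    .forLoop 13 0
      (.ite (.eq (.get 19 (.var 13)) (.var 12)) (.store 19 (.var 13) (.var 11)) .skip) ;;
    .assign 9 (.sub (.var 9) (.const 1)))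
    .skip

/-- Starting with singletons, merges clusters with the same label (array `18`) along edges while
there are more than `k` clusters.  Array `19` receives the representatives of the clusters, variable
`9` their number. -/
def mergeClusters : Program :=
  .forLoop 8 0 (.store 19 (.var 8) (.var 8)) ;;
  .assign 9 (.var 0) ;;
  .forLoop 8 0 (.forLoop 10 0 tryMerge)

/-- Writes the clusters to the arrays `8` and `9`. -/
def outputClusters : Program :=
  .assign 10 (.const 0) ;;
  .forLoop 8 0
    (.ite (.eq (.get 19 (.var 8)) (.var 8))
      (.store 9 (.var 10) (.var 8) ;;
      .store 20 (.var 8) (.var 10) ;;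
      .assign 10 (.add (.var 10) (.const 1)))
      .skip) ;;
  .forLoop 8 0 (.store 8 (.var 8) (.get 20 (.get 19 (.var 8)))) ;;
  .ite (.eq (.var 9) (.var 1)) (.assign 4 (.const 1)) (.assign 4 (.const 0))

/-- Relabelling a cluster takes time linear in `n` but lowers the number of clusters by one; it is
paid by the potential `16 * n + 40` per cluster, so that every call has amortized cost at most 40.
Clusters only grow, so equal representatives stay equal. -/
theorem run_tryMerge {σ : State} {n k c : ℕ} {G : SimpleGraph (Fin n)} {lab : ℕ → ℕ}
    (hσ : Bdd W σ) (h0 : σ.var 0 = n) (h1 : σ.var 1 = k) (hW : n * n < 2 ^ W)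
    (hG : ∀ u v : Fin n, σ.arr 0 (u * n + v) = 1 ↔ G.Adj u v) (hl : σ.arr 18 = lab)
    (h9 : σ.var 9 = c) (hk : k ≤ c) (hm : IsMerging G lab (σ.arr 19) c)
    {u v : ℕ} (hu : u < n) (hv : v < n) (h8 : σ.var 8 = u) (h10 : σ.var 10 = v) :
    Run W D tryMerge σ fun t τ => t + τ.var 9 * (16 * n + 40) ≤ 40 + c * (16 * n + 40) ∧
      k ≤ τ.var 9 ∧ IsMerging G lab (τ.arr 19) (τ.var 9) ∧
      (τ.var 9 = k ∨ (σ.arr 0 (u * n + v) = 1 → lab u = lab v → τ.arr 19 u = τ.arr 19 v)) ∧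
      (∀ x < n, ∀ y < n, σ.arr 19 x = σ.arr 19 y → τ.arr 19 x = τ.arr 19 y) ∧
      τ.var 9 ≤ c := by
  have hW1 : 1 < 2 ^ W := by nlinarith [hσ.1 0, hσ.1 9, mul_add_lt_mul hu hv]
  have hs : u * n < 2 ^ W ∧ u * n + v < 2 ^ W := by
    have := mul_add_lt_mul hu hv; omega
  refine run_ite hσ ?_ (fun hh => ?_) (fun hh => run_skip.2 ?_)
  · simp only [Test.Safe, Expr.Safe, Expr.eval, h8, h10, h0]
    exact ⟨⟨⟨⟨⟨trivial, trivial, hs.1⟩, trivial, hs.2⟩, hW1⟩, trivial, trivial⟩, ⟨trivial, trivial⟩,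
      trivial, trivial⟩
  · simp only [Test.Holds, Expr.eval, h8, h10, h0, h1, h9, hl] at hh
    obtain ⟨⟨hadj, hlab⟩, hne, hkc⟩ := hh
    refine run_assign_seq hσ trivial fun hB => run_assign_seq hB trivial fun hB' => ?_
    simp only [Expr.eval, h8, h10, setVar_arr, setVar_var] at hB' ⊢
    simp only [Nat.reduceEqDiff, if_false] at hB' ⊢
    refine Run.seq hB' (run_forLoop 8 hB' (fun j τ => ∀ x, τ.arr 19 x =
      if x < j ∧ σ.arr 19 x = σ.arr 19 v then σ.arr 19 u else σ.arr 19 x) (c := n)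
      (by simp [h0]) (by decide) (by decide) (by decide) (by simp) ?_
      (Q := fun t τ => t ≤ n * 16 + 6 ∧ ∀ x < n, τ.arr 19 x =
      if σ.arr 19 x = σ.arr 19 v then σ.arr 19 u else σ.arr 19 x) ?_) ?_
    · intro j τ hj hτ hA h13 hI
      have e12 : τ.var 12 = σ.arr 19 v := by rw [hA.1 12 (by decide)]; simp
      have e11 : τ.var 11 = σ.arr 19 u := by rw [hA.1 11 (by decide)]; simp
      refine run_ite hτ ⟨trivial, trivial⟩ (fun hh => run_store hτ trivial trivial ?_)
        (fun hh => run_skip.2 ?_)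
      · simp only [Test.Holds, Expr.eval, h13, e12, hI j, lt_irrefl, false_and, if_false] at hh
        refine ⟨by simp [Test.cost, Expr.cost], fun x => ?_⟩
        simp only [Expr.eval, h13, e11, setVar_arr, setArr_arr, if_true, Function.update_apply]
        by_cases hx : x = j
        · simp [hx, hh]
        · rw [if_neg hx, hI x]
          have : x < j + 1 ↔ x < j := by omega
          simp [this]
      · simp only [Test.Holds, Expr.eval, h13, e12, hI j, lt_irrefl, false_and, if_false] at hh
        refine ⟨by simp [Test.cost, Expr.cost], fun x => ?_⟩
        rw [setVar_arr, hI x]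
        by_cases hx : x = j
        · simp [hx, hh]
        · have : x < j + 1 ↔ x < j := by omega
          simp [this]
    · intro t τ ht _ _ _ hI
      exact ⟨ht, fun x hx => by rw [hI x]; simp [hx]⟩
    · rintro t τ ⟨ht, hI⟩ hτ hA
      have e9 : τ.var 9 = c := by rw [hA.1 9 (by decide)]; simp [h9]
      refine run_assign hτ ⟨trivial, hW1⟩ ?_
      simp only [Expr.eval, Expr.cost, Test.cost, setVar_var, setVar_arr, if_true, e9]
      have hm' := hm.merge (a := ⟨u, hu⟩) (b := ⟨v, hv⟩) ((hG _ _).1 hadj) hlab hne hI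
      obtain ⟨c', rfl⟩ : ∃ c', c = c' + 1 := ⟨c - 1, by omega⟩
      refine ⟨by rw [Nat.add_sub_cancel]; linarith, by omega, hm', .inr fun _ _ => ?_, ?_,
        by omega⟩
      · rw [hI u hu, hI v hv, if_pos rfl, ite_self]
      · intro x hx y hy hxy
        rw [hI x hx, hI y hy, hxy]
  · simp only [Test.Holds, Expr.eval, h8, h10, h0, h1, h9, hl] at hh
    rw [h9]
    refine ⟨by simp [Test.cost, Expr.cost], hk, hm, ?_, fun _ _ _ _ h => h, le_rfl⟩
    by_cases hck : c = k
    · exact .inl hck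
    · refine .inr fun h2 h3 => ?_
      by_contra h4
      exact hh ⟨⟨h2, h3⟩, h4, by omega⟩

/-- One pass over all pairs of vertices suffices because merging never separates vertices. Fewer
than `n` merges can happen, which is why the amortized loop rule yields a quadratic bound. -/
theorem run_mergeClusters {σ : State} {n k : ℕ} {G : SimpleGraph (Fin n)} {lab : ℕ → ℕ}
    (hσ : Bdd W σ) (h0 : σ.var 0 = n) (h1 : σ.var 1 = k) (hkn : k ≤ n) (hW : n * n < 2 ^ W)
    (hG : ∀ u v : Fin n, σ.arr 0 (u * n + v) = 1 ↔ G.Adj u v) (hl : σ.arr 18 = lab) :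
    Run W D mergeClusters σ fun t τ => t ≤ 64 * n * n + 100 * n + 100 ∧
      k ≤ τ.var 9 ∧ IsMerging G lab (τ.arr 19) (τ.var 9) ∧
      (τ.var 9 = k ∨ ∀ u v : Fin n, G.Adj u v → lab u = lab v → τ.arr 19 u = τ.arr 19 v) := by
  refine Run.seq hσ (run_forLoop 3 hσ (fun j τ => ∀ x < j, τ.arr 19 x = x) h0 (by decide) (by decide)
    (by decide) (by simp) ?_ (Q := fun t τ => t ≤ n * 11 + 6 ∧ ∀ x < n, τ.arr 19 x = x) ?_) ?_
  · intro j τ hj hτ hA h8 hI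
    refine run_store hτ trivial trivial ⟨by simp [Expr.cost], fun x hx => ?_⟩
    simp only [Expr.eval, h8, setVar_arr, setArr_arr, if_true, Function.update_apply]
    split_ifs with hxj
    · exact hxj.symm
    · exact hI x (by omega)
  · exact fun t τ ht _ _ _ hI => ⟨ht, hI⟩
  rintro t τ ⟨ht, hI⟩ hτ hA
  have e0 : τ.var 0 = n := by rw [hA.1 0 (by decide), h0]
  have e1 : τ.var 1 = k := by rw [hA.1 1 (by decide), h1]
  have a0 : τ.arr 0 = σ.arr 0 := hA.2 0 (by decide)
  have a18 : τ.arr 18 = lab := by rw [hA.2 18 (by decide), hl]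
  refine run_assign_seq hτ trivial fun hB => ?_
  simp only [Expr.eval, e0] at hB ⊢
  -- `P` describes the pairs treated so far. Once the number of clusters is `k`, merging has stopped
  -- and nothing is claimed about edges.
  let Inv (P : ℕ → ℕ → Prop) (ρ : State) : Prop :=
    k ≤ ρ.var 9 ∧ ρ.var 9 ≤ n ∧ IsMerging G lab (ρ.arr 19) (ρ.var 9) ∧
      (ρ.var 9 = k ∨ ∀ u < n, ∀ v < n, P u v → σ.arr 0 (u * n + v) = 1 → lab u = lab v →
        ρ.arr 19 u = ρ.arr 19 v)
  refine run_forLoop_amortized (T := n * 48 + 6) hB (fun j ρ => Inv (fun u _ => u < j) ρ)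
    (fun ρ => ρ.var 9 * (16 * n + 40)) (c := n) (by simp [e0]) (by decide) (by decide) (by decide)
    (fun _ _ => by simp) ?_ ?_ ?_
  · simp only [Inv, setVar_var, setVar_arr]
    simpa [hkn] using IsMerging.id G lab hI
  · intro j ρ hj hρ hA' h8 hI'
    refine run_forLoop_amortized (T := 40) hρ (fun i ρ => Inv (fun u v => u < j ∨ u = j ∧ v < i) ρ)
      (fun ρ => ρ.var 9 * (16 * n + 40)) (c := n) (by rw [hA'.1 0 (by decide)]; simp [e0])
      (by decide) (by decide) (by decide) (fun _ _ => by simp) ?_ ?_ ?_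
    · simpa [Inv] using hI'
    · rintro i ρ' hi hρ' hA'' h10 ⟨hI1, hI2, hI3, hI4⟩
      have b0 : ρ'.arr 0 = σ.arr 0 := by
        rw [hA''.2 0 (by decide), hA'.2 0 (by decide)]; simp [a0]
      refine (run_tryMerge hρ' (n := n) (k := k) (G := G) (lab := lab) ?_ ?_ hW ?_ ?_ rfl hI1 hI3 hj hi
        ?_ h10).mono ?_
      · rw [hA''.1 0 (by decide), hA'.1 0 (by decide)]; simp [e0]
      · rw [hA''.1 1 (by decide), hA'.1 1 (by decide)]; simp [e1]
      · rwa [b0]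
      · rw [hA''.2 18 (by decide), hA'.2 18 (by decide)]; simp [a18]
      · rw [hA''.1 8 (by decide), h8]
      · rintro t' ρ'' ⟨g1, g2, g3, g4, g5, g6⟩
        refine ⟨g1, ?_⟩
        simp only [Inv, setVar_var, setVar_arr]
        simp only [Nat.reduceEqDiff, if_false]
        refine ⟨g2, g6.trans hI2, g3, ?_⟩
        obtain h | hI4 := hI4
        · exact .inl (by omega)
        obtain g4 | g4 := g4
        · exact .inl g4
        refine .inr fun u hu v hv huv hadj hlab => ?_
        by_cases hP : u < j ∨ u = j ∧ v < i
        · exact g5 u hu v hv (hI4 u hu v hv hP hadj hlab)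
        · obtain ⟨rfl, rfl⟩ : u = j ∧ v = i := by omega
          exact g4 (by rwa [b0]) hlab
    · intro t' ρ' ht' _ _ _ hI''
      refine ⟨ht', ?_⟩
      simp only [Inv, setVar_var, setVar_arr]
      simp only [Nat.reduceEqDiff, if_false]
      refine ⟨hI''.1, hI''.2.1, hI''.2.2.1, hI''.2.2.2.imp id fun h u hu v hv huj => ?_⟩
      exact h u hu v hv (by omega)
  · intro t' ρ ht' _ _ _ hI'
    simp only [setVar_var, if_true] at ht'
    refine ⟨?_, hI'.1, hI'.2.2.1, hI'.2.2.2.imp id fun h u v huv hlab => ?_⟩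
    · simp only [Expr.cost]
      nlinarith
    · exact h u u.2 v v.2 u.2 ((hG u v).2 huv) hlab

/-- Representatives are numbered in increasing order; array `20` maps a representative to its number
and array `9` is the inverse map. The output is a clustering only if there are `k` representatives,
and this is what variable `4` reports. -/
theorem run_outputClusters {σ : State} {n k c : ℕ} {G : SimpleGraph (Fin n)} {lab : ℕ → ℕ}
    (hσ : Bdd W σ) (h0 : σ.var 0 = n) (h1 : σ.var 1 = k) (hn : 1 < n) (hW : n * n < 2 ^ W)
    (h9 : σ.var 9 = c) (hm : IsMerging G lab (σ.arr 19) c) :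
    Run W D outputClusters σ fun t τ => t ≤ 40 * n + 40 ∧ τ.var 4 = (if c = k then 1 else 0) ∧
      (c = k → ∃ S : ConnectedClustering G k, (∀ v : Fin n, τ.arr 8 v = S.cluster v) ∧
        (∀ i : Fin k, τ.arr 9 i = S.center i) ∧
        ∀ v : Fin n, lab v = lab (S.center (S.cluster v))) := by
  have hW1 : n < 2 ^ W := by nlinarith
  refine run_assign_seq hσ (show 0 < 2 ^ W by omega) fun hB => ?_
  refine Run.seq hB (run_forLoop 17 hB (fun j τ =>
    τ.var 10 = ((Finset.range j).filter fun r => σ.arr 19 r = r).card ∧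
    (∀ r < j, σ.arr 19 r = r → τ.arr 20 r < τ.var 10 ∧ τ.arr 9 (τ.arr 20 r) = r) ∧
    ∀ i < τ.var 10, τ.arr 9 i < j ∧ σ.arr 19 (τ.arr 9 i) = τ.arr 9 i ∧ τ.arr 20 (τ.arr 9 i) = i)
    (c := n) (by simp [h0]) (by decide) (by decide) (by decide) (by simp [Expr.eval]) ?_
    (Q := fun t τ => t ≤ n * 25 + 6 ∧
    (∀ r < n, σ.arr 19 r = r → τ.arr 20 r < c ∧ τ.arr 9 (τ.arr 20 r) = r) ∧
    ∀ i < c, τ.arr 9 i < n ∧ σ.arr 19 (τ.arr 9 i) = τ.arr 9 i ∧ τ.arr 20 (τ.arr 9 i) = i) ?_) ?_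
  · rintro j τ hj hτ hA h8 ⟨hI1, hI2, hI3⟩
    have e19 : τ.arr 19 = σ.arr 19 := by rw [hA.2 19 (by decide)]; simp
    refine run_ite hτ ⟨trivial, trivial⟩ (fun hh => ?_) (fun hh => run_skip.2 ?_)
    · simp only [Test.Holds, Expr.eval, h8, e19] at hh
      have hlt : τ.var 10 ≤ j := by
        rw [hI1]
        exact (Finset.card_filter_le _ _).trans (by simp)
      refine run_store_seq hτ trivial trivial fun hB1 => run_store_seq hB1 trivial trivial fun hB2 =>
        run_assign hB2 ⟨trivial, by simp only [Expr.Safe]; omega, ?_⟩ ?_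
      · simp only [Expr.eval, setArr_var]; omega
      · simp only [Expr.eval, Expr.cost, Test.cost, setArr_var, setVar_var, setArr_arr, setVar_arr,
          h8]
        simp only [Nat.reduceEqDiff, if_false, if_true]
        refine ⟨by omega, ?_, ?_, ?_⟩
        · rw [Finset.range_add_one, Finset.filter_insert, if_pos hh, Finset.card_insert_of_notMem
            (by simp), hI1]
        · intro r hr hr'
          by_cases hrj : r = j
          · subst hrj; simp
          · rw [Function.update_of_ne hrj]
            obtain ⟨g1, g2⟩ := hI2 r (by omega) hr'
            rw [Function.update_of_ne (by omega)]
            exact ⟨by omega, g2⟩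
        · intro i hi
          by_cases hij : i = τ.var 10
          · subst hij; simp [hh]
          · rw [Function.update_of_ne hij]
            obtain ⟨g1, g2, g3⟩ := hI3 i (by omega)
            rw [Function.update_of_ne (by omega)]
            exact ⟨by omega, g2, g3⟩
    · simp only [Test.Holds, Expr.eval, h8, e19] at hh
      simp only [Test.cost, Expr.cost, setVar_var, setVar_arr]
      simp only [Nat.reduceEqDiff, if_false]
      refine ⟨by omega, ?_, ?_, ?_⟩
      · rw [Finset.range_add_one, Finset.filter_insert, if_neg hh, hI1]
      · intro r hr hr'
        obtain hr | rfl := Nat.lt_succ_iff_lt_or_eq.1 hr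
        · exact hI2 r hr hr'
        · exact absurd hr' hh
      · intro i hi
        obtain ⟨g1, g2⟩ := hI3 i hi
        exact ⟨by omega, g2⟩
  · rintro t τ ht _ _ _ ⟨hI1, hI2, hI3⟩
    rw [hm.card] at hI1
    rw [hI1] at hI2 hI3
    exact ⟨ht, hI2, hI3⟩
  rintro t τ ⟨ht, hnum, hcen⟩ hτ hA
  have e19 : τ.arr 19 = σ.arr 19 := by rw [hA.2 19 (by decide)]; simp
  refine Run.seq hτ (run_forLoop 5 hτ (fun j ρ => ∀ v < j, ρ.arr 8 v = τ.arr 20 (σ.arr 19 v)) (c := n)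
    (by rw [hA.1 0 (by decide)]; simp [h0]) (by decide) (by decide) (by decide) (by simp) ?_
    (Q := fun t ρ => t ≤ n * 13 + 6 ∧ ∀ v < n, ρ.arr 8 v = τ.arr 20 (σ.arr 19 v)) ?_) ?_
  · intro j ρ hj hρ hA' h8 hI
    have e19' : ρ.arr 19 = σ.arr 19 := by rw [hA'.2 19 (by decide), e19]
    have e20 : ρ.arr 20 = τ.arr 20 := hA'.2 20 (by decide)
    refine run_store hρ trivial trivial ⟨by simp [Expr.cost], fun v hv => ?_⟩
    simp only [Expr.eval, h8, setVar_arr, setArr_arr, if_true, Function.update_apply, e19', e20]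
    split_ifs with hvj
    · rw [hvj]
    · exact hI v (by omega)
  · exact fun t τ ht _ _ _ hI => ⟨ht, hI⟩
  rintro t' ρ ⟨ht', hclu⟩ hρ hA'
  have e9 : ρ.arr 9 = τ.arr 9 := hA'.2 9 (by decide)
  have e1 : ρ.var 1 = k := by rw [hA'.1 1 (by decide), hA.1 1 (by decide)]; simp [h1]
  have e9' : ρ.var 9 = c := by rw [hA'.1 9 (by decide), hA.1 9 (by decide)]; simp [h9]
  have fin : ∀ x, c = k → ∃ S : ConnectedClustering G k,
      (∀ v : Fin n, (ρ.setVar 4 x).arr 8 v = S.cluster v) ∧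
        (∀ i : Fin k, (ρ.setVar 4 x).arr 9 i = S.center i) ∧
        ∀ v : Fin n, lab v = lab (S.center (S.cluster v)) := by
    rintro x rfl
    obtain ⟨S, h1, h2, h3⟩ := hm.exists_clustering hnum hcen
    refine ⟨S, fun v => ?_, fun i => ?_, h3⟩
    · rw [setVar_arr, hclu v v.2, h1]
    · rw [setVar_arr, e9, h2]
  refine run_ite hρ ⟨trivial, trivial⟩ (fun hh => run_assign hρ (show 1 < 2 ^ W by omega) ?_)
    (fun hh => run_assign hρ (show 0 < 2 ^ W by omega) ?_)
  all_goals
    simp only [Test.Holds, Expr.eval, e1, e9'] at hh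
    refine ⟨by simp only [Expr.cost, Test.cost]; omega, ?_, fin _⟩
    simp [hh, Expr.eval]

end RAM

/-! ### The tree decomposition and its encoding -/

namespace KCenterInstance

variable (I : KCenterInstance)

/-- Upper bound for the sizes of the bags. -/
def bagBound : ℕ := I.w + 1

/-- The number of colors. -/
def colors : ℕ := I.k * I.bagBound

/-- The number of states of a node. -/
def states : ℕ := I.colors ^ I.bagBound * (I.k + 1)

/-- The entry `p` of the bag of the node `t` as given to the machine. -/
noncomputable def bagAt (t p : ℕ) : ℕ := I.input.arr 7 (t * I.n + p)

/-- The position of a vertex in a bag. -/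
noncomputable def bagIdx (t : Fin I.N) (v : Fin I.n) : ℕ :=
  ((I.decomp.bag t).sort (· ≤ ·)).idxOf v

theorem arrayOf_val {m : ℕ} (f : Fin m → ℕ) (t : Fin m) : arrayOf f t = f t := by
  simp [arrayOf]

theorem two_le_n : 2 ≤ I.n := I.two_le_k.trans I.k_le_n

theorem card_bag_le (t : Fin I.N) : (I.decomp.bag t).card ≤ I.bagBound := by
  have := Finset.le_sup (f := fun t => (I.decomp.bag t).card) (Finset.mem_univ t)
  simp only [bagBound, w, TreeDecomposition.width]
  omega

theorem card_bag_le_n (t : Fin I.N) : (I.decomp.bag t).card ≤ I.n :=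
  (Finset.card_le_univ _).trans (by simp)

theorem bagAt_eq {t : Fin I.N} {p : ℕ} (hp : p < (I.decomp.bag t).card) :
    I.bagAt t p = ((I.decomp.bag t).sort (· ≤ ·))[p]'(by simpa using hp) := by
  have hpn : p < I.n := hp.trans_le (I.card_bag_le_n t)
  have h1 : (t * I.n + p) / I.n = t := by
    rw [add_comm, Nat.add_mul_div_right _ _ (by omega), Nat.div_eq_of_lt hpn, zero_add]
  have h2 : (t * I.n + p) % I.n = p := by
    rw [add_comm, Nat.add_mul_mod_self_right, Nat.mod_eq_of_lt hpn]
  simp only [bagAt, input, h1, h2, arrayOf_val]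
  rw [List.getD_eq_getElem _ _ (by simpa using hp)]
  simp

theorem bagIdx_lt {t : Fin I.N} {v : Fin I.n} (hv : v ∈ I.decomp.bag t) :
    I.bagIdx t v < (I.decomp.bag t).card := by
  have := List.idxOf_lt_length_of_mem (l := (I.decomp.bag t).sort (· ≤ ·)) (a := v) (by simpa using hv)
  simpa [bagIdx] using this

theorem bagAt_bagIdx {t : Fin I.N} {v : Fin I.n} (hv : v ∈ I.decomp.bag t) :
    I.bagAt t (I.bagIdx t v) = v := by
  rw [I.bagAt_eq (I.bagIdx_lt hv)]
  simp [bagIdx]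

theorem exists_bagAt {t : Fin I.N} {p : ℕ} (hp : p < (I.decomp.bag t).card) :
    ∃ v ∈ I.decomp.bag t, I.bagAt t p = v ∧ I.bagIdx t v = p := by
  have hlen : p < ((I.decomp.bag t).sort (· ≤ ·)).length := by simpa using hp
  refine ⟨((I.decomp.bag t).sort (· ≤ ·))[p], ?_, I.bagAt_eq hp, ?_⟩
  · exact (Finset.mem_sort _).1 (List.getElem_mem hlen)
  · exact (Finset.sort_nodup _ _).idxOf_getElem p hlen

theorem input_arr_zero (u v : Fin I.n) : I.input.arr 0 (u * I.n + v) = 1 ↔ I.G.Adj u v := by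
  have hn := I.two_le_n
  have : (∃ u' v' : Fin I.n, (u * I.n + v : ℕ) = u' * I.n + v' ∧ I.G.Adj u' v') ↔ I.G.Adj u v := by
    constructor
    · rintro ⟨u', v', h, hadj⟩
      have h1 := congrArg (· / I.n) h
      have h2 := congrArg (· % I.n) h
      simp only [add_comm _ (v : ℕ), add_comm _ (v' : ℕ), Nat.add_mul_div_right _ _
        (show 0 < I.n by omega), Nat.div_eq_of_lt v.2, Nat.div_eq_of_lt v'.2, zero_add,
        Nat.add_mul_mod_self_right, Nat.mod_eq_of_lt v.2, Nat.mod_eq_of_lt v'.2] at h1 h2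
      rwa [Fin.ext h1, Fin.ext h2]
    · exact fun h => ⟨u, v, rfl, h⟩
  simp only [input]
  split_ifs with h
  · simpa using this.1 h
  · simpa using fun hadj => h (this.2 hadj)

theorem distArray_eq (u v : Fin I.n) : I.distArray (u * I.n + v) = I.d u v := by
  have hn := I.two_le_n
  have h1 : (u * I.n + v : ℕ) / I.n = u := by
    rw [add_comm, Nat.add_mul_div_right _ _ (by omega), Nat.div_eq_of_lt v.2, zero_add]
  have h2 : (u * I.n + v : ℕ) % I.n = v := by
    rw [add_comm, Nat.add_mul_mod_self_right, Nat.mod_eq_of_lt v.2]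
  simp [distArray, h1, h2]

/-! ### Descendants -/

/-- `s` is a child of `t`. -/
def Child (s t : Fin I.N) : Prop := s ∈ childSet I.decomp.tree I.decomp.root t

/-- `s` is a descendant of `t`, or `t` itself. -/
def Below (s t : Fin I.N) : Prop := Relation.ReflTransGen I.Child s t

variable {I}

theorem Child.dist {s t : Fin I.N} (h : I.Child s t) :
    I.decomp.tree.dist I.decomp.root s = I.decomp.tree.dist I.decomp.root t + 1 := h.2

/-- A shortest path from the root to a parent of `s` avoids `s`, so it extends to a path to `s`
whose penultimate vertex is that parent. Paths in a tree are unique. -/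
theorem Child.parent_unique {s t t' : Fin I.N} (h : I.Child s t) (h' : I.Child s t') : t = t' := by
  classical
  have hT := I.decomp.isTree
  have key : ∀ t, I.Child s t → ∃ p : I.decomp.tree.Walk I.decomp.root s, p.IsPath ∧
      p.penultimate = t := by
    intro t h
    obtain ⟨p, hp, hlen⟩ := (hT.connected I.decomp.root t).exists_path_of_dist
    have hs : s ∉ p.support := by
      intro hs
      have := SimpleGraph.dist_le (p.takeUntil s hs)
      have h2 := p.length_takeUntil_le_length hs
      have := h.dist
      omega
    exact ⟨p.concat h.1, hp.concat hs h.1, by simp⟩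
  obtain ⟨p, hp, rfl⟩ := key t h
  obtain ⟨q, hq, rfl⟩ := key t' h'
  rw [(hT.existsUnique_path _ _).unique hp hq]

theorem child_or_child_of_adj {s t : Fin I.N} (h : I.decomp.tree.Adj s t) :
    I.Child s t ∨ I.Child t s := by
  obtain h1 | h1 := I.decomp.isTree.dist_eq_dist_add_one_of_adj I.decomp.root h
  · exact .inl ⟨h.symm, h1⟩
  · exact .inr ⟨h, h1⟩

theorem Below.dist_le {s t : Fin I.N} (h : I.Below s t) :
    I.decomp.tree.dist I.decomp.root t ≤ I.decomp.tree.dist I.decomp.root s := by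
  induction h with
  | refl => exact le_rfl
  | tail _ hc ih => have := hc.dist; omega

/-- A tree edge leaving the set of descendants of `s` is the edge from `s` to its parent. -/
theorem Below.leave {s p q : Fin I.N} (hp : I.Below p s) (h : I.decomp.tree.Adj p q)
    (hq : ¬ I.Below q s) : p = s ∧ I.Child s q := by
  obtain hc | hc := child_or_child_of_adj h
  · obtain rfl | ⟨u, hu, hus⟩ := Relation.ReflTransGen.cases_head hp
    · exact ⟨rfl, hc⟩
    · exact absurd (hu.parent_unique hc ▸ hus) hq
  · exact absurd (Relation.ReflTransGen.head hc hp) hq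

/-- If the bags of a descendant of `s` and of another node that is none contain `a`, then so do the
bag of `s` and that of its parent. -/
theorem Below.mem_bag {s p q : Fin I.N} {a : Fin I.n} (hp : I.Below p s)
    (hap : a ∈ I.decomp.bag p) (haq : a ∈ I.decomp.bag q) (hq : ¬ I.Below q s) :
    a ∈ I.decomp.bag s ∧ ∃ t, I.Child s t ∧ a ∈ I.decomp.bag t := by
  have hreach := (I.decomp.connected_nodes a).preconnected ⟨p, hap⟩ ⟨q, haq⟩
  rw [SimpleGraph.reachable_iff_reflTransGen] at hreach
  suffices ∀ q' : {t | a ∈ I.decomp.bag t}, Relation.ReflTransGen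
      (I.decomp.tree.induce {t | a ∈ I.decomp.bag t}).Adj ⟨p, hap⟩ q' → ¬ I.Below q' s →
        a ∈ I.decomp.bag s ∧ ∃ t, I.Child s t ∧ a ∈ I.decomp.bag t from
    this ⟨q, haq⟩ hreach hq
  intro q' h
  induction h with
  | refl => exact fun h => absurd hp h
  | @tail b c _ hbc ih =>
    intro hc
    by_cases hb : I.Below b s
    · obtain ⟨h1, h2⟩ := hb.leave (by simpa using hbc) hc
      exact ⟨h1 ▸ b.2, c, h2, c.2⟩
    · exact ih hb

/-- Parents are unique, so two ancestors of a node are comparable. Siblings have the same distance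
from the root, so they are comparable only if equal. -/
theorem not_below_of_ne {s₁ s₂ t p : Fin I.N} (h₁ : I.Child s₁ t) (h₂ : I.Child s₂ t)
    (hne : s₁ ≠ s₂) (hp : I.Below p s₁) : ¬ I.Below p s₂ := by
  intro hp'
  have key : I.Below s₁ s₂ ∨ I.Below s₂ s₁ := by
    induction hp using Relation.ReflTransGen.head_induction_on with
    | refl => exact .inl hp'
    | head hc hcs ih =>
      obtain rfl | ⟨u, hu, hus⟩ := Relation.ReflTransGen.cases_head hp'
      · exact .inr (Relation.ReflTransGen.head hc hcs)
      · exact ih (hu.parent_unique hc ▸ hus)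
  have aux : ∀ {a b : Fin I.N}, I.Child a t → I.Child b t → I.Below a b → a = b := by
    intro a b ha hb hab
    obtain rfl | ⟨u, hu, hub⟩ := Relation.ReflTransGen.cases_head hab
    · rfl
    · have := Below.dist_le hub
      rw [← ha.parent_unique hu] at this
      have := hb.dist
      omega
  obtain h | h := key
  · exact hne (aux h₁ h₂ h)
  · exact hne (aux h₂ h₁ h).symm

/-- A walk from the root leaving its set of descendants would, by `Below.leave`, pass from the root
to a parent of the root, which does not exist. -/
theorem below_root (t : Fin I.N) : I.Below t I.decomp.root := by
  obtain ⟨p⟩ := I.decomp.isTree.connected I.decomp.root t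
  by_contra h
  have key : ∀ q, I.decomp.tree.Reachable I.decomp.root q → I.Below q I.decomp.root := by
    intro q hq
    rw [SimpleGraph.reachable_iff_reflTransGen] at hq
    induction hq with
    | refl => exact .refl
    | @tail b c _ hbc ih =>
      by_contra hc
      obtain ⟨-, h2⟩ := ih.leave hbc hc
      have := h2.dist
      simp at this
  exact h (key t ⟨p⟩)

theorem child_introVertex {t s : Fin I.N} {v : Fin I.n} (h : I.decomp.kind t = .introVertex v s) :
    I.Child s t ∧ (∀ s', I.Child s' t → s' = s) ∧ v ∉ I.decomp.bag s ∧
      I.decomp.bag t = insert v (I.decomp.bag s) := by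
  have := I.decomp.valid t
  rw [h] at this
  obtain ⟨h1, h2⟩ := this
  exact ⟨by simp [Child, h1], fun s' hs => by simpa [Child, h1] using hs, h2⟩

theorem child_introEdge {t s : Fin I.N} {u v : Fin I.n} (h : I.decomp.kind t = .introEdge u v s) :
    I.Child s t ∧ (∀ s', I.Child s' t → s' = s) ∧ I.G.Adj u v ∧
      I.decomp.bag t = I.decomp.bag s ∧ u ∈ I.decomp.bag t ∧ v ∈ I.decomp.bag t := by
  have := I.decomp.valid t
  rw [h] at this
  obtain ⟨h1, h2⟩ := this
  exact ⟨by simp [Child, h1], fun s' hs => by simpa [Child, h1] using hs, h2⟩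

theorem child_forget {t s : Fin I.N} {v : Fin I.n} (h : I.decomp.kind t = .forget v s) :
    I.Child s t ∧ (∀ s', I.Child s' t → s' = s) ∧ v ∈ I.decomp.bag s ∧
      I.decomp.bag t = (I.decomp.bag s).erase v := by
  have := I.decomp.valid t
  rw [h] at this
  obtain ⟨h1, h2⟩ := this
  exact ⟨by simp [Child, h1], fun s' hs => by simpa [Child, h1] using hs, h2⟩

theorem child_join {t s₁ s₂ : Fin I.N} (h : I.decomp.kind t = .join s₁ s₂) :
    I.Child s₁ t ∧ I.Child s₂ t ∧ (∀ s', I.Child s' t → s' = s₁ ∨ s' = s₂) ∧ s₁ ≠ s₂ ∧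
      I.decomp.bag s₁ = I.decomp.bag t ∧ I.decomp.bag s₂ = I.decomp.bag t := by
  have := I.decomp.valid t
  rw [h] at this
  obtain ⟨h0, h1, h2⟩ := this
  exact ⟨by simp [Child, h1], by simp [Child, h1], fun s' hs => by simpa [Child, h1] using hs, h0, h2⟩

theorem leaf_spec {t : Fin I.N} (h : I.decomp.kind t = .leaf) :
    (∀ s', ¬ I.Child s' t) ∧ I.decomp.bag t = ∅ := by
  have := I.decomp.valid t
  rw [h] at this
  obtain ⟨h1, h2⟩ := this
  exact ⟨fun s' hs => by simp [Child, h1] at hs, h2⟩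

theorem Child.not_below {s t : Fin I.N} (h : I.Child s t) : ¬ I.Below t s := fun hb => by
  have h1 := hb.dist_le
  have h2 := h.dist
  omega

theorem below_iff {p t : Fin I.N} : I.Below p t ↔ p = t ∨ ∃ s, I.Child s t ∧ I.Below p s := by
  constructor
  · intro h
    obtain rfl | ⟨s, hs, hst⟩ := Relation.ReflTransGen.cases_tail h
    · exact .inl rfl
    · exact .inr ⟨_, hst, hs⟩
  · rintro (rfl | ⟨s, hs, hps⟩)
    · exact .refl
    · exact hps.tail hs

/-- Induction from the leaves to the root. -/
theorem child_induction {P : Fin I.N → Prop} (h : ∀ t, (∀ s, I.Child s t → P s) → P t)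
    (t : Fin I.N) : P t := by
  -- Nodes are ordered by decreasing depth; this is well founded because there are finitely many
  -- nodes.
  let r : Fin I.N → Fin I.N → Prop := fun s t =>
    I.decomp.tree.dist I.decomp.root t < I.decomp.tree.dist I.decomp.root s
  have : IsTrans _ r := ⟨fun a b c hab hbc => lt_trans (b := I.decomp.tree.dist _ b) hbc hab⟩
  have : Std.Irrefl r := ⟨fun a => lt_irrefl _⟩
  refine (Finite.wellFounded_of_trans_of_irrefl r).induction t fun t ih => h t fun s hs => ih s ?_
  have := hs.dist
  simp only [r]
  omega

end KCenterInstance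

/-! ### The dynamic program -/

namespace KCenterInstance

variable (I : KCenterInstance)

/-- The number of closed components in the state `e`. -/
def closedCount (e : ℕ) : ℕ := e % (I.k + 1)

/-- The color of the vertex `v` of the bag of `t` in the state `e`. -/
noncomputable def color (t : Fin I.N) (e : ℕ) (v : Fin I.n) : ℕ :=
  e / (I.k + 1) / I.colors ^ I.bagIdx t v % I.colors

/-- `z` is the coloring of `B` by the join of the partitions given by `x` and `y`, with colors from
`x`. -/
def IsJoin {V : Type} (B : Finset V) (x y z : V → ℕ) : Prop :=
  (∀ u ∈ B, ∀ v ∈ B, x u = x v → z u = z v) ∧ (∀ u ∈ B, ∀ v ∈ B, y u = y v → z u = z v) ∧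
    ∀ r : Setoid V, (∀ u ∈ B, ∀ v ∈ B, x u = x v → r u v) → (∀ u ∈ B, ∀ v ∈ B, y u = y v → r u v) →
      (∀ u ∈ B, ∀ v ∈ B, z u = z v → r u v) ∧ ∀ u ∈ B, ∃ u' ∈ B, z u = x u' ∧ r u u'

open Classical in
/-- The states `e₁`, `e₂` of the children (or the color `e₂` for an introduce node) can be extended
to the node `t`; the entries of the table `V` for states that do not occur are zero. -/
def Enabled (V : ℕ → ℕ) (t : Fin I.N) (e₁ e₂ : ℕ) : Prop :=
  match I.decomp.kind t with
  | .leaf => True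
  | .introVertex _ s => V (s * I.states + e₁) ≠ 0 ∧ e₂ < I.colors ∧
      ∀ u ∈ I.decomp.bag s, I.color s e₁ u ≠ e₂
  | .introEdge _ _ s => V (s * I.states + e₁) ≠ 0
  | .forget v s => V (s * I.states + e₁) ≠ 0 ∧ I.closedCount e₁ +
      (if ∃ u ∈ I.decomp.bag t, I.color s e₁ u = I.color s e₁ v then 0 else 1) ≤ I.k
  | .join s₁ s₂ => V (s₁ * I.states + e₁) ≠ 0 ∧ V (s₂ * I.states + e₂) ≠ 0 ∧
      (∀ u ∈ I.decomp.bag t, I.color s₁ e₁ u % I.k = I.color s₂ e₂ u % I.k) ∧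
      I.closedCount e₁ + I.closedCount e₂ ≤ I.k

open Classical in
/-- The coloring `x` and the number `c` of closed components result from the states `e₁`, `e₂` of
the children. -/
def Outcome (t : Fin I.N) (e₁ e₂ : ℕ) (x : Fin I.n → ℕ) (c : ℕ) : Prop :=
  match I.decomp.kind t with
  | .leaf => c = 0
  | .introVertex v s => c = I.closedCount e₁ ∧ x v = e₂ ∧ ∀ u ∈ I.decomp.bag s, x u = I.color s e₁ u
  | .introEdge u v s => c = I.closedCount e₁ ∧ ∀ a ∈ I.decomp.bag t, x a =
      if I.color s e₁ u % I.k = I.color s e₁ v % I.k ∧ I.color s e₁ a = I.color s e₁ v then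
        I.color s e₁ u else I.color s e₁ a
  | .forget v s => c = I.closedCount e₁ +
      (if ∃ u ∈ I.decomp.bag t, I.color s e₁ u = I.color s e₁ v then 0 else 1) ∧
      ∀ u ∈ I.decomp.bag t, x u = I.color s e₁ u
  | .join s₁ s₂ => c = I.closedCount e₁ + I.closedCount e₂ ∧
      IsJoin (I.decomp.bag t) (I.color s₁ e₁) (I.color s₂ e₂) x

/-- The bottleneck distance of the state of `t` that results from `e₁` and `e₂`; `ctr` lists the
points that can serve as labels. -/
noncomputable def bottleneck (ctr V : ℕ → ℕ) (t : Fin I.N) (e₁ e₂ : ℕ) : ℝ :=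
  match I.decomp.kind t with
  | .leaf => I.distArray 0
  | .introVertex _ s => I.distArray (V (s * I.states + e₁) - 1)
  | .introEdge _ _ s => I.distArray (V (s * I.states + e₁) - 1)
  | .forget v s => max (I.distArray (V (s * I.states + e₁) - 1))
      (I.distArray (v * I.n + ctr (I.color s e₁ v % I.k)))
  | .join s₁ s₂ => max (I.distArray (V (s₁ * I.states + e₁) - 1))
      (I.distArray (V (s₂ * I.states + e₂) - 1))

/-- The entries of the tables `V` (values) and `P` (origins) for the node `t` are correct. -/
structure RowCorrect (ctr V P : ℕ → ℕ) (t : Fin I.N) : Prop where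
  sound : ∀ e < I.states, V (t * I.states + e) ≠ 0 → ∃ e₁ < I.states, ∃ e₂ < I.states,
    P (t * I.states + e) = e₁ * I.states + e₂ ∧ I.Enabled V t e₁ e₂ ∧
      I.Outcome t e₁ e₂ (I.color t e) (I.closedCount e) ∧
      I.distArray (V (t * I.states + e) - 1) = I.bottleneck ctr V t e₁ e₂
  complete : ∀ e₁ < I.states, ∀ e₂ < I.states, I.Enabled V t e₁ e₂ → ∃ e < I.states,
    I.Outcome t e₁ e₂ (I.color t e) (I.closedCount e) ∧ V (t * I.states + e) ≠ 0 ∧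
      I.distArray (V (t * I.states + e) - 1) ≤ I.bottleneck ctr V t e₁ e₂

/-- The states of the children of `t` are `e₁` and `e₂`. -/
def Follows (E : Fin I.N → ℕ) (t : Fin I.N) (e₁ e₂ : ℕ) : Prop :=
  match I.decomp.kind t with
  | .leaf => True
  | .introVertex _ s => E s = e₁
  | .introEdge _ _ s => E s = e₁
  | .forget _ s => E s = e₁
  | .join s₁ s₂ => E s₁ = e₁ ∧ E s₂ = e₂

/-- A choice of consistent states for all nodes. -/
def IsRun (ctr V : ℕ → ℕ) (E : Fin I.N → ℕ) : Prop :=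
  ∀ t, ∃ e₁ e₂, I.Follows E t e₁ e₂ ∧ I.Enabled V t e₁ e₂ ∧
    I.Outcome t e₁ e₂ (I.color t (E t)) (I.closedCount (E t)) ∧
    I.distArray (V (t * I.states + E t) - 1) = I.bottleneck ctr V t e₁ e₂

variable {I} {ctr V : ℕ → ℕ} {E : Fin I.N → ℕ}

/-- Having the same label is an equivalence relation that contains both partitions. By the
minimality of the join, `z u` is therefore the `x`-color of a vertex with the same label as `u`. -/
theorem IsJoin.label {B : Finset (Fin I.n)} {x y z : Fin I.n → ℕ} (h : IsJoin B x y z) {k : ℕ}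
    (hxy : ∀ u ∈ B, x u % k = y u % k) {u : Fin I.n} (hu : u ∈ B) : z u % k = x u % k := by
  obtain ⟨u', hu', hz, hr⟩ := (h.2.2 (Setoid.ker fun v => x v % k)
    (fun u _ v _ h => by simp [h])
    (fun u hu v hv h => by simp [hxy u hu, hxy v hv, h])).2 u hu
  rw [hz]
  exact Eq.symm hr

theorem IsRun.label_eq (h : I.IsRun ctr V E) {s t : Fin I.N} (hst : I.Child s t) {v : Fin I.n}
    (hs : v ∈ I.decomp.bag s) (ht : v ∈ I.decomp.bag t) :
    I.color t (E t) v % I.k = I.color s (E s) v % I.k := by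
  obtain ⟨e₁, e₂, hf, he, ho, -⟩ := h t
  unfold Follows at hf
  unfold Enabled at he
  unfold Outcome at ho
  cases hk : I.decomp.kind t with
  | leaf => exact absurd hst ((leaf_spec hk).1 s)
  | introVertex w s' =>
    simp only [hk] at hf ho
    obtain rfl := (child_introVertex hk).2.1 s hst
    rw [ho.2.2 v hs, hf]
  | introEdge u w s' =>
    simp only [hk] at hf ho
    obtain rfl := (child_introEdge hk).2.1 s hst
    rw [ho.2 v ht, hf]
    split_ifs with h1
    · rw [h1.1, h1.2]
    · rfl
  | forget w s' =>
    simp only [hk] at hf ho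
    obtain rfl := (child_forget hk).2.1 s hst
    rw [ho.2 v ht, hf]
  | join s₁ s₂ =>
    simp only [hk] at hf he ho
    have := ho.2.label he.2.2.1 ht
    obtain rfl | rfl := (child_join hk).2.2.1 s hst
    · rw [this, hf.1]
    · rw [this, he.2.2.1 v ht, hf.2]

/-- Colors of a vertex vary from node to node, but the label is preserved along every tree edge
inside the connected set of nodes whose bags contain `v`. -/
theorem IsRun.label_eq_label (h : I.IsRun ctr V E) {s t : Fin I.N} {v : Fin I.n}
    (hs : v ∈ I.decomp.bag s) (ht : v ∈ I.decomp.bag t) :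
    I.color t (E t) v % I.k = I.color s (E s) v % I.k := by
  have hreach := (I.decomp.connected_nodes v).preconnected ⟨s, hs⟩ ⟨t, ht⟩
  rw [SimpleGraph.reachable_iff_reflTransGen] at hreach
  suffices ∀ q : {t | v ∈ I.decomp.bag t}, Relation.ReflTransGen
      (I.decomp.tree.induce {t | v ∈ I.decomp.bag t}).Adj ⟨s, hs⟩ q →
      I.color q (E q) v % I.k = I.color s (E s) v % I.k from this ⟨t, ht⟩ hreach
  intro q hq
  induction hq with
  | refl => rfl
  | @tail b c _ hbc ih =>
    rw [← ih]
    obtain h1 | h1 := child_or_child_of_adj (show I.decomp.tree.Adj b c by simpa using hbc)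
    · exact h.label_eq h1 b.2 c.2
    · exact (h.label_eq h1 c.2 b.2).symm

theorem exists_forget (v : Fin I.n) : ∃ t s, I.decomp.kind t = .forget v s := by
  obtain ⟨t, ht, -⟩ := I.decomp.forgotten_once v
  cases hk : I.decomp.kind t <;> simp [hk, NodeKind.Forgets] at ht
  exact ⟨t, _, ht ▸ hk⟩

/-- The labeling `lab` is the one given by the states of the nodes before vertices are forgotten. -/
def IsLabeling (E : Fin I.N → ℕ) (lab : Fin I.n → ℕ) : Prop :=
  ∀ t v s, I.decomp.kind t = .forget v s → lab v = I.color s (E s) v % I.k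

theorem IsRun.color_mod (h : I.IsRun ctr V E) {lab : Fin I.n → ℕ} (hlab : IsLabeling E lab)
    {t : Fin I.N} {v : Fin I.n} (ht : v ∈ I.decomp.bag t) :
    I.color t (E t) v % I.k = lab v := by
  obtain ⟨t', s', hk⟩ := exists_forget v
  rw [hlab t' v s' hk]
  exact h.label_eq_label (child_forget hk).2.2.1 ht

/-- Soundness of the dynamic program, by induction from the leaves. Equal colors imply
connectedness; the converse is not needed, since only an upper bound for the number of components is
wanted. The set `Z` gets a vertex whenever one is forgotten whose color no longer occurs in the bag,
and every vertex met so far reaches `Z` or the current bag. -/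
theorem IsRun.hitting_aux (h : I.IsRun ctr V E) {lab : Fin I.n → ℕ} (hlab : IsLabeling E lab)
    (t : Fin I.N) :
    (∀ u ∈ I.decomp.bag t, ∀ v ∈ I.decomp.bag t, I.color t (E t) u = I.color t (E t) v →
      (labelGraph I.G lab).Reachable u v) ∧
    ∃ Z : Finset (Fin I.n), Z.card ≤ I.closedCount (E t) ∧ ∀ p, I.Below p t →
      ∀ a ∈ I.decomp.bag p, ∃ z, (z ∈ Z ∨ z ∈ I.decomp.bag t) ∧
        (labelGraph I.G lab).Reachable a z := by
  classical
  induction t using child_induction with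
  | h t ih =>
  have hmod := fun (t : Fin I.N) (v : Fin I.n) => h.color_mod hlab (t := t) (v := v)
  obtain ⟨e₁, e₂, hf, he, ho, -⟩ := h t
  unfold Follows at hf
  unfold Enabled at he
  unfold Outcome at ho
  cases hk : I.decomp.kind t with
  | leaf =>
    obtain ⟨h1, h2⟩ := leaf_spec hk
    refine ⟨by simp [h2], ∅, by simp, fun p hp a ha => ?_⟩
    obtain rfl | ⟨s, hs, -⟩ := below_iff.1 hp
    · simp [h2] at ha
    · exact absurd hs (h1 s)
  | introVertex w s =>
    simp only [hk] at hf he ho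
    obtain ⟨hs, hs', hw, hb⟩ := child_introVertex hk
    obtain ⟨ih1, Z, hZ, ih2⟩ := ih s hs
    subst hf
    refine ⟨?_, Z, by rwa [ho.1], fun p hp a ha => ?_⟩
    · intro u hu v hv huv
      rw [hb, Finset.mem_insert] at hu hv
      obtain rfl | hu := hu
      · obtain rfl | hv := hv
        · exact .rfl
        · exact absurd (by rw [← ho.2.2 v hv, ← huv, ho.2.1]) (he.2.2 v hv)
      · obtain rfl | hv := hv
        · exact absurd (by rw [← ho.2.2 u hu, huv, ho.2.1]) (he.2.2 u hu)
        · exact ih1 u hu v hv (by rw [← ho.2.2 u hu, huv, ho.2.2 v hv])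
    · obtain rfl | ⟨s', hs'', hps⟩ := below_iff.1 hp
      · exact ⟨a, .inr ha, .rfl⟩
      · obtain rfl := hs' s' hs''
        obtain ⟨z, hz, hr⟩ := ih2 p hps a ha
        exact ⟨z, hz.imp id fun h => by simp [hb, h], hr⟩
  | introEdge x y s =>
    simp only [hk] at hf he ho
    obtain ⟨hs, hs', hadj, hb, hx, hy⟩ := child_introEdge hk
    obtain ⟨ih1, Z, hZ, ih2⟩ := ih s hs
    subst hf
    refine ⟨?_, Z, by rwa [ho.1], fun p hp a ha => ?_⟩
    · by_cases hl : I.color s (E s) x % I.k = I.color s (E s) y % I.k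
      · have hxy : (labelGraph I.G lab).Reachable x y := by
          refine SimpleGraph.Adj.reachable ⟨hadj, ?_⟩
          rw [← hmod s x (hb ▸ hx), hl, hmod s y (hb ▸ hy)]
        have key : ∀ u ∈ I.decomp.bag s, ∃ u' ∈ I.decomp.bag s,
            I.color t (E t) u = I.color s (E s) u' ∧ (labelGraph I.G lab).Reachable u u' := by
          intro u hu
          rw [ho.2 u (hb ▸ hu)]
          split_ifs with h1
          · exact ⟨x, hb ▸ hx, rfl, (ih1 u hu y (hb ▸ hy) h1.2).trans hxy.symm⟩
          · exact ⟨u, hu, rfl, .rfl⟩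
        intro u hu v hv huv
        obtain ⟨u', hu', e1, r1⟩ := key u (hb ▸ hu)
        obtain ⟨v', hv', e2, r2⟩ := key v (hb ▸ hv)
        exact (r1.trans (ih1 u' hu' v' hv' (by rw [← e1, huv, e2]))).trans r2.symm
      · intro u hu v hv huv
        rw [ho.2 u hu, ho.2 v hv, if_neg fun h => hl h.1, if_neg fun h => hl h.1] at huv
        exact ih1 u (hb ▸ hu) v (hb ▸ hv) huv
    · obtain rfl | ⟨s', hs'', hps⟩ := below_iff.1 hp
      · exact ⟨a, .inr ha, .rfl⟩
      · obtain rfl := hs' s' hs''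
        obtain ⟨z, hz, hr⟩ := ih2 p hps a ha
        exact ⟨z, hz.imp id fun h => hb ▸ h, hr⟩
  | forget w s =>
    simp only [hk] at hf he ho
    obtain ⟨hs, hs', hw, hb⟩ := child_forget hk
    obtain ⟨ih1, Z, hZ, ih2⟩ := ih s hs
    subst hf
    have hsub : I.decomp.bag t ⊆ I.decomp.bag s := hb ▸ Finset.erase_subset _ _
    refine ⟨fun u hu v hv huv => ih1 u (hsub hu) v (hsub hv)
      (by rw [← ho.2 u hu, huv, ho.2 v hv]), ?_⟩
    split_ifs at ho with hex
    · obtain ⟨u, hu, huw⟩ := hex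
      refine ⟨Z, by rw [ho.1]; simpa using hZ, fun p hp a ha => ?_⟩
      obtain rfl | ⟨s', hs'', hps⟩ := below_iff.1 hp
      · exact ⟨a, .inr ha, .rfl⟩
      · obtain rfl := hs' s' hs''
        obtain ⟨z, hz | hz, hr⟩ := ih2 p hps a ha
        · exact ⟨z, .inl hz, hr⟩
        · by_cases hzw : z = w
          · exact ⟨u, .inr hu, hr.trans (ih1 z hz u (hsub hu) (by rw [hzw, huw]))⟩
          · exact ⟨z, .inr (by simp [hb, hzw, hz]), hr⟩
    -- The color of `w` disappears from the bag, so `w` itself becomes the witness of the component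
    -- that is counted as closed.
    · refine ⟨insert w Z, (Finset.card_insert_le _ _).trans (by rw [ho.1]; omega),
        fun p hp a ha => ?_⟩
      obtain rfl | ⟨s', hs'', hps⟩ := below_iff.1 hp
      · exact ⟨a, .inr ha, .rfl⟩
      · obtain rfl := hs' s' hs''
        obtain ⟨z, hz | hz, hr⟩ := ih2 p hps a ha
        · exact ⟨z, .inl (by simp [hz]), hr⟩
        · by_cases hzw : z = w
          · exact ⟨z, .inl (by simp [hzw]), hr⟩
          · exact ⟨z, .inr (by simp [hb, hzw, hz]), hr⟩
  | join s₁ s₂ =>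
    simp only [hk] at hf he ho
    obtain ⟨hs₁, hs₂, hs', -, hb₁, hb₂⟩ := child_join hk
    obtain ⟨ih1, Z₁, hZ₁, ih2⟩ := ih s₁ hs₁
    obtain ⟨ih3, Z₂, hZ₂, ih4⟩ := ih s₂ hs₂
    obtain ⟨rfl, rfl⟩ := hf
    rw [hb₁] at ih1 ih2
    rw [hb₂] at ih3 ih4
    -- Minimality of the join is applied to reachability, which contains the partitions of both
    -- children.
    refine ⟨(ho.2.2.2 (labelGraph I.G lab).reachableSetoid ih1 ih3).1, Z₁ ∪ Z₂,
      (Finset.card_union_le _ _).trans (by rw [ho.1]; omega), fun p hp a ha => ?_⟩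
    obtain rfl | ⟨s', hs'', hps⟩ := below_iff.1 hp
    · exact ⟨a, .inr ha, .rfl⟩
    · obtain rfl | rfl := hs' s' hs''
      · obtain ⟨z, hz, hr⟩ := ih2 p hps a ha
        exact ⟨z, hz.imp (fun h => by simp [h]) id, hr⟩
      · obtain ⟨z, hz, hr⟩ := ih4 p hps a ha
        exact ⟨z, hz.imp (fun h => by simp [h]) id, hr⟩

/-- The labeling given by a run has at most `k` connected components. -/
theorem IsRun.exists_hitting (h : I.IsRun ctr V E) {lab : Fin I.n → ℕ} (hlab : IsLabeling E lab) :
    ∃ Z : Finset (Fin I.n), Z.card ≤ I.k ∧ ∀ v, ∃ z ∈ Z, (labelGraph I.G lab).Reachable v z := by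
  obtain ⟨-, Z, hZ, hr⟩ := h.hitting_aux hlab I.decomp.root
  refine ⟨Z, hZ.trans (Nat.lt_succ_iff.1 (Nat.mod_lt _ (Nat.succ_pos _))), fun v => ?_⟩
  obtain ⟨t, ht⟩ := I.decomp.cover_vertex v
  obtain ⟨z, hz, hvz⟩ := hr t (below_root t) v ht
  exact ⟨z, hz.resolve_right (by simp [I.decomp.bag_root]), hvz⟩

/-- The labeling given by a run respects the bottleneck value. -/
theorem IsRun.dist_le (h : I.IsRun ctr V E) {lab : Fin I.n → ℕ} (hlab : IsLabeling E lab)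
    (v : Fin I.n) : I.distArray (v * I.n + ctr (lab v)) ≤
      I.distArray (V (I.decomp.root * I.states + E I.decomp.root) - 1) := by
  have hstep : ∀ s t, I.Child s t → I.distArray (V (s * I.states + E s) - 1) ≤
      I.distArray (V (t * I.states + E t) - 1) := by
    intro s t hst
    obtain ⟨e₁, e₂, hf, -, -, hv⟩ := h t
    rw [hv]
    unfold Follows at hf
    unfold bottleneck
    cases hk : I.decomp.kind t with
    | leaf => exact absurd hst ((leaf_spec hk).1 s)
    | introVertex w s' =>
      simp only [hk] at hf ⊢
      obtain rfl := (child_introVertex hk).2.1 s hst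
      rw [hf]
    | introEdge u w s' =>
      simp only [hk] at hf ⊢
      obtain rfl := (child_introEdge hk).2.1 s hst
      rw [hf]
    | forget w s' =>
      simp only [hk] at hf ⊢
      obtain rfl := (child_forget hk).2.1 s hst
      rw [hf]
      exact le_max_left _ _
    | join s₁ s₂ =>
      simp only [hk] at hf ⊢
      obtain rfl | rfl := (child_join hk).2.2.1 s hst
      · rw [hf.1]; exact le_max_left _ _
      · rw [hf.2]; exact le_max_right _ _
  have hbelow : ∀ s t, I.Below s t → I.distArray (V (s * I.states + E s) - 1) ≤
      I.distArray (V (t * I.states + E t) - 1) := by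
    intro s t hst
    induction hst with
    | refl => exact le_rfl
    | tail _ hc ih => exact ih.trans (hstep _ _ hc)
  obtain ⟨t, s, hk⟩ := exists_forget v
  refine le_trans ?_ (hbelow t _ (below_root t))
  obtain ⟨e₁, e₂, hf, -, -, hv⟩ := h t
  rw [hv, hlab t v s hk]
  unfold Follows at hf
  unfold bottleneck
  simp only [hk] at hf ⊢
  rw [hf]
  exact le_max_right _ _

end KCenterInstance

/-! ### Completeness of the dynamic program. -/

namespace KCenterInstance

variable {I : KCenterInstance} {ctr V P : ℕ → ℕ}

theorem closedCount_le (I : KCenterInstance) (e : ℕ) : I.closedCount e ≤ I.k :=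
  Nat.lt_succ_iff.1 (Nat.mod_lt _ (Nat.succ_pos _))

theorem bagBound_pos (I : KCenterInstance) : 0 < I.bagBound := Nat.succ_pos _

theorem colors_pos (I : KCenterInstance) : 0 < I.colors :=
  Nat.mul_pos (by have := I.two_le_k; omega) I.bagBound_pos

theorem states_pos (I : KCenterInstance) : 0 < I.states :=
  Nat.mul_pos (pow_pos I.colors_pos _) (Nat.succ_pos _)

/-- At an introduce vertex node the second entry of a pair of states is read as the new color; by
this inequality the loop over all pairs reaches every color. -/
theorem colors_le_states (I : KCenterInstance) : I.colors ≤ I.states :=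
  calc I.colors = I.colors ^ 1 := (pow_one _).symm
    _ ≤ I.colors ^ I.bagBound := Nat.pow_le_pow_right I.colors_pos I.bagBound_pos
    _ ≤ I.states := Nat.le_mul_of_pos_right _ (Nat.succ_pos _)

/-- The graph of the edges introduced at descendants of `t` whose ends have the same label. -/
def introduced (lam : Fin I.n → ℕ) (t : Fin I.N) : SimpleGraph (Fin I.n) where
  Adj u v := (labelGraph I.G lam).Adj u v ∧
    ∃ p, I.Below p t ∧ (I.decomp.kind p).IntroducesEdge s(u, v)
  symm := ⟨fun _ _ h => ⟨h.1.symm, by simpa [Sym2.eq_swap] using h.2⟩⟩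
  loopless := ⟨fun _ h => (labelGraph I.G lam).irrefl h.1⟩

/-- The vertices in the bags of descendants of `t`. -/
def under (t : Fin I.N) : Set (Fin I.n) := {v | ∃ p, I.Below p t ∧ v ∈ I.decomp.bag p}

/-- The components all of whose vertices have been forgotten at or below `t`. -/
def closedComponents (lam : Fin I.n → ℕ) (t : Fin I.N) :
    Set (labelGraph I.G lam).ConnectedComponent :=
  {C | ∀ a ∈ C.supp, a ∈ under t ∧ a ∉ I.decomp.bag t}

theorem mem_bag_of_introducesEdge {p : Fin I.N} {u v : Fin I.n}
    (h : (I.decomp.kind p).IntroducesEdge s(u, v)) :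
    u ∈ I.decomp.bag p ∧ v ∈ I.decomp.bag p := by
  cases hk : I.decomp.kind p <;> simp only [hk, NodeKind.IntroducesEdge] at h
  obtain ⟨-, -, -, -, h1, h2⟩ := child_introEdge hk
  rw [Sym2.eq_iff] at h
  obtain ⟨rfl, rfl⟩ | ⟨rfl, rfl⟩ := h
  exacts [⟨h1, h2⟩, ⟨h2, h1⟩]

theorem mem_under_of_adj {lam : Fin I.n → ℕ} {t : Fin I.N} {u v : Fin I.n}
    (h : (introduced lam t).Adj u v) : u ∈ under t ∧ v ∈ under t := by
  obtain ⟨-, p, hp, hi⟩ := h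
  exact ⟨⟨p, hp, (mem_bag_of_introducesEdge hi).1⟩, ⟨p, hp, (mem_bag_of_introducesEdge hi).2⟩⟩

theorem bag_subset_under {t : Fin I.N} {v : Fin I.n} (h : v ∈ I.decomp.bag t) : v ∈ under t :=
  ⟨t, .refl, h⟩

theorem under_mono {s t : Fin I.N} (hst : I.Child s t) {v : Fin I.n} (h : v ∈ under s) :
    v ∈ under t :=
  let ⟨p, hp, hv⟩ := h
  ⟨p, hp.tail hst, hv⟩

theorem mem_bag_of_mem_under {s t : Fin I.N} (hst : I.Child s t) {v : Fin I.n} (h : v ∈ under s)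
    (ht : v ∈ I.decomp.bag t) : v ∈ I.decomp.bag s :=
  let ⟨_, hp, hv⟩ := h
  (hp.mem_bag hv ht hst.not_below).1

/-- Two graphs that only have vertices of `B` in common: if a coloring of `B` is constant along
paths in each of them, then along paths in their union. -/
theorem color_eq_of_reachable {X : Type} {H H₁ H₂ : SimpleGraph X} {U₁ U₂ : Set X} {B : Set X}
    {z : X → ℕ} (hH : ∀ a b, H.Adj a b → H₁.Adj a b ∨ H₂.Adj a b)
    (h₁ : ∀ a b, H₁.Adj a b → a ∈ U₁ ∧ b ∈ U₁) (h₂ : ∀ a b, H₂.Adj a b → a ∈ U₂ ∧ b ∈ U₂)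
    (hB₁ : B ⊆ U₁) (hU : U₁ ∩ U₂ ⊆ B)
    (hz₁ : ∀ a ∈ B, ∀ b ∈ B, H₁.Reachable a b → z a = z b)
    (hz₂ : ∀ a ∈ B, ∀ b ∈ B, H₂.Reachable a b → z a = z b) {a b : X} (ha : a ∈ B) (hb : b ∈ B)
    (hab : H.Reachable a b) : z a = z b := by
  -- `c` is the start of the path or the last vertex where it switches between the two graphs. A
  -- switch happens in `U₁ ∩ U₂ ⊆ B`, so the finished stretch preserves the color by `hz₁` or `hz₂`.
  have key : (∃ c ∈ B, z c = z a ∧ H₁.Reachable c b ∧ b ∈ U₁) ∨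
      ∃ c ∈ B, z c = z a ∧ H₂.Reachable c b ∧ b ∈ U₂ := by
    rw [SimpleGraph.reachable_iff_reflTransGen] at hab
    clear hb
    induction hab with
    | refl => exact .inl ⟨a, ha, rfl, .rfl, hB₁ ha⟩
    | @tail v w _ hvw ih =>
      obtain h | h := hH v w hvw
      · have hv := h₁ v w h
        obtain ⟨c, hc, hca, hr, -⟩ | ⟨c, hc, hca, hr, hu⟩ := ih
        · exact .inl ⟨c, hc, hca, hr.trans h.reachable, hv.2⟩
        · have hvB := hU ⟨hv.1, hu⟩
          exact .inl ⟨v, hvB, by rw [← hca, hz₂ c hc v hvB hr], h.reachable, hv.2⟩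
      · have hv := h₂ v w h
        obtain ⟨c, hc, hca, hr, hu⟩ | ⟨c, hc, hca, hr, -⟩ := ih
        · have hvB := hU ⟨hu, hv.1⟩
          exact .inr ⟨v, hvB, by rw [← hca, hz₁ c hc v hvB hr], h.reachable, hv.2⟩
        · exact .inr ⟨c, hc, hca, hr.trans h.reachable, hv.2⟩
  obtain ⟨c, hc, hca, hr, -⟩ | ⟨c, hc, hca, hr, -⟩ := key
  · rw [← hca, hz₁ c hc b hb hr]
  · rw [← hca, hz₂ c hc b hb hr]

/-- At nodes other than introduce edge nodes no edge is added. -/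
theorem introduced_child {lam : Fin I.n → ℕ} {s t : Fin I.N} (hs' : ∀ s', I.Child s' t → s' = s)
    (hk : ∀ e, ¬ (I.decomp.kind t).IntroducesEdge e) {u v : Fin I.n}
    (h : (introduced lam t).Reachable u v) : (introduced lam s).Reachable u v := by
  refine SimpleGraph.Reachable.mono (G := introduced lam t) ?_ h
  rintro a b ⟨h1, p, hp, hi⟩
  refine ⟨h1, ?_⟩
  obtain rfl | ⟨s', hs, hps⟩ := below_iff.1 hp
  · exact absurd hi (hk _)
  · exact ⟨p, hs' s' hs ▸ hps, hi⟩

/-- The vertices reachable from `v` in the child of the node where `v` is forgotten, if no other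
vertex of the bag is. -/
theorem closed_of_forget {lam : Fin I.n → ℕ} {s t : Fin I.N} {v : Fin I.n}
    (hk : I.decomp.kind t = .forget v s)
    (hv : ∀ u ∈ I.decomp.bag t, ¬ (introduced lam s).Reachable v u) {a : Fin I.n}
    (ha : (labelGraph I.G lam).Reachable v a) :
    (introduced lam s).Reachable v a ∧ a ∈ under t ∧ a ∉ I.decomp.bag t := by
  obtain ⟨hs, hs', hvs, hb⟩ := child_forget hk
  suffices h : (introduced lam s).Reachable v a ∧ a ∈ under s ∧ a ∉ I.decomp.bag t from
    ⟨h.1, under_mono hs h.2.1, h.2.2⟩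
  rw [SimpleGraph.reachable_iff_reflTransGen] at ha
  induction ha with
  | refl => exact ⟨.rfl, bag_subset_under hvs, by simp [hb]⟩
  | @tail b c _ hbc ih =>
    obtain ⟨ih1, ⟨q, hq, hbq⟩, ih3⟩ := ih
    obtain ⟨p, hp, -⟩ := I.decomp.introduced_once s(b, c) hbc.1
    -- The edge `bc` is introduced at `p`. If `p` were not below `s`, then `b` would also lie in the
    -- bag of the parent `t` of `s`, against `ih3`.
    have hps : I.Below p s := by
      by_contra hps
      obtain ⟨-, t', ht', hbt⟩ := hq.mem_bag hbq (mem_bag_of_introducesEdge hp).1 hps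
      exact ih3 (hs.parent_unique ht' ▸ hbt)
    have hadj : (introduced lam s).Adj b c := ⟨hbc, p, hps, hp⟩
    have hr := ih1.trans hadj.reachable
    exact ⟨hr, (mem_under_of_adj hadj).2, fun hc => hv c hc hr⟩

theorem closedComponents_subset {lam : Fin I.n → ℕ} {s t : Fin I.N} (hs : I.Child s t)
    (hb : ∀ a ∈ under s, a ∈ I.decomp.bag t → a ∈ I.decomp.bag s) :
    closedComponents lam s ⊆ closedComponents lam t := fun _ hC a ha =>
  ⟨under_mono hs (hC a ha).1, fun hat => (hC a ha).2 (hb a (hC a ha).1 hat)⟩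

/-- Each label `j` has `bagBound` colors `j + k * i`, and the vertices of `B` occupy fewer. This is
the reason for the number of colors. -/
theorem exists_fresh_color {B : Finset (Fin I.n)} (hB : B.card < I.bagBound) (x : Fin I.n → ℕ)
    {j : ℕ} (hj : j < I.k) : ∃ a < I.colors, a % I.k = j ∧ ∀ u ∈ B, x u ≠ a := by
  obtain ⟨a, ha, hax⟩ : ∃ a ∈ (Finset.range I.bagBound).image (fun i => j + I.k * i), a ∉ B.image x := by
    by_contra! h
    have h1 := Finset.card_le_card (show _ ⊆ B.image x from h)
    rw [Finset.card_image_of_injective, Finset.card_range] at h1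
    · have := Finset.card_image_le (s := B) (f := x)
      omega
    · intro i i' hii
      simpa [show I.k ≠ 0 by omega] using hii
  simp only [Finset.mem_image, Finset.mem_range, not_exists, not_and] at ha hax
  obtain ⟨i, hi, rfl⟩ := ha
  refine ⟨_, ?_, by simp [Nat.mod_eq_of_lt hj], hax⟩
  have := mul_comm I.k i ▸ RAM.mul_add_lt_mul hi hj
  simp only [colors]
  rw [mul_comm I.k I.bagBound]
  linarith

/-- The counterpart of `IsRun.hitting_aux`: a good labeling `lam` guides the choice of states from
the leaves upwards. Vertices connected by introduced edges receive equal colors, so every component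
that the program counts as closed really is closed. As there are at most `k` components, the bound
on the count in `Enabled` never blocks the construction. The hypothesis `h0` serves the leaves,
whose value is entry 0 of the distance array. -/
theorem exists_state (hrow : ∀ t, I.RowCorrect ctr V P t) {lam : Fin I.n → ℕ} {ρ : ℝ}
    (hlam : ∀ v, lam v < I.k) (h0 : I.distArray 0 ≤ ρ)
    (hρ : ∀ v : Fin I.n, I.distArray (v * I.n + ctr (lam v)) ≤ ρ)
    (hcc : (Set.univ : Set (labelGraph I.G lam).ConnectedComponent).ncard ≤ I.k) (t : Fin I.N) :
    ∃ e < I.states, V (t * I.states + e) ≠ 0 ∧ I.distArray (V (t * I.states + e) - 1) ≤ ρ ∧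
      (∀ u ∈ I.decomp.bag t, I.color t e u % I.k = lam u) ∧
      (∀ u ∈ I.decomp.bag t, ∀ v ∈ I.decomp.bag t, (introduced lam t).Reachable u v →
        I.color t e u = I.color t e v) ∧
      I.closedCount e ≤ (closedComponents lam t).ncard := by
  classical
  have hle : ∀ S : Set (labelGraph I.G lam).ConnectedComponent, S.ncard ≤ I.k := fun S =>
    (Set.ncard_le_ncard (Set.subset_univ S) (Set.toFinite _)).trans hcc
  induction t using child_induction with
  | h t ih =>
  cases hk : I.decomp.kind t with
  | leaf =>
    obtain ⟨e, he, ho, hV, hd⟩ := (hrow t).complete 0 I.states_pos 0 I.states_pos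
      (by simp [Enabled, hk])
    simp only [Outcome, bottleneck, hk] at ho hd
    exact ⟨e, he, hV, hd.trans h0, by simp [(leaf_spec hk).2], by simp [(leaf_spec hk).2], by omega⟩
  | introVertex w s =>
    obtain ⟨hs, hs', hw, hb⟩ := child_introVertex hk
    obtain ⟨e₁, he₁, hV₁, hd₁, hl, hc, hn⟩ := ih s hs
    have hcard : (I.decomp.bag s).card < I.bagBound := by
      have := I.card_bag_le t
      rw [hb, Finset.card_insert_of_notMem hw] at this
      omega
    obtain ⟨e₂, he₂, hmod, hfresh⟩ := exists_fresh_color hcard (I.color s e₁) (hlam w)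
    obtain ⟨e, he, ho, hV, hd⟩ := (hrow t).complete e₁ he₁ e₂ (he₂.trans_le I.colors_le_states)
      (by simp only [Enabled, hk]; exact ⟨hV₁, he₂, hfresh⟩)
    simp only [Outcome, bottleneck, hk] at ho hd
    obtain ⟨ho1, ho2, ho3⟩ := ho
    -- The new vertex occurs in no bag below, so it is isolated in the graph introduced so far and
    -- its fresh color violates nothing.
    have hwU : w ∉ under s := fun h => hw (mem_bag_of_mem_under hs h (by simp [hb]))
    have hiso : ∀ u, (introduced lam s).Reachable w u → u = w := by
      intro u hu
      rw [SimpleGraph.reachable_iff_reflTransGen] at hu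
      obtain rfl | ⟨x, hx, -⟩ := Relation.ReflTransGen.cases_head hu
      · rfl
      · exact absurd (mem_under_of_adj hx).1 hwU
    refine ⟨e, he, hV, hd.trans hd₁, fun u hu => ?_, fun u hu v hv huv => ?_, ?_⟩
    · rw [hb, Finset.mem_insert] at hu
      obtain rfl | hu := hu
      · rw [ho2, hmod]
      · rw [ho3 u hu, hl u hu]
    · replace huv := introduced_child hs' (by simp [hk, NodeKind.IntroducesEdge]) huv
      rw [hb, Finset.mem_insert] at hu hv
      obtain rfl | hu := hu
      · rw [hiso v huv]
      obtain rfl | hv := hv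
      · rw [hiso u huv.symm]
      rw [ho3 u hu, ho3 v hv, hc u hu v hv huv]
    · rw [ho1]
      refine hn.trans (Set.ncard_le_ncard (closedComponents_subset hs fun a ha hat => ?_)
        (Set.toFinite _))
      exact mem_bag_of_mem_under hs ha hat
  | introEdge x y s =>
    obtain ⟨hs, hs', hadj, hb, hx, hy⟩ := child_introEdge hk
    obtain ⟨e₁, he₁, hV₁, hd₁, hl, hc, hn⟩ := ih s hs
    obtain ⟨e, he, ho, hV, hd⟩ := (hrow t).complete e₁ he₁ 0 I.states_pos
      (by simpa only [Enabled, hk] using hV₁)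
    simp only [Outcome, bottleneck, hk] at ho hd
    rw [← hb] at hl hc
    rw [hl x hx, hl y hy] at ho
    have heq : ∀ a ∈ I.decomp.bag t, ∀ b ∈ I.decomp.bag t, I.color s e₁ a = I.color s e₁ b →
        I.color t e a = I.color t e b := by
      intro a ha b hb' hab
      rw [ho.2 a ha, ho.2 b hb', hab]
    refine ⟨e, he, hV, hd.trans hd₁, fun u hu => ?_, fun u hu v hv huv => ?_, ?_⟩
    · rw [ho.2 u hu]
      split_ifs with h
      · rw [hl x hx, ← hl u hu, h.2, hl y hy, h.1]
      · exact hl u hu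
    -- The graph introduced up to `t` is covered by the one up to `s` and the single edge `xy` (if
    -- its ends have equal labels), so the gluing argument applies with `H₂` this edge.
    · let H₂ : SimpleGraph (Fin I.n) :=
        { Adj := fun a b => (labelGraph I.G lam).Adj a b ∧ s(x, y) = s(a, b)
          symm := ⟨fun a b h => ⟨h.1.symm, h.2.trans Sym2.eq_swap⟩⟩
          loopless := ⟨fun a h => (labelGraph I.G lam).irrefl h.1⟩ }
      have hH₂ : ∀ a b, H₂.Adj a b →
          lam x = lam y ∧ (x = a ∧ y = b ∨ x = b ∧ y = a) := by
        rintro a b ⟨h1, h2⟩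
        rw [Sym2.eq_iff] at h2
        refine ⟨?_, h2⟩
        obtain ⟨rfl, rfl⟩ | ⟨rfl, rfl⟩ := h2
        exacts [h1.2, h1.2.symm]
      refine color_eq_of_reachable (H := introduced lam t) (H₁ := introduced lam s) (H₂ := H₂)
        (U₁ := under s) (U₂ := I.decomp.bag t) (B := I.decomp.bag t) (z := I.color t e)
        ?_ (fun a b => mem_under_of_adj) ?_ (fun a ha => bag_subset_under (hb ▸ ha))
        Set.inter_subset_right (fun a ha b hb' hab => heq a ha b hb' (hc a ha b hb' hab)) ?_ hu hv huv
      · rintro a b ⟨h1, p, hp, hi⟩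
        obtain rfl | ⟨s', hs'', hps⟩ := below_iff.1 hp
        · exact .inr ⟨h1, by simpa [hk, NodeKind.IntroducesEdge] using hi⟩
        · exact .inl ⟨h1, p, hs' s' hs'' ▸ hps, hi⟩
      · intro a b hab
        obtain ⟨-, ⟨rfl, rfl⟩ | ⟨rfl, rfl⟩⟩ := hH₂ a b hab
        exacts [⟨hx, hy⟩, ⟨hy, hx⟩]
      · intro a _ b hbB hab
        clear hbB
        rw [SimpleGraph.reachable_iff_reflTransGen] at hab
        induction hab with
        | refl => rfl
        | tail _ h ih =>
          rw [ih]
          obtain ⟨hxy, h⟩ := hH₂ _ _ h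
          have hcol : I.color t e x = I.color t e y := by
            rw [ho.2 x hx, ho.2 y hy]
            simp [hxy]
          obtain ⟨rfl, rfl⟩ | ⟨rfl, rfl⟩ := h
          exacts [hcol, hcol.symm]
    · rw [ho.1]
      exact hn.trans (Set.ncard_le_ncard (closedComponents_subset hs fun a _ hat => hb ▸ hat)
        (Set.toFinite _))
  | forget w s =>
    obtain ⟨hs, hs', hw, hb⟩ := child_forget hk
    obtain ⟨e₁, he₁, hV₁, hd₁, hl, hc, hn⟩ := ih s hs
    have hsub : I.decomp.bag t ⊆ I.decomp.bag s := hb ▸ Finset.erase_subset _ _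
    have hmono : closedComponents lam s ⊆ closedComponents lam t :=
      closedComponents_subset hs fun a _ hat => hsub hat
    have hcount : I.closedCount e₁ + (if ∃ u ∈ I.decomp.bag t, I.color s e₁ u = I.color s e₁ w
        then 0 else 1) ≤ (closedComponents lam t).ncard := by
      split_ifs with hex
      · exact hn.trans (Set.ncard_le_ncard hmono (Set.toFinite _))
      · have hv : ∀ u ∈ I.decomp.bag t, ¬ (introduced lam s).Reachable w u := fun u hu hr =>
          hex ⟨u, hu, (hc w hw u (hsub hu) hr).symm⟩
        -- The component of `w` is closed at `t` but not at `s`, where `w` is still in the bag; this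
        -- pays for the increment of the count.
        have h1 : (labelGraph I.G lam).connectedComponentMk w ∉ closedComponents lam s := fun h =>
          (h w rfl).2 hw
        have h2 : insert ((labelGraph I.G lam).connectedComponentMk w) (closedComponents lam s) ⊆
            closedComponents lam t := by
          refine Set.insert_subset (fun a ha => ?_) hmono
          rw [SimpleGraph.ConnectedComponent.mem_supp_iff, SimpleGraph.ConnectedComponent.eq] at ha
          exact (closed_of_forget hk hv ha.symm).2
        calc I.closedCount e₁ + 1 ≤ (closedComponents lam s).ncard + 1 := by omega
          _ = (insert ((labelGraph I.G lam).connectedComponentMk w)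
              (closedComponents lam s)).ncard := (Set.ncard_insert_of_notMem h1 (Set.toFinite _)).symm
          _ ≤ _ := Set.ncard_le_ncard h2 (Set.toFinite _)
    obtain ⟨e, he, ho, hV, hd⟩ := (hrow t).complete e₁ he₁ 0 I.states_pos
      (by simp only [Enabled, hk]; exact ⟨hV₁, hcount.trans (hle _)⟩)
    simp only [Outcome, bottleneck, hk] at ho hd
    refine ⟨e, he, hV, hd.trans (max_le hd₁ (by rw [hl w hw]; exact hρ w)), fun u hu => ?_,
      fun u hu v hv huv => ?_, ho.1 ▸ hcount⟩
    · rw [ho.2 u hu, hl u (hsub hu)]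
    · rw [ho.2 u hu, ho.2 v hv]
      exact hc u (hsub hu) v (hsub hv)
        (introduced_child hs' (by simp [hk, NodeKind.IntroducesEdge]) huv)
  | join s₁ s₂ =>
    obtain ⟨hs₁, hs₂, hs', hne, hb₁, hb₂⟩ := child_join hk
    obtain ⟨e₁, he₁, hV₁, hd₁, hl₁, hc₁, hn₁⟩ := ih s₁ hs₁
    obtain ⟨e₂, he₂, hV₂, hd₂, hl₂, hc₂, hn₂⟩ := ih s₂ hs₂
    rw [hb₁] at hl₁ hc₁
    rw [hb₂] at hl₂ hc₂
    have hinter : under s₁ ∩ under s₂ ⊆ (I.decomp.bag t : Set (Fin I.n)) := by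
      rintro a ⟨⟨p, hp, hap⟩, q, hq, haq⟩
      have := (hp.mem_bag hap haq fun h => not_below_of_ne hs₁ hs₂ hne h hq).1
      rwa [hb₁] at this
    have hcount : I.closedCount e₁ + I.closedCount e₂ ≤ (closedComponents lam t).ncard := by
      -- A vertex occurring below both children lies in the common bag, which closed components
      -- avoid; so the two counts may be added.
      have hdisj : Disjoint (closedComponents lam s₁) (closedComponents lam s₂) := by
        rw [Set.disjoint_left]
        intro C h1 h2
        obtain ⟨a, ha⟩ := C.nonempty_supp
        exact (h1 a ha).2 (hb₁ ▸ hinter ⟨(h1 a ha).1, (h2 a ha).1⟩)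
      calc _ ≤ (closedComponents lam s₁).ncard + (closedComponents lam s₂).ncard := by omega
        _ = (closedComponents lam s₁ ∪ closedComponents lam s₂).ncard :=
          (Set.ncard_union_eq hdisj (Set.toFinite _) (Set.toFinite _)).symm
        _ ≤ _ := Set.ncard_le_ncard (Set.union_subset
          (closedComponents_subset hs₁ fun a _ ha => hb₁ ▸ ha)
          (closedComponents_subset hs₂ fun a _ ha => hb₂ ▸ ha)) (Set.toFinite _)
    have hlab : ∀ u ∈ I.decomp.bag t, I.color s₁ e₁ u % I.k = I.color s₂ e₂ u % I.k :=
      fun u hu => by rw [hl₁ u hu, hl₂ u hu]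
    obtain ⟨e, he, ho, hV, hd⟩ := (hrow t).complete e₁ he₁ e₂ he₂
      (by simp only [Enabled, hk]; exact ⟨hV₁, hV₂, hlab, hcount.trans (hle _)⟩)
    simp only [Outcome, bottleneck, hk] at ho hd
    refine ⟨e, he, hV, hd.trans (max_le hd₁ hd₂), fun u hu => ?_,
      fun u hu v hv huv => ?_, ho.1 ▸ hcount⟩
    · rw [ho.2.label hlab hu, hl₁ u hu]
    · refine color_eq_of_reachable (H := introduced lam t) (H₁ := introduced lam s₁)
        (H₂ := introduced lam s₂) (U₁ := under s₁) (U₂ := under s₂) (B := I.decomp.bag t)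
        (z := I.color t e) ?_ (fun a b => mem_under_of_adj) (fun a b => mem_under_of_adj)
        (fun a ha => bag_subset_under (hb₁ ▸ ha)) hinter
        (fun a ha b hb hab => ho.2.1 a ha b hb (hc₁ a ha b hb hab))
        (fun a ha b hb hab => ho.2.2.1 a ha b hb (hc₂ a ha b hb hab)) hu hv huv
      rintro a b ⟨h1, p, hp, hi⟩
      obtain rfl | ⟨s', hs'', hps⟩ := below_iff.1 hp
      · simp [hk, NodeKind.IntroducesEdge] at hi
      · obtain rfl | rfl := hs' s' hs''
        · exact .inl ⟨h1, p, hps, hi⟩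
        · exact .inr ⟨h1, p, hps, hi⟩

end KCenterInstance

/-! ### The instance in the memory of the machine. -/

namespace KCenterInstance

/-- The machine holds the instance, the parameters of the dynamic program and the points `ctr` that
serve as labels, and its words are long enough for all positions in the tables. -/
structure Loaded (I : KCenterInstance) (W : ℕ) (ctr : ℕ → ℕ) (σ : RAM.State) : Prop where
  bdd : RAM.Bdd W σ
  v0 : σ.var 0 = I.n
  v1 : σ.var 1 = I.k
  v2 : σ.var 2 = I.N
  v3 : σ.var 3 = I.decomp.root
  v5 : σ.var 5 = I.bagBound
  v6 : σ.var 6 = I.colors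
  v7 : σ.var 7 = I.states
  inp : ∀ a < 8, σ.arr a = I.input.arr a
  a10 : σ.arr 10 = ctr
  big : 8 + I.N + I.n * I.n + I.N * I.n + I.N * I.states + I.states * I.states ≤ 2 ^ W

theorem Loaded.agree {I : KCenterInstance} {W : ℕ} {ctr : ℕ → ℕ} {σ τ : RAM.State} {vs as : List ℕ}
    (h : I.Loaded W ctr σ) (hA : RAM.Agree vs as σ τ) (hτ : RAM.Bdd W τ)
    (hv : ∀ x ∈ [0, 1, 2, 3, 5, 6, 7], x ∉ vs) (ha : ∀ a ∈ [0, 1, 2, 3, 4, 5, 6, 7, 10], a ∉ as) :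
    I.Loaded W ctr τ where
  bdd := hτ
  v0 := by rw [hA.1 0 (hv 0 (by simp)), h.v0]
  v1 := by rw [hA.1 1 (hv 1 (by simp)), h.v1]
  v2 := by rw [hA.1 2 (hv 2 (by simp)), h.v2]
  v3 := by rw [hA.1 3 (hv 3 (by simp)), h.v3]
  v5 := by rw [hA.1 5 (hv 5 (by simp)), h.v5]
  v6 := by rw [hA.1 6 (hv 6 (by simp)), h.v6]
  v7 := by rw [hA.1 7 (hv 7 (by simp)), h.v7]
  inp a ha' := by
    rw [hA.2 a (ha a (by simp; omega)), h.inp a ha']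
  a10 := by rw [hA.2 10 (ha 10 (by simp)), h.a10]
  big := h.big

variable {I : KCenterInstance}

theorem input_arr_one (t : Fin I.N) : I.input.arr 1 t = (I.decomp.kind t).code := by
  simp [input, arrayOf_val]
theorem input_arr_two (t : Fin I.N) : I.input.arr 2 t = (I.decomp.kind t).child₁ := by
  simp [input, arrayOf_val]
theorem input_arr_three (t : Fin I.N) : I.input.arr 3 t = (I.decomp.kind t).child₂ := by
  simp [input, arrayOf_val]
theorem input_arr_four (t : Fin I.N) : I.input.arr 4 t = (I.decomp.kind t).label₁ := by
  simp [input, arrayOf_val]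
theorem input_arr_five (t : Fin I.N) : I.input.arr 5 t = (I.decomp.kind t).label₂ := by
  simp [input, arrayOf_val]
theorem input_arr_six (t : Fin I.N) : I.input.arr 6 t = (I.decomp.bag t).card := by
  simp [input, arrayOf_val]

/-- Describes the children by the numbers that the machine sees, so that the programs need no
distinction between the three types with one child. -/
theorem exists_children {t : Fin I.N} (h : (I.decomp.kind t).code ≠ 0) :
    ∃ s : Fin I.N, I.Child s t ∧ (I.decomp.kind t).child₁ = s ∧
      (∀ s', I.Child s' t → s' = s ∨
        (I.decomp.kind t).code = 4 ∧ (I.decomp.kind t).child₂ = s') ∧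
      ((I.decomp.kind t).code = 4 → ∃ s₂ : Fin I.N, I.Child s₂ t ∧
        (I.decomp.kind t).child₂ = s₂ ∧ s₂ ≠ s) := by
  cases hk : I.decomp.kind t with
  | leaf => simp [hk, NodeKind.code] at h
  | introVertex v s =>
    obtain ⟨h1, h2, -⟩ := child_introVertex hk
    exact ⟨s, h1, rfl, fun s' hs' => .inl (h2 s' hs'), by simp [NodeKind.code]⟩
  | introEdge u v s =>
    obtain ⟨h1, h2, -⟩ := child_introEdge hk
    exact ⟨s, h1, rfl, fun s' hs' => .inl (h2 s' hs'), by simp [NodeKind.code]⟩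
  | forget v s =>
    obtain ⟨h1, h2, -⟩ := child_forget hk
    exact ⟨s, h1, rfl, fun s' hs' => .inl (h2 s' hs'), by simp [NodeKind.code]⟩
  | join s₁ s₂ =>
    obtain ⟨h1, h2, h3, hne, -⟩ := child_join hk
    exact ⟨s₁, h1, rfl, fun s' hs' => (h3 s' hs').imp id fun h => by
      simp [NodeKind.code, NodeKind.child₂, h], fun _ => ⟨s₂, h2, rfl, hne.symm⟩⟩

/-! ### Enumerating the nodes -/

/-- The first `L` entries of `q` are nodes in top-down order, starting with the root; all but the
root are children of one of the first `i` entries. -/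
structure IsPrefix (I : KCenterInstance) (q : ℕ → ℕ) (L i : ℕ) : Prop where
  node : ∀ j < L, ∃ t : Fin I.N, q j = t
  inj : ∀ j < L, ∀ j' < L, q j = q j' → j = j'
  root : q 0 = I.decomp.root
  pos : 0 < L
  parent : ∀ j < L, 0 < j → ∃ j' < j, j' < i ∧ ∃ s t : Fin I.N, q j = s ∧ q j' = t ∧ I.Child s t

/-- The children of the first `i` entries of `q` are among the first `L` entries. -/
def IsClosedPrefix (I : KCenterInstance) (q : ℕ → ℕ) (L i : ℕ) : Prop :=
  ∀ j < i, ∀ s t : Fin I.N, q j = t → I.Child s t → ∃ j' < L, j < j' ∧ q j' = s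

/-- `q` lists all nodes in top-down order. -/
structure IsTopDown (I : KCenterInstance) (q : ℕ → ℕ) : Prop extends IsPrefix I q I.N I.N where
  child : IsClosedPrefix I q I.N I.N

theorem IsPrefix.le {q : ℕ → ℕ} {L i : ℕ} (h : I.IsPrefix q L i) : L ≤ I.N := by
  have := Fintype.card_le_of_injective
    (fun j : Fin L => (h.node j j.2).choose) fun j j' hj => by
      have h1 := (h.node j j.2).choose_spec
      have h2 := (h.node j' j'.2).choose_spec
      simp only at hj
      rw [hj, ← h2] at h1
      exact Fin.ext (h.inj j j.2 j' j'.2 h1)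
  simpa using this

theorem IsPrefix.mono {q : ℕ → ℕ} {L i i' : ℕ} (h : I.IsPrefix q L i) (hi : i ≤ i') :
    I.IsPrefix q L i' :=
  ⟨h.node, h.inj, h.root, h.pos, fun j hj h0 =>
    let ⟨j', h1, h2, h3⟩ := h.parent j hj h0
    ⟨j', h1, h2.trans_le hi, h3⟩⟩

/-- An enumeration that cannot be continued is complete. -/
theorem IsPrefix.exhausted {q : ℕ → ℕ} {L : ℕ} (h : I.IsPrefix q L L)
    (hc : I.IsClosedPrefix q L L) (t : Fin I.N) : ∃ j < L, q j = t := by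
  have hb : ∀ s r : Fin I.N, I.Below s r → (∃ j < L, q j = r) → ∃ j < L, q j = s := by
    intro s r hsr
    induction hsr using Relation.ReflTransGen.head_induction_on with
    | refl => exact id
    | head hab _ ih =>
      intro hr
      obtain ⟨j, hj, hq⟩ := ih hr
      obtain ⟨j', hj', -, hq'⟩ := hc j hj _ _ hq hab
      exact ⟨j', hj', hq'⟩
  exact hb t _ (below_root t) ⟨0, h.pos, h.root⟩

/-- The queue does not run empty early: if all its `L = i` entries have been processed, it contains
every node, which contradicts `i < N`. -/
theorem IsPrefix.lt {q : ℕ → ℕ} {L i : ℕ} (h : I.IsPrefix q L i)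
    (hc : I.IsClosedPrefix q L i) (hiL : i ≤ L) (hi : i < I.N) : i < L := by
  rcases hiL.lt_or_eq with h1 | rfl
  · exact h1
  · have := Fintype.card_le_of_injective
      (fun t : Fin I.N => (⟨(h.exhausted hc t).choose, (h.exhausted hc t).choose_spec.1⟩ : Fin i))
      fun t t' ht => by
        have h1 := (h.exhausted hc t).choose_spec.2
        have h2 := (h.exhausted hc t').choose_spec.2
        simp only [Fin.mk.injEq] at ht
        rw [ht, h2] at h1
        exact (Fin.ext h1).symm
    simp at this
    omega

/-- All listed nodes except the root are children of one of the first `i` entries, whereas the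
unique parent of `s` is entry `i`. -/
theorem IsPrefix.fresh {q : ℕ → ℕ} {L i : ℕ} (h : I.IsPrefix q L i) (hi : i < L) {s t : Fin I.N}
    (ht : q i = t) (hst : I.Child s t) : ∀ j < L, q j ≠ s := by
  intro j hj hjs
  rcases Nat.eq_zero_or_pos j with rfl | h0
  · rw [h.root] at hjs
    have := hst.dist
    rw [← Fin.ext hjs] at this
    simp at this
  · obtain ⟨j', h1, h2, s', t', hs', ht', hc⟩ := h.parent j hj h0
    rw [hjs] at hs'
    obtain rfl := Fin.ext hs'
    have := hst.parent_unique hc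
    subst this
    exact absurd (h.inj j' (h1.trans hj) i hi (by rw [ht', ht])) h2.ne

theorem IsPrefix.push {q : ℕ → ℕ} {L i : ℕ} (h : I.IsPrefix q L (i + 1)) (hi : i < L) {s t : Fin I.N}
    (ht : q i = t) (hst : I.Child s t) (hfresh : ∀ j < L, q j ≠ s) :
    I.IsPrefix (Function.update q L s) (L + 1) (i + 1) := by
  have hlt : ∀ j < L, Function.update q L s j = q j := fun j hj => Function.update_of_ne hj.ne _ _
  refine ⟨fun j hj => ?_, fun j hj j' hj' hjj => ?_, ?_, by omega, fun j hj h0 => ?_⟩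
  · obtain hj | rfl := Nat.lt_succ_iff_lt_or_eq.1 hj
    · rw [hlt j hj]; exact h.node j hj
    · exact ⟨s, by simp⟩
  · obtain hj | rfl := Nat.lt_succ_iff_lt_or_eq.1 hj
    · obtain hj' | rfl := Nat.lt_succ_iff_lt_or_eq.1 hj'
      · rw [hlt j hj, hlt j' hj'] at hjj
        exact h.inj j hj j' hj' hjj
      · rw [hlt j hj, Function.update_self] at hjj
        exact absurd hjj (hfresh j hj)
    · obtain hj' | rfl := Nat.lt_succ_iff_lt_or_eq.1 hj'
      · rw [hlt j' hj', Function.update_self] at hjj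
        exact absurd hjj.symm (hfresh j' hj')
      · rfl
  · rw [hlt 0 h.pos, h.root]
  · obtain hj | rfl := Nat.lt_succ_iff_lt_or_eq.1 hj
    · obtain ⟨j', h1, h2, s', t', h3, h4, h5⟩ := h.parent j hj h0
      exact ⟨j', h1, h2, s', t', by rw [hlt j hj, h3], by rw [hlt j' (by omega), h4], h5⟩
    · exact ⟨i, hi, by omega, s, t, by simp, by rw [hlt i hi, ht], hst⟩

end KCenterInstance

namespace RAM

/-- Writes the nodes to array `12` in top-down order, starting with the root. -/
def enumerateNodes : Program :=
  .store 12 (.const 0) (.var 3) ;;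
  .assign 9 (.const 1) ;;
  .forLoop 8 2
    (.assign 10 (.get 12 (.var 8)) ;;
    .assign 11 (.get 1 (.var 10)) ;;
    .ite (.lt (.const 0) (.var 11))
      (.store 12 (.var 9) (.get 2 (.var 10)) ;;
      .assign 9 (.add (.var 9) (.const 1)) ;;
      .ite (.eq (.var 11) (.const 4))
        (.store 12 (.var 9) (.get 3 (.var 10)) ;;
        .assign 9 (.add (.var 9) (.const 1)))
        .skip)
      .skip)

variable {W : ℕ} {D : ℕ → ℝ} {I : KCenterInstance}

-- Breadth-first search: array `12` is the queue, variable `8` the reading and variable `9` the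
-- writing position.
open KCenterInstance in
theorem run_enumerateNodes {σ : State} {ctr : ℕ → ℕ} (h : I.Loaded W ctr σ) :
    Run W D enumerateNodes σ fun t τ => t ≤ 50 * I.N + 20 ∧ I.IsTopDown (τ.arr 12) := by
  have hbig := h.big
  refine run_store_seq h.bdd (show 0 < 2 ^ W by omega) trivial fun hB =>
    run_assign_seq hB (show 1 < 2 ^ W by omega) fun hB' => ?_
  simp only [Expr.eval, h.v3] at hB' ⊢
  refine run_forLoop 40 hB' (fun i τ => i ≤ τ.var 9 ∧ I.IsPrefix (τ.arr 12) (τ.var 9) i ∧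
    I.IsClosedPrefix (τ.arr 12) (τ.var 9) i) (c := I.N) (by simp [h.v2])
    (by decide) (by decide) (by decide) ?_ ?_ ?_
  · refine ⟨by simp, ⟨fun j hj => ?_, fun j hj j' hj' _ => ?_, by simp, by simp, fun j hj h0 => ?_⟩,
      fun j hj => absurd hj (by omega)⟩
    all_goals simp at hj
    · exact ⟨I.decomp.root, by simp [hj]⟩
    · simp at hj'
      omega
    · omega
  · rintro i τ hi hτ hA h8 ⟨hI1, hI2, hI3⟩
    have hL := I.two_le_n
    have hiL := hI2.lt hI3 hI1 hi
    obtain ⟨t, ht⟩ := hI2.node i hiL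
    have e1 : τ.arr 1 = I.input.arr 1 := by rw [hA.2 1 (by decide)]; simp [h.inp 1 (by omega)]
    have e2 : τ.arr 2 = I.input.arr 2 := by rw [hA.2 2 (by decide)]; simp [h.inp 2 (by omega)]
    have e3 : τ.arr 3 = I.input.arr 3 := by rw [hA.2 3 (by decide)]; simp [h.inp 3 (by omega)]
    have hmono := hI2.mono (Nat.le_succ i)
    have hclosed : ∀ q' L', τ.var 9 ≤ L' → (∀ j < τ.var 9, q' j = τ.arr 12 j) →
        (∀ s : Fin I.N, I.Child s t → ∃ j' < L', i < j' ∧ q' j' = (s : ℕ)) → I.IsClosedPrefix q' L' (i + 1) := by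
      intro q' L' hL' hq' hs j hj s t' ht' hst
      obtain hj | rfl := Nat.lt_succ_iff_lt_or_eq.1 hj
      · rw [hq' j (by omega)] at ht'
        obtain ⟨j', h1, h2, h3⟩ := hI3 j hj s t' ht' hst
        exact ⟨j', by omega, h2, by rw [hq' j' h1, h3]⟩
      · rw [hq' j hiL, ht] at ht'
        obtain rfl := Fin.ext ht'
        exact hs s hst
    refine run_assign_seq hτ trivial fun hB1 => run_assign_seq hB1 trivial fun hB2 => ?_
    simp only [Expr.eval, Expr.cost, h8, ht, e1, setVar_arr, setVar_var] at hB2 ⊢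
    simp only [if_true, input_arr_one] at hB2 ⊢
    refine run_ite hB2 ⟨show 0 < 2 ^ W by omega, trivial⟩ (fun hh => ?_) (fun hh => run_skip.2 ?_)
    · simp only [Test.Holds, Expr.eval, setVar_var, if_true] at hh
      have hpush : ∀ s : Fin I.N, I.Child s t → (I.decomp.kind t).child₁ = s →
          (∀ s', I.Child s' t → s' = s ∨
            (I.decomp.kind t).code = 4 ∧ (I.decomp.kind t).child₂ = s') →
          ((I.decomp.kind t).code = 4 → ∃ s₂ : Fin I.N, I.Child s₂ t ∧
            (I.decomp.kind t).child₂ = s₂ ∧ s₂ ≠ s) →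
          Run W D (.store 12 (.var 9) (.get 2 (.var 10)) ;;
            .assign 9 (.add (.var 9) (.const 1)) ;;
            .ite (.eq (.var 11) (.const 4))
              (.store 12 (.var 9) (.get 3 (.var 10)) ;;
              .assign 9 (.add (.var 9) (.const 1))) .skip)
            ((τ.setVar 10 t).setVar 11 (I.decomp.kind t).code) fun t τ' => t ≤ 26 ∧
              i + 1 ≤ τ'.var 9 ∧ I.IsPrefix (τ'.arr 12) (τ'.var 9) (i + 1) ∧
              I.IsClosedPrefix (τ'.arr 12) (τ'.var 9) (i + 1) := by
        intro s hs hc₁ hall h2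
        have hp := hmono.push hiL ht hs (hI2.fresh hiL ht hs)
        have hle := hp.le
        refine run_store_seq hB2 trivial trivial fun hB3 => run_assign_seq hB3
          ⟨trivial, show 1 < 2 ^ W by omega, by simp [Expr.eval]; omega⟩ fun hB4 => ?_
        simp only [Expr.eval, Expr.cost, setVar_arr, setVar_var, setArr_var, e2,
          input_arr_two, hc₁, Nat.reduceEqDiff, if_true, if_false] at hB4 ⊢
        refine run_ite hB4 ⟨trivial, show 4 < 2 ^ W by omega⟩ (fun hh2 => ?_)
          (fun hh2 => run_skip.2 ?_)
        · simp only [Test.Holds, Expr.eval, setVar_var, setArr_var, Nat.reduceEqDiff, if_true,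
            if_false] at hh2
          obtain ⟨s₂, hs₂, hc₂, hne⟩ := h2 hh2
          have hp2 := hp.push (i := i) (s := s₂) (t := t) (by omega)
            (by rw [Function.update_of_ne hiL.ne, ht]) hs₂ (by
              intro j hj
              obtain hj | rfl := Nat.lt_succ_iff_lt_or_eq.1 hj
              · rw [Function.update_of_ne hj.ne]
                exact hI2.fresh hiL ht hs₂ j hj
              · rw [Function.update_self]
                exact fun h => hne (Fin.ext h).symm)
          have hle2 := hp2.le
          refine run_store_seq hB4 trivial trivial fun hB5 => run_assign hB5
            ⟨trivial, show 1 < 2 ^ W by omega, by simp [Expr.eval]; omega⟩ ?_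
          simp only [Expr.eval, Expr.cost, Test.cost, setVar_arr, setVar_var, setArr_var, setArr_arr,
            e3, input_arr_three, hc₂, Nat.reduceEqDiff, if_true, if_false]
          refine ⟨by omega, by omega, hp2, hclosed _ _ (by omega) (fun j hj => ?_) fun s' hs' => ?_⟩
          · rw [Function.update_of_ne (by omega), Function.update_of_ne (by omega)]
          · obtain rfl | ⟨-, h3⟩ := hall s' hs'
            · exact ⟨τ.var 9, by omega, hiL, by
                rw [Function.update_of_ne (by omega), Function.update_self]⟩
            · exact ⟨τ.var 9 + 1, by omega, by omega, by rw [Function.update_self, ← hc₂, h3]⟩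
        · simp only [Test.Holds, Expr.eval, setVar_var, setArr_var, Nat.reduceEqDiff, if_true,
            if_false] at hh2
          simp only [Expr.cost, Test.cost, setVar_arr, setVar_var, setArr_arr, if_true]
          refine ⟨by omega, by omega, hp, hclosed _ _ (by omega) (fun j hj => ?_) fun s' hs' => ?_⟩
          · rw [Function.update_of_ne (by omega)]
          · obtain rfl | ⟨h3, -⟩ := hall s' hs'
            · exact ⟨τ.var 9, by omega, hiL, by rw [Function.update_self]⟩
            · exact absurd h3 hh2
      obtain ⟨s, h1, h2, h3, h4⟩ := exists_children (t := t) (by omega)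
      refine (hpush s h1 h2 h3 h4).mono fun t' τ' ⟨g1, g2⟩ => ⟨by simp only [Test.cost, Expr.cost]; omega, ?_⟩
      simpa using g2
    · simp only [Test.Holds, Expr.eval, setVar_var, if_true] at hh
      simp only [Expr.cost, Test.cost, setVar_arr, setVar_var, Nat.reduceEqDiff, if_false]
      refine ⟨by omega, hiL, hmono, hclosed _ _ le_rfl (fun _ _ => rfl) fun s hs => ?_⟩
      cases hk : I.decomp.kind t with
      | leaf => exact absurd hs ((leaf_spec hk).1 s)
      | _ => simp [hk, NodeKind.code] at hh
  · rintro t τ ht hτ hA h8 ⟨hI1, hI2, hI3⟩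
    have hL : τ.var 9 = I.N := le_antisymm hI2.le hI1
    rw [hL] at hI2 hI3
    exact ⟨by simp only [Expr.cost]; omega, hI2, hI3⟩

end RAM

/-! ### Encoding colorings and joining partitions. -/

namespace KCenterInstance

variable {I : KCenterInstance}

/-- The minimality clause of `IsJoin` for the coloring `x` itself, with which the joining loop
starts. -/
theorem IsJoin.id {V : Type} {B : Finset V} {x y : V → ℕ} :
    ∀ r : Setoid V, (∀ u ∈ B, ∀ v ∈ B, x u = x v → r u v) → (∀ u ∈ B, ∀ v ∈ B, y u = y v → r u v) →
      (∀ u ∈ B, ∀ v ∈ B, x u = x v → r u v) ∧ ∀ u ∈ B, ∃ u' ∈ B, x u = x u' ∧ r u u' :=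
  fun r h _ => ⟨h, fun u hu => ⟨u, hu, rfl, r.refl u⟩⟩

/-- An equivalence that contains both partitions relates `p` and `q`, so it also contains the
partition in which their classes are merged. Thus minimality is an invariant of the joining loop. -/
theorem IsJoin.step {V : Type} {B : Finset V} {x y z z' : V → ℕ}
    (h : ∀ r : Setoid V, (∀ u ∈ B, ∀ v ∈ B, x u = x v → r u v) →
      (∀ u ∈ B, ∀ v ∈ B, y u = y v → r u v) →
      (∀ u ∈ B, ∀ v ∈ B, z u = z v → r u v) ∧ ∀ u ∈ B, ∃ u' ∈ B, z u = x u' ∧ r u u')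
    {p q : V} (hp : p ∈ B) (hq : q ∈ B) (hpq : y p = y q)
    (hz' : ∀ v ∈ B, z' v = if z v = z q then z p else z v) :
    ∀ r : Setoid V, (∀ u ∈ B, ∀ v ∈ B, x u = x v → r u v) → (∀ u ∈ B, ∀ v ∈ B, y u = y v → r u v) →
      (∀ u ∈ B, ∀ v ∈ B, z' u = z' v → r u v) ∧ ∀ u ∈ B, ∃ u' ∈ B, z' u = x u' ∧ r u u' := by
  intro r hx hy
  obtain ⟨h1, h2⟩ := h r hx hy
  have hrpq : r p q := hy p hp q hq hpq
  have key : ∀ u ∈ B, ∃ w ∈ B, z' u = z w ∧ r u w := by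
    intro u hu
    rw [hz' u hu]
    split_ifs with huq
    · exact ⟨p, hp, rfl, r.trans (h1 u hu q hq huq) (r.symm hrpq)⟩
    · exact ⟨u, hu, rfl, r.refl u⟩
  refine ⟨fun u hu v hv huv => ?_, fun u hu => ?_⟩
  · obtain ⟨u', hu', e1, r1⟩ := key u hu
    obtain ⟨v', hv', e2, r2⟩ := key v hv
    exact r.trans r1 (r.trans (h1 u' hu' v' hv' (by rw [← e1, huv, e2])) (r.symm r2))
  · obtain ⟨w, hw, e1, r1⟩ := key u hu
    obtain ⟨u', hu', e2, r2⟩ := h2 w hw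
    exact ⟨u', hu', e1.trans e2, r.trans r1 r2⟩

theorem pow_le_states {j : ℕ} (hj : j ≤ I.bagBound) : I.colors ^ j ≤ I.states :=
  (Nat.pow_le_pow_right I.colors_pos hj).trans (Nat.le_mul_of_pos_right _ (Nat.succ_pos _))

theorem Loaded.states_lt {W : ℕ} {ctr : ℕ → ℕ} {σ : RAM.State} (h : I.Loaded W ctr σ) :
    I.states < 2 ^ W := by
  have h1 := h.big
  have h2 := Nat.le_mul_self I.states
  omega

theorem k_lt_states : I.k < I.states :=
  (Nat.lt_succ_self _).trans_le (Nat.le_mul_of_pos_left _ (pow_pos I.colors_pos _))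

end KCenterInstance

namespace RAM

open KCenterInstance

variable {W : ℕ} {D : ℕ → ℝ} {I : KCenterInstance} {ctr : ℕ → ℕ} {σ : State}

theorem eval_var (x : ℕ) : (Expr.var x).eval σ = σ.var x := rfl

theorem eval_get (a : ℕ) (i : Expr) : (Expr.get a i).eval σ = σ.arr a (i.eval σ) := rfl

theorem eval_add (e f : Expr) : (Expr.add e f).eval σ = e.eval σ + f.eval σ := rfl

theorem eval_mul (e f : Expr) : (Expr.mul e f).eval σ = e.eval σ * f.eval σ := rfl

theorem eval_mod (e f : Expr) : (Expr.mod e f).eval σ = e.eval σ % f.eval σ := rfl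

theorem agree_setVar (x c : ℕ) : Agree [x] [] σ (σ.setVar x c) :=
  ⟨fun y hy => by simp [show y ≠ x by simpa using hy], fun _ _ => rfl⟩

theorem agree_setArr (a i c : ℕ) : Agree [] [a] σ (σ.setArr a i c) :=
  ⟨fun _ _ => rfl, fun b hb => by simp [show b ≠ a by simpa using hb]⟩

/-- The entry `p` of the bag of the node in the variable `r`. -/
abbrev bagEntry (r : ℕ) (p : Expr) : Expr := .get 7 (.add (.mul (.var r) (.var 0)) p)

theorem eval_bagEntry (h : I.Loaded W ctr σ) {r j : ℕ} {p : Expr} {t : Fin I.N} (hr : σ.var r = t)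
    (hj : p.eval σ = j) : (bagEntry r p).eval σ = I.bagAt t j := by
  simp only [Expr.eval, hr, h.v0, hj, h.inp 7 (by omega)]
  rfl

theorem bagEntry_safe (h : I.Loaded W ctr σ) {r j : ℕ} {p : Expr} {t : Fin I.N} (hr : σ.var r = t)
    (hp : p.Safe W σ) (hj : p.eval σ = j) (hjt : j < (I.decomp.bag t).card) :
    (bagEntry r p).Safe W σ := by
  have h1 := mul_add_lt_mul t.2 (hjt.trans_le (I.card_bag_le_n t))
  have h2 := h.big
  simp only [Expr.Safe, Expr.eval, hr, h.v0, hj]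
  exact ⟨⟨trivial, trivial, by omega⟩, hp, by omega⟩

/-- Decodes the coloring of the bag of the node in variable `27`, of size given by variable `28`,
from variable `23` into the array `a`. -/
def decodeInto (a : ℕ) : Program :=
  .forLoop 24 28
    (.store a (bagEntry 27 (.var 24)) (.mod (.var 23) (.var 6)) ;;
    .assign 23 (.div (.var 23) (.var 6)))

theorem run_decodeInto {a x : ℕ} {t : Fin I.N} (h : I.Loaded W ctr σ)
    (ha : ∀ b ∈ [0, 1, 2, 3, 4, 5, 6, 7, 10], b ∉ [a]) (h27 : σ.var 27 = t)
    (h28 : σ.var 28 = (I.decomp.bag t).card) (h23 : σ.var 23 = x) :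
    Run W D (decodeInto a) σ fun s τ => s ≤ (I.decomp.bag t).card * 22 + 6 ∧
      ∀ v ∈ I.decomp.bag t, τ.arr a v = x / I.colors ^ I.bagIdx t v % I.colors := by
  refine run_forLoop 14 h.bdd (fun j τ => τ.var 23 = x / I.colors ^ j ∧
    ∀ v ∈ I.decomp.bag t, I.bagIdx t v < j →
      τ.arr a v = x / I.colors ^ I.bagIdx t v % I.colors) h28 (by decide : 24 ∉ [23])
    (by decide : 28 ∉ [23]) (by decide) ⟨by simp [h23], by simp⟩ ?_ ?_
  · rintro j τ hj hτ hA h24 ⟨hI1, hI2⟩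
    have hL := h.agree hA hτ (by decide : ∀ x ∈ [0, 1, 2, 3, 5, 6, 7], x ∉ [24, 23]) ha
    have e27 : τ.var 27 = t := by rw [hA.1 27 (by decide : 27 ∉ [24, 23]), h27]
    obtain ⟨v, hv, hbv, hiv⟩ := I.exists_bagAt hj
    refine run_store_seq hτ (bagEntry_safe hL e27 trivial h24 hj) ⟨trivial, trivial⟩
      fun hB => run_assign hB ⟨trivial, trivial⟩ ?_
    rw [eval_bagEntry hL e27 (p := .var 24) h24, hbv]
    refine ⟨by simp [Expr.cost], ?_, fun u hu huj => ?_⟩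
    · simp [Expr.eval, hI1, hL.v6, Nat.div_div_eq_div_mul, pow_succ]
    · simp only [Expr.eval, setVar_arr, setArr_arr, if_true, hI1, hL.v6]
      by_cases huv : u = v
      · subst huv
        simp [hiv]
      · rw [Function.update_of_ne (fun h => huv (Fin.ext h))]
        refine hI2 u hu (lt_of_le_of_ne (Nat.lt_succ_iff.1 huj) fun h => huv ?_)
        apply Fin.ext
        rw [← I.bagAt_bagIdx hu, h, hbv]
  · exact fun s τ hs _ _ _ hI => ⟨hs, fun v hv => hI.2 v hv (I.bagIdx_lt hv)⟩

/-- Encodes the coloring in array `13` of the bag of the node in variable `10` and the count in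
variable `25` to variable `21`. -/
def encode : Program :=
  .assign 21 (.const 0) ;;
  .forLoop 24 16
    (.assign 21 (.add (.mul (.var 21) (.var 6))
      (.get 13 (bagEntry 10 (.sub (.sub (.var 16) (.const 1)) (.var 24)))))) ;;
  .assign 21 (.add (.mul (.var 21) (.add (.var 1) (.const 1))) (.var 25))

theorem mul_add_div_pow_succ {m g : ℕ} (hg : g < m) (x p : ℕ) :
    (x * m + g) / m ^ (p + 1) = x / m ^ p := by
  rw [pow_succ', ← Nat.div_div_eq_div_mul, add_comm, Nat.add_mul_div_right _ _ (by omega),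
    Nat.div_eq_of_lt hg, zero_add]

/-- Horner's scheme, running through the bag from its last position so that position `p` becomes
digit `p` in base `colors`. The number of closed components is appended as lowest digit in base `k +
1`. -/
theorem run_encode {c : ℕ} {t : Fin I.N} (h : I.Loaded W ctr σ) (h10 : σ.var 10 = t)
    (h16 : σ.var 16 = (I.decomp.bag t).card) (h25 : σ.var 25 = c) (hc : c ≤ I.k)
    (hcol : ∀ v ∈ I.decomp.bag t, σ.arr 13 v < I.colors) :
    Run W D encode σ fun s τ => s ≤ (I.decomp.bag t).card * 30 + 30 ∧
      τ.var 21 < I.states ∧ (∀ v ∈ I.decomp.bag t, I.color t (τ.var 21) v = σ.arr 13 v) ∧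
      I.closedCount (τ.var 21) = c := by
  have hbig := h.big
  have hS := h.states_lt
  have hcard := I.card_bag_le t
  refine run_assign_seq h.bdd (show 0 < 2 ^ W by omega) fun hB => ?_
  -- After `j` rounds the last `j` positions have been read, and digit `p` belongs to position `card
  -- - j + p`.
  refine Run.seq hB (run_forLoop 16 hB (fun j τ => τ.var 21 < I.colors ^ j ∧ ∀ p < j,
    τ.var 21 / I.colors ^ p % I.colors = σ.arr 13 (I.bagAt t ((I.decomp.bag t).card - j + p)))
    (c := (I.decomp.bag t).card) (by simp [h16]) (by decide) (by decide) (by decide)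
    (by simp [Expr.eval]) ?_ (Q := fun s τ => s ≤ (I.decomp.bag t).card * 24 + 6 ∧
      τ.var 21 < I.colors ^ (I.decomp.bag t).card ∧ ∀ p < (I.decomp.bag t).card,
        τ.var 21 / I.colors ^ p % I.colors = σ.arr 13 (I.bagAt t p)) ?_) ?_
  · rintro j τ hj hτ hA h24 ⟨hI1, hI2⟩
    have hL := (h.agree (agree_setVar 21 _) hB (by decide) (by decide)).agree hA hτ
      (by decide) (by decide)
    have e10 : τ.var 10 = t := by rw [hA.1 10 (by decide)]; simp [h10]
    have e16 : τ.var 16 = (I.decomp.bag t).card := by rw [hA.1 16 (by decide)]; simp [h16]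
    have e13 : τ.arr 13 = σ.arr 13 := by rw [hA.2 13 (by decide)]; simp
    have hj' : (I.decomp.bag t).card - 1 - j < (I.decomp.bag t).card := by omega
    obtain ⟨v, hv, hbv, hiv⟩ := I.exists_bagAt hj'
    have hev : (Expr.sub (.sub (.var 16) (.const 1)) (.var 24)).eval τ =
        (I.decomp.bag t).card - 1 - j := by simp [Expr.eval, e16, h24]
    have hx := mul_add_lt_mul hI1 (hcol v hv)
    rw [← pow_succ] at hx
    have hpow := pow_le_states (I := I) (show j + 1 ≤ I.bagBound by omega)
    refine run_assign hτ ⟨⟨trivial, trivial, ?_⟩, bagEntry_safe hL e10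
      ⟨⟨trivial, show 1 < 2 ^ W by omega⟩, trivial⟩ hev hj', ?_⟩ ?_
    · simp only [Expr.eval, hL.v6]; omega
    · rw [eval_mul, eval_get, eval_bagEntry hL e10 hev, hbv, e13, eval_var, eval_var, hL.v6]
      omega
    · rw [eval_add, eval_mul, eval_get, eval_bagEntry hL e10 hev, hbv, e13, eval_var, eval_var,
        hL.v6]
      refine ⟨by simp [Expr.cost], by simpa using hx, fun p hp => ?_⟩
      simp only [setVar_var, Nat.reduceEqDiff, if_false, if_true]
      cases p with
      | zero =>
        rw [pow_zero, Nat.div_one, add_comm, Nat.add_mul_mod_self_right,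
          Nat.mod_eq_of_lt (hcol v hv), ← hbv]
        congr 2
        omega
      | succ p =>
        rw [mul_add_div_pow_succ (hcol v hv), hI2 p (by omega)]
        congr 2
        omega
  · intro s τ hs _ _ _ hI
    refine ⟨hs, hI.1, fun p hp => ?_⟩
    rw [hI.2 p hp]
    congr 2
    omega
  · rintro s τ ⟨hs, hlt, hdig⟩ hτ hA
    have e1 : τ.var 1 = I.k := by rw [hA.1 1 (by decide)]; simp [h.v1]
    have e25 : τ.var 25 = c := by rw [hA.1 25 (by decide)]; simp [h25]
    have hlt' : τ.var 21 < I.colors ^ I.bagBound :=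
      hlt.trans_le (Nat.pow_le_pow_right I.colors_pos hcard)
    have hx := mul_add_lt_mul hlt' (Nat.lt_succ_of_le hc)
    have hk := k_lt_states (I := I)
    change _ < I.states at hx
    rw [Nat.succ_eq_add_one] at hx
    refine run_assign hτ ⟨⟨trivial, ⟨trivial, show 1 < 2 ^ W by omega, ?_⟩, ?_⟩, trivial, ?_⟩ ?_
    · simp only [Expr.eval, e1]; omega
    · simp only [Expr.eval, e1]; omega
    · simp only [Expr.eval, e1, e25]; omega
    · simp only [Expr.eval, Expr.cost, e1, e25, setVar_var, if_true]
      refine ⟨by omega, hx, fun v hv => ?_, ?_⟩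
      · rw [color, add_comm, Nat.add_mul_div_right _ _ (Nat.succ_pos _),
          Nat.div_eq_of_lt (Nat.lt_succ_of_le hc), zero_add, hdig _ (I.bagIdx_lt hv),
          I.bagAt_bagIdx hv]
      · rw [closedCount, add_comm, Nat.add_mul_mod_self_right, Nat.mod_eq_of_lt (by omega)]

/-- Replaces the color in variable `31` by that in variable `30` in the bag of the node in variable
`10`. -/
def recolor : Program :=
  .forLoop 24 16
    (.ite (.eq (.get 13 (bagEntry 10 (.var 24))) (.var 31))
      (.store 13 (bagEntry 10 (.var 24)) (.var 30))
      .skip)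

theorem run_recolor {a b : ℕ} {t : Fin I.N} (h : I.Loaded W ctr σ) (h10 : σ.var 10 = t)
    (h16 : σ.var 16 = (I.decomp.bag t).card) (h30 : σ.var 30 = a) (h31 : σ.var 31 = b) :
    Run W D recolor σ fun s τ => s ≤ (I.decomp.bag t).card * 30 + 6 ∧
      ∀ v ∈ I.decomp.bag t, τ.arr 13 v = if σ.arr 13 v = b then a else σ.arr 13 v := by
  refine run_forLoop 22 h.bdd (fun j τ => ∀ v ∈ I.decomp.bag t, τ.arr 13 v =
    if I.bagIdx t v < j ∧ σ.arr 13 v = b then a else σ.arr 13 v) h16 (by decide) (by decide)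
    (by decide) (by simp) ?_ ?_
  · intro j τ hj hτ hA h24 hI
    have hL := h.agree hA hτ (by decide) (by decide)
    have e10 : τ.var 10 = t := by rw [hA.1 10 (by decide), h10]
    have e30 : τ.var 30 = a := by rw [hA.1 30 (by decide), h30]
    have e31 : τ.var 31 = b := by rw [hA.1 31 (by decide), h31]
    obtain ⟨v, hv, hbv, hiv⟩ := I.exists_bagAt hj
    have hs := bagEntry_safe hL e10 (p := .var 24) trivial h24 hj
    have hev := eval_bagEntry hL e10 (p := .var 24) h24
    rw [hbv] at hev
    have hother : ∀ u ∈ I.decomp.bag t, u ≠ v → (I.bagIdx t u < j + 1 ↔ I.bagIdx t u < j) := by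
      intro u hu huv
      have : I.bagIdx t u ≠ j := fun h => huv (Fin.ext (by rw [← I.bagAt_bagIdx hu, h, hbv]))
      omega
    refine run_ite hτ ⟨hs, trivial⟩ (fun hh => run_store hτ hs trivial ?_) (fun hh => run_skip.2 ?_)
    all_goals
      rw [Test.Holds, eval_get, hev, eval_var, e31, hI v hv, hiv, if_neg (by simp)] at hh
    · rw [hev]
      refine ⟨by simp [Expr.cost, Test.cost], fun u hu => ?_⟩
      simp only [Expr.eval, e30, setVar_arr, setArr_arr, if_true]
      by_cases huv : u = v
      · subst huv
        simp [hiv, hh]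
      · rw [Function.update_of_ne (fun h => huv (Fin.ext h)), hI u hu]
        simp [hother u hu huv]
    · refine ⟨by simp [Expr.cost, Test.cost], fun u hu => ?_⟩
      rw [setVar_arr, hI u hu]
      by_cases huv : u = v
      · subst huv
        simp [hh]
      · simp [hother u hu huv]
  · exact fun s τ hs _ _ _ hI => ⟨by omega, fun v hv => by rw [hI v hv]; simp [I.bagIdx_lt hv]⟩

/-- Joins the partition given by array `14` to that given by array `13`. -/
def joinColors : Program :=
  .forLoop 26 16
    (.forLoop 29 16
      (.ite (.eq (.get 14 (bagEntry 10 (.var 26))) (.get 14 (bagEntry 10 (.var 29))))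
        (.assign 30 (.get 13 (bagEntry 10 (.var 26))) ;;
        .assign 31 (.get 13 (bagEntry 10 (.var 29))) ;;
        recolor)
        .skip))

/-- Recoloring never separates vertices of equal color, so a single pass over all ordered pairs of
positions makes the coloring constant on the classes of array `14`. The cost is cubic in the bag
size. -/
theorem run_joinColors {t : Fin I.N} (h : I.Loaded W ctr σ) (h10 : σ.var 10 = t)
    (h16 : σ.var 16 = (I.decomp.bag t).card) {B : ℕ} (hB : (I.decomp.bag t).card ≤ B) :
    Run W D joinColors σ fun s τ => s ≤ B * (B * (B * 30 + 60) + 20) + 6 ∧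
      IsJoin (I.decomp.bag t) (fun v => σ.arr 13 v) (fun v => σ.arr 14 v) (fun v => τ.arr 13 v) := by
  let Inv (Q : Fin I.n → Fin I.n → Prop) (τ : State) : Prop :=
    (∀ u ∈ I.decomp.bag t, ∀ v ∈ I.decomp.bag t, σ.arr 13 u = σ.arr 13 v →
      τ.arr 13 u = τ.arr 13 v) ∧
    (∀ u ∈ I.decomp.bag t, ∀ v ∈ I.decomp.bag t, Q u v → σ.arr 14 u = σ.arr 14 v →
      τ.arr 13 u = τ.arr 13 v) ∧
    ∀ r : Setoid (Fin I.n),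
      (∀ u ∈ I.decomp.bag t, ∀ v ∈ I.decomp.bag t, σ.arr 13 u = σ.arr 13 v → r u v) →
      (∀ u ∈ I.decomp.bag t, ∀ v ∈ I.decomp.bag t, σ.arr 14 u = σ.arr 14 v → r u v) →
      (∀ u ∈ I.decomp.bag t, ∀ v ∈ I.decomp.bag t, τ.arr 13 u = τ.arr 13 v → r u v) ∧
        ∀ u ∈ I.decomp.bag t, ∃ u' ∈ I.decomp.bag t, τ.arr 13 u = σ.arr 13 u' ∧ r u u'
  refine run_forLoop ((I.decomp.bag t).card * (B * 30 + 58) + 6) h.bdd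
    (fun i τ => Inv (fun u _ => I.bagIdx t u < i) τ) h16 (by decide) (by decide) (by decide) ?_ ?_ ?_
  · exact ⟨fun u _ v _ h => h, fun u _ v _ h => absurd h (by simp), IsJoin.id⟩
  · intro i τ hi hτ hA h26 hI
    have hL := h.agree hA hτ (by decide) (by decide)
    have e10 : τ.var 10 = t := by rw [hA.1 10 (by decide), h10]
    have e16 : τ.var 16 = (I.decomp.bag t).card := by rw [hA.1 16 (by decide), h16]
    have e14 : τ.arr 14 = σ.arr 14 := hA.2 14 (by decide)
    obtain ⟨p, hp, hbp, hip⟩ := I.exists_bagAt hi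
    refine run_forLoop (B * 30 + 50) hτ (fun j ρ => Inv (fun u v => I.bagIdx t u < i ∨
      I.bagIdx t u = i ∧ I.bagIdx t v < j) ρ) e16 (by decide) (by decide) (by decide) ?_ ?_ ?_
    · simpa [Inv] using hI
    · rintro j ρ hj hρ hA' h29 ⟨hI1, hI2, hI3⟩
      have hL' := hL.agree hA' hρ (by decide) (by decide)
      have f10 : ρ.var 10 = t := by rw [hA'.1 10 (by decide), e10]
      have f26 : ρ.var 26 = i := by rw [hA'.1 26 (by decide), h26]
      have f14 : ρ.arr 14 = σ.arr 14 := by rw [hA'.2 14 (by decide), e14]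
      obtain ⟨q, hq, hbq, hiq⟩ := I.exists_bagAt hj
      have hs1 := bagEntry_safe hL' f10 (p := .var 26) trivial f26 hi
      have hs2 := bagEntry_safe hL' f10 (p := .var 29) trivial h29 hj
      have hev1 := eval_bagEntry hL' f10 (p := .var 26) f26
      have hev2 := eval_bagEntry hL' f10 (p := .var 29) h29
      rw [hbp] at hev1
      rw [hbq] at hev2
      have hQ : ∀ u ∈ I.decomp.bag t, ∀ v ∈ I.decomp.bag t,
          (I.bagIdx t u < i ∨ I.bagIdx t u = i ∧ I.bagIdx t v < j + 1) →
          (I.bagIdx t u < i ∨ I.bagIdx t u = i ∧ I.bagIdx t v < j) ∨ u = p ∧ v = q := by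
        rintro u hu v hv (h1 | ⟨h1, h2⟩)
        · exact .inl (.inl h1)
        · obtain h2 | h2 := Nat.lt_succ_iff_lt_or_eq.1 h2
          · exact .inl (.inr ⟨h1, h2⟩)
          · refine .inr ⟨Fin.ext ?_, Fin.ext ?_⟩
            · rw [← I.bagAt_bagIdx hu, h1, hbp]
            · rw [← I.bagAt_bagIdx hv, h2, hbq]
      refine run_ite hρ ⟨hs1, hs2⟩ (fun hh => ?_) (fun hh => run_skip.2 ?_)
      · rw [Test.Holds, eval_get, hev1, eval_get, hev2, f14] at hh
        refine run_assign_seq hρ hs1 fun hB1 => ?_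
        rw [eval_get, hev1] at hB1 ⊢
        have hL1 : I.Loaded W ctr (ρ.setVar 30 (ρ.arr 13 p)) := hL'.agree (agree_setVar 30 _) hB1
          (by decide) (by decide)
        have hs3 := bagEntry_safe hL1 (r := 10) (p := .var 29) (t := t) (by simp [f10]) trivial
          (show _ = j by simp [Expr.eval, h29]) hj
        have hev3 := eval_bagEntry hL1 (r := 10) (p := .var 29) (t := t) (by simp [f10])
          (show _ = j by simp [Expr.eval, h29])
        rw [hbq] at hev3
        refine run_assign_seq hB1 hs3 fun hB2 => ?_
        rw [eval_get, hev3] at hB2 ⊢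
        have hL2 := hL1.agree (agree_setVar 31 _) hB2 (by decide) (by decide)
        refine (run_recolor hL2 (t := t) (a := ρ.arr 13 p) (b := ρ.arr 13 q) (by simp [f10]) ?_
          (by simp) (by simp)).mono ?_
        · simp only [setVar_var, Nat.reduceEqDiff, if_false]
          rw [hA'.1 16 (by decide), e16]
        · rintro s ρ' ⟨hs, hz⟩
          replace hz : ∀ v ∈ I.decomp.bag t, ρ'.arr 13 v =
            if ρ.arr 13 v = ρ.arr 13 q then ρ.arr 13 p else ρ.arr 13 v := hz
          refine ⟨by simp only [Test.cost, Expr.cost]; omega, ?_⟩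
          refine ⟨fun u hu v hv huv => ?_, fun u hu v hv huv hy => ?_, ?_⟩
          · simp only [setVar_arr]
            rw [hz u hu, hz v hv, hI1 u hu v hv huv]
          · simp only [setVar_arr]
            obtain huv | ⟨rfl, rfl⟩ := hQ u hu v hv huv
            · rw [hz u hu, hz v hv, hI2 u hu v hv huv hy]
            · rw [hz u hu, hz v hv, if_pos rfl, ite_self]
          · exact IsJoin.step hI3 hp hq hh hz
      · rw [Test.Holds, eval_get, hev1, eval_get, hev2, f14] at hh
        refine ⟨by simp only [Test.cost, Expr.cost]; omega, hI1, fun u hu v hv huv hy => ?_, hI3⟩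
        obtain huv | ⟨rfl, rfl⟩ := hQ u hu v hv huv
        · exact hI2 u hu v hv huv hy
        · exact absurd hy hh
    · intro s ρ hs _ _ _ hI'
      refine ⟨by omega, hI'.1, fun u hu v hv huv => ?_, hI'.2.2⟩
      exact hI'.2.1 u hu v hv (by have := I.bagIdx_lt hv; omega)
  · intro s τ hs _ _ _ hI
    refine ⟨hs.trans ?_, hI.1, fun u hu v hv => hI.2.1 u hu v hv (I.bagIdx_lt hu), hI.2.2⟩
    have h1 : (I.decomp.bag t).card * (B * 30 + 58) ≤ B * (B * 30 + 60) :=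
      Nat.mul_le_mul hB (by omega)
    have h2 : (I.decomp.bag t).card * ((I.decomp.bag t).card * (B * 30 + 58) + 6 + 8) ≤
      B * (B * (B * 30 + 60) + 20) := Nat.mul_le_mul hB (by omega)
    omega

end RAM

/-! ### Combining two states of the children. -/

namespace KCenterInstance

variable {I : KCenterInstance} {W : ℕ} {ctr : ℕ → ℕ} {σ τ : RAM.State} {t : Fin I.N} {e₁ e₂ : ℕ}

/-- The machine is about to combine the states `e₁` and `e₂` of the children of `t`. -/
structure AtPair (I : KCenterInstance) (W : ℕ) (ctr : ℕ → ℕ) (t : Fin I.N) (e₁ e₂ : ℕ)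
    (σ : RAM.State) : Prop where
  loaded : I.Loaded W ctr σ
  v10 : σ.var 10 = t
  v11 : σ.var 11 = (I.decomp.kind t).code
  v12 : σ.var 12 = (I.decomp.kind t).child₁
  v13 : σ.var 13 = (I.decomp.kind t).child₂
  v14 : σ.var 14 = (I.decomp.kind t).label₁
  v15 : σ.var 15 = (I.decomp.kind t).label₂
  v16 : σ.var 16 = (I.decomp.bag t).card
  v17 : σ.var 17 = I.input.arr 6 (I.decomp.kind t).child₁
  v18 : σ.var 18 = e₁
  v19 : σ.var 19 = e₂
  lt₁ : e₁ < I.states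
  lt₂ : e₂ < I.states
  table : ∀ i, σ.arr 15 i ≤ I.n * I.n

theorem AtPair.agree {vs as : List ℕ} (h : I.AtPair W ctr t e₁ e₂ σ) (hA : RAM.Agree vs as σ τ)
    (hτ : RAM.Bdd W τ)
    (hv : ∀ x ∈ [0, 1, 2, 3, 5, 6, 7, 10, 11, 12, 13, 14, 15, 16, 17, 18, 19], x ∉ vs)
    (ha : ∀ a ∈ [0, 1, 2, 3, 4, 5, 6, 7, 10, 15], a ∉ as) :
    I.AtPair W ctr t e₁ e₂ τ where
  loaded := h.loaded.agree hA hτ (fun x hx => hv x (by simp at hx ⊢; omega))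
    (fun x hx => ha x (by simp at hx ⊢; omega))
  v10 := by rw [hA.1 10 (hv 10 (by simp)), h.v10]
  v11 := by rw [hA.1 11 (hv 11 (by simp)), h.v11]
  v12 := by rw [hA.1 12 (hv 12 (by simp)), h.v12]
  v13 := by rw [hA.1 13 (hv 13 (by simp)), h.v13]
  v14 := by rw [hA.1 14 (hv 14 (by simp)), h.v14]
  v15 := by rw [hA.1 15 (hv 15 (by simp)), h.v15]
  v16 := by rw [hA.1 16 (hv 16 (by simp)), h.v16]
  v17 := by rw [hA.1 17 (hv 17 (by simp)), h.v17]
  v18 := by rw [hA.1 18 (hv 18 (by simp)), h.v18]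
  v19 := by rw [hA.1 19 (hv 19 (by simp)), h.v19]
  lt₁ := h.lt₁
  lt₂ := h.lt₂
  table := by rw [hA.2 15 (ha 15 (by simp))]; exact h.table

/-- The state `e₁` of the child `s` has been decoded. -/
structure ChildLoaded (I : KCenterInstance) (s : Fin I.N) (e₁ : ℕ) (σ : RAM.State) : Prop where
  v22 : σ.var 22 = σ.arr 15 (s * I.states + e₁) - 1
  v25 : σ.var 25 = I.closedCount e₁
  a13 : ∀ v ∈ I.decomp.bag s, σ.arr 13 v = I.color s e₁ v
  ne : σ.arr 15 (s * I.states + e₁) ≠ 0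

/-- The machine has decided if `e₁` and `e₂` can be combined; in that case the resulting coloring is
in array `13`, the number of closed components in variable `25` and the position of the bottleneck
distance in variable `22`. -/
def IsCandidate (I : KCenterInstance) (ctr V : ℕ → ℕ) (t : Fin I.N) (e₁ e₂ : ℕ)
    (τ : RAM.State) : Prop :=
  (τ.var 20 = 1 ↔ I.Enabled V t e₁ e₂) ∧
    (I.Enabled V t e₁ e₂ → I.Outcome t e₁ e₂ (fun v => τ.arr 13 v) (τ.var 25) ∧ τ.var 25 ≤ I.k ∧
      (∀ v ∈ I.decomp.bag t, τ.arr 13 v < I.colors) ∧ τ.var 22 < I.n * I.n ∧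
      I.distArray (τ.var 22) = I.bottleneck ctr V t e₁ e₂)

theorem color_lt (s : Fin I.N) (e : ℕ) (v : Fin I.n) : I.color s e v < I.colors :=
  Nat.mod_lt _ I.colors_pos

end KCenterInstance

namespace RAM

theorem ite_one_zero_iff {p : Prop} [Decidable p] : (if p then 1 else 0) = 1 ↔ p := by simp

open KCenterInstance

variable {W : ℕ} {I : KCenterInstance} {ctr : ℕ → ℕ} {σ : State} {t : Fin I.N} {e₁ e₂ : ℕ}

/-- The position of the state in variable `y` of the node in variable `x` in the tables. -/
abbrev tableEntry (x y : ℕ) : Expr := .add (.mul (.var x) (.var 7)) (.var y)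

/-- `k + 1` -/
abbrev succK : Expr := .add (.var 1) (.const 1)

theorem tableEntry_safe (h : I.Loaded W ctr σ) {x y e : ℕ} {s : Fin I.N} (hx : σ.var x = s)
    (hy : σ.var y = e) (he : e < I.states) : (tableEntry x y).Safe W σ := by
  have h1 := mul_add_lt_mul s.2 he
  have h2 := h.big
  simp only [Expr.Safe, Expr.eval, hx, h.v7, hy]
  exact ⟨⟨trivial, trivial, by omega⟩, trivial, by omega⟩

theorem eval_tableEntry (h : I.Loaded W ctr σ) {x y e : ℕ} {s : Fin I.N} (hx : σ.var x = s)
    (hy : σ.var y = e) : (tableEntry x y).eval σ = s * I.states + e := by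
  simp only [Expr.eval, hx, h.v7, hy]

theorem succK_safe (h : I.Loaded W ctr σ) : succK.Safe W σ := by
  have h1 := h.states_lt
  have h2 := k_lt_states (I := I)
  have h3 := h.big
  simp only [Expr.Safe, Expr.eval, h.v1]
  exact ⟨trivial, by omega, by omega⟩

theorem eval_succK (h : I.Loaded W ctr σ) : succK.eval σ = I.k + 1 := by
  simp only [Expr.eval, h.v1]

/-- Decodes the state of the first child. -/
def loadChild : Program :=
  .assign 22 (.sub (.get 15 (tableEntry 12 18)) (.const 1)) ;;
  .assign 25 (.mod (.var 18) succK) ;;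
  .assign 23 (.div (.var 18) succK) ;;
  .assign 27 (.var 12) ;;
  .assign 28 (.var 17) ;;
  decodeInto 13

theorem run_loadChild {D : ℕ → ℝ} (h : I.AtPair W ctr t e₁ e₂ σ) {s : Fin I.N}
    (hs : (I.decomp.kind t).child₁ = s) (hne : σ.arr 15 (s * I.states + e₁) ≠ 0) :
    Run W D loadChild σ fun r τ => r ≤ I.bagBound * 22 + 50 ∧ I.ChildLoaded s e₁ τ := by
  have hL := h.loaded
  have hbig := hL.big
  have h12 : σ.var 12 = s := by rw [h.v12, hs]
  refine run_assign_seq hL.bdd ⟨tableEntry_safe hL h12 h.v18 h.lt₁, show 1 < 2 ^ W by omega⟩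
    fun hB1 => ?_
  have hL1 := hL.agree (agree_setVar 22 _) hB1 (by decide) (by decide)
  refine run_assign_seq hB1 ⟨trivial, succK_safe hL1⟩ fun hB2 => ?_
  have hL2 := hL1.agree (agree_setVar 25 _) hB2 (by decide) (by decide)
  refine run_assign_seq hB2 ⟨trivial, succK_safe hL2⟩ fun hB3 => run_assign_seq hB3 trivial fun hB4 =>
    run_assign_seq hB4 trivial fun hB5 => ?_
  have hL3 := hL2.agree (agree_setVar 23 _) hB3 (by decide) (by decide)
  have hL4 := hL3.agree (agree_setVar 27 _) hB4 (by decide) (by decide)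
  have hL5 := hL4.agree (agree_setVar 28 _) hB5 (by decide) (by decide)
  obtain ⟨r, τ, he, hr, hcol⟩ := run_decodeInto (D := D) (a := 13) (t := s) (x := e₁ / (I.k + 1)) hL5
    (by decide) (by simp [Expr.eval, h12])
    (by simp only [setVar_var, Expr.eval]; simp [h.v17, hs, input_arr_six])
    (by simp only [setVar_var, Expr.eval]; simp [h.v18, hL.v1])
  have hA := he.agree
  refine ⟨r, τ, he, ?_, ?_, ?_, fun v hv => hcol v hv, ?_⟩
  · have := I.card_bag_le s
    simp only [Expr.cost]
    omega
  · rw [hA.1 22 (by decide), hA.2 15 (by decide)]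
    simp only [setVar_var, setVar_arr]
    simp [Expr.eval, h12, hL.v7, h.v18]
  · rw [hA.1 25 (by decide)]
    simp only [setVar_var]
    simp [Expr.eval, h.v18, hL.v1, closedCount]
  · rw [hA.2 15 (by decide)]
    simpa using hne

/-- Combines a state of the child of an introduce vertex node with a color. -/
def introVertexStep : Program :=
  .ite (.lt (.var 19) (.var 6)) (.assign 20 (.const 1)) (.assign 20 (.const 0)) ;;
  .forLoop 24 17
    (.ite (.eq (.get 13 (bagEntry 12 (.var 24))) (.var 19)) (.assign 20 (.const 0)) .skip) ;;
  .store 13 (.var 14) (.var 19)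

theorem run_introVertexStep {D : ℕ → ℝ} (h : I.AtPair W ctr t e₁ e₂ σ) {s : Fin I.N} {v : Fin I.n}
    (hk : I.decomp.kind t = .introVertex v s) (hc : I.ChildLoaded s e₁ σ)
    (hd : σ.var 22 < I.n * I.n) :
    Run W D introVertexStep σ fun r τ => r ≤ I.bagBound * 30 + 50 ∧
      I.IsCandidate ctr (σ.arr 15) t e₁ e₂ τ := by
  have hL := h.loaded
  have hbig := hL.big
  have h12 : σ.var 12 = s := by rw [h.v12, hk]; rfl
  have h17 : σ.var 17 = (I.decomp.bag s).card := by
    rw [h.v17, hk]; exact input_arr_six s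
  obtain ⟨-, -, hvs, hb⟩ := child_introVertex hk
  refine Run.seq hL.bdd (R := fun r τ => r ≤ 6 ∧ τ.var 20 = if e₂ < I.colors then 1 else 0) ?_ ?_
  · refine run_ite hL.bdd ⟨trivial, trivial⟩
      (fun hh => run_assign hL.bdd (show 1 < 2 ^ W by omega) ?_)
      (fun hh => run_assign hL.bdd (show 0 < 2 ^ W by omega) ?_)
    all_goals
      simp only [Test.Holds, Expr.eval, h.v19, hL.v6] at hh
      simp [Test.cost, Expr.cost, Expr.eval, hh]
  rintro r τ ⟨hr, h20⟩ hτ hA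
  have hP := h.agree hA hτ (by decide) (by decide)
  refine Run.seq hτ (run_forLoop 13 hτ (fun j ρ => ρ.var 20 = if e₂ < I.colors ∧
    ∀ u ∈ I.decomp.bag s, I.bagIdx s u < j → I.color s e₁ u ≠ e₂ then 1 else 0)
    (c := (I.decomp.bag s).card) (by rw [hA.1 17 (by decide), h17]) (by decide) (by decide)
    (by decide) (by simp [h20]) ?_ (Q := fun r ρ => r ≤ I.bagBound * 21 + 6 ∧
      ρ.var 20 = if e₂ < I.colors ∧ ∀ u ∈ I.decomp.bag s, I.color s e₁ u ≠ e₂ then 1 else 0) ?_) ?_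
  · intro j ρ hj hρ hA' h24 hI
    have hP' := hP.agree hA' hρ (by decide) (by decide)
    have f12 : ρ.var 12 = s := by rw [hP'.v12, hk]; rfl
    have f13 : ρ.arr 13 = σ.arr 13 := by rw [hA'.2 13 (by decide), hA.2 13 (by decide)]
    obtain ⟨u, hu, hbu, hiu⟩ := I.exists_bagAt hj
    have hs := bagEntry_safe hP'.loaded f12 (p := .var 24) trivial h24 hj
    have hev := eval_bagEntry hP'.loaded f12 (p := .var 24) h24
    rw [hbu] at hev
    have huniq : ∀ w ∈ I.decomp.bag s, I.bagIdx s w < j + 1 → I.bagIdx s w < j ∨ w = u := by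
      intro w hw hwj
      by_cases hwj' : I.bagIdx s w = j
      · exact .inr (Fin.ext (by rw [← I.bagAt_bagIdx hw, hwj', hbu]))
      · exact .inl (by omega)
    refine run_ite hρ ⟨hs, trivial⟩ (fun hh => run_assign hρ (show 0 < 2 ^ W by omega) ?_)
      (fun hh => run_skip.2 ?_)
    · rw [Test.Holds, eval_get, hev, eval_var, hP'.v19, f13, hc.a13 u hu] at hh
      refine ⟨by simp [Test.cost, Expr.cost], ?_⟩
      rw [if_neg fun h => h.2 u hu (by omega) hh]
      simp [Expr.eval]
    · rw [Test.Holds, eval_get, hev, eval_var, hP'.v19, f13, hc.a13 u hu] at hh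
      refine ⟨by simp [Test.cost, Expr.cost], ?_⟩
      simp only [setVar_var, Nat.reduceEqDiff, if_false]
      rw [hI]
      refine if_congr (and_congr_right fun _ => ⟨fun h w hw hwj => ?_, fun h w hw hwj =>
        h w hw (by omega)⟩) rfl rfl
      obtain hwj | rfl := huniq w hw hwj
      exacts [h w hw hwj, hh]
  · intro r ρ hr _ _ _ hI
    refine ⟨hr.trans (by have := I.card_bag_le s; omega), ?_⟩
    rw [hI]
    exact if_congr (and_congr_right fun _ => ⟨fun h w hw => h w hw (I.bagIdx_lt hw),
      fun h w hw _ => h w hw⟩) rfl rfl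
  · rintro r' ρ ⟨hr', h20'⟩ hρ hA'
    have hP' := hP.agree hA' hρ (by decide) (by decide)
    have f13 : ρ.arr 13 = σ.arr 13 := by rw [hA'.2 13 (by decide), hA.2 13 (by decide)]
    have f22 : ρ.var 22 = σ.var 22 := by rw [hA'.1 22 (by decide), hA.1 22 (by decide)]
    have f25 : ρ.var 25 = σ.var 25 := by rw [hA'.1 25 (by decide), hA.1 25 (by decide)]
    refine run_store hρ trivial trivial ⟨by simp only [Expr.cost]; omega, ?_, ?_⟩
    · have hE : I.Enabled (σ.arr 15) t e₁ e₂ ↔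
          e₂ < I.colors ∧ ∀ u ∈ I.decomp.bag s, I.color s e₁ u ≠ e₂ := by
        simp only [Enabled, hk]
        exact and_iff_right hc.ne
      rw [setArr_var, h20', hE]
      exact ite_one_zero_iff
    · intro hE
      simp only [Enabled, hk] at hE
      have e14 : ρ.var 14 = v := by rw [hP'.v14, hk]; rfl
      simp only [Outcome, bottleneck, hk, Expr.eval, setArr_var, setArr_arr, if_true, e14, hP'.v19, f13,
        f22, f25, hc.v22, hc.v25, Function.update_self, true_and]
      have hne : ∀ u ∈ I.decomp.bag s, (u : ℕ) ≠ v := fun u hu h => hvs (Fin.ext h ▸ hu)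
      refine ⟨fun u hu => by rw [Function.update_of_ne (hne u hu), hc.a13 u hu], closedCount_le I _,
        fun u hu => ?_, by rwa [← hc.v22], trivial⟩
      rw [hb, Finset.mem_insert] at hu
      obtain rfl | hu := hu
      · rw [Function.update_self]; exact hE.2.1
      · rw [Function.update_of_ne (hne u hu), hc.a13 u hu]; exact color_lt _ _ _

/-- Merges the components of the ends of an edge with equal labels. -/
def introEdgeStep : Program :=
  .assign 20 (.const 1) ;;
  .assign 30 (.get 13 (.var 14)) ;;
  .assign 31 (.get 13 (.var 15)) ;;
  .ite (.eq (.mod (.var 30) (.var 1)) (.mod (.var 31) (.var 1))) recolor .skip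

theorem run_introEdgeStep {D : ℕ → ℝ} (h : I.AtPair W ctr t e₁ e₂ σ) {s : Fin I.N} {u v : Fin I.n}
    (hk : I.decomp.kind t = .introEdge u v s) (hc : I.ChildLoaded s e₁ σ)
    (hd : σ.var 22 < I.n * I.n) :
    Run W D introEdgeStep σ fun r τ => r ≤ I.bagBound * 30 + 50 ∧
      I.IsCandidate ctr (σ.arr 15) t e₁ e₂ τ := by
  have hL := h.loaded
  have hbig := hL.big
  obtain ⟨-, -, -, hb, hu, hv⟩ := child_introEdge hk
  have hcol := hc.a13
  rw [← hb] at hcol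
  have h14 : σ.var 14 = u := by rw [h.v14, hk]; rfl
  have h15 : σ.var 15 = v := by rw [h.v15, hk]; rfl
  refine run_assign_seq hL.bdd (show 1 < 2 ^ W by omega) fun hB1 => run_assign_seq hB1 trivial
    fun hB2 => run_assign_seq hB2 trivial fun hB3 => ?_
  have hA : Agree [20, 30, 31] [] σ (((σ.setVar 20 1).setVar 30 (I.color s e₁ u)).setVar 31
      (I.color s e₁ v)) :=
    ((agree_setVar 20 _).mono (by simp) (by simp)).trans (((agree_setVar 30 _).mono (by simp)
      (by simp)).trans ((agree_setVar 31 _).mono (by simp) (by simp)))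
  simp only [Expr.eval, setVar_arr, setVar_var, Nat.reduceEqDiff, if_false, h14, h15, hcol u hu,
    hcol v hv] at hB3 ⊢
  have hP := h.agree hA hB3 (by decide) (by decide)
  have hfin : ∀ (ρ : State), Agree [20, 24, 30, 31] [13] σ ρ → ρ.var 20 = 1 →
      (∀ a ∈ I.decomp.bag t, ρ.arr 13 a =
        if I.color s e₁ u % I.k = I.color s e₁ v % I.k ∧ I.color s e₁ a = I.color s e₁ v then
          I.color s e₁ u else I.color s e₁ a) → I.IsCandidate ctr (σ.arr 15) t e₁ e₂ ρ := by
    intro ρ hA' h20 hρ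
    refine ⟨by simp [h20, Enabled, hk, hc.ne], fun _ => ?_⟩
    simp only [Outcome, bottleneck, hk, hA'.1 22 (by decide), hA'.1 25 (by decide), hc.v22, hc.v25,
      true_and]
    refine ⟨hρ, closedCount_le I _, fun a ha => ?_, by rwa [← hc.v22], trivial⟩
    rw [hρ a ha]
    split_ifs <;> exact color_lt _ _ _
  refine run_ite hB3 ⟨⟨trivial, trivial⟩, trivial, trivial⟩ (fun hh => ?_) (fun hh => run_skip.2 ?_)
  · simp only [Test.Holds, Expr.eval, setVar_var, Nat.reduceEqDiff, if_true, if_false, hL.v1] at hh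
    obtain ⟨r, τ, he, hr, hτ⟩ := run_recolor (D := D) hP.loaded hP.v10 hP.v16 rfl rfl
    refine ⟨r, τ, he, ?_, hfin τ ?_ ?_ ?_⟩
    · have := I.card_bag_le t
      simp only [Test.cost, Expr.cost]
      omega
    · exact (hA.mono (by simp) (by simp)).trans (he.agree.mono (by decide) (by decide))
    · rw [he.agree.1 20 (by decide)]
      simp
    · intro a ha
      rw [hτ a ha]
      simp [hh, hcol a ha]
  · simp only [Test.Holds, Expr.eval, setVar_var, Nat.reduceEqDiff, if_true, if_false, hL.v1] at hh
    refine ⟨by simp only [Test.cost, Expr.cost]; omega, hfin _ (hA.mono (by simp) (by simp)) (by simp)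
      fun a ha => ?_⟩
    simp [hh, hcol a ha]

/-- Forgets a vertex. -/
def forgetStep : Program :=
  .assign 30 (.get 13 (.var 14)) ;;
  .assign 26 (.const 1) ;;
  .forLoop 24 16
    (.ite (.eq (.get 13 (bagEntry 10 (.var 24))) (.var 30)) (.assign 26 (.const 0)) .skip) ;;
  .assign 25 (.add (.var 25) (.var 26)) ;;
  .ite (.lt (.var 1) (.var 25)) (.assign 20 (.const 0)) (.assign 20 (.const 1)) ;;
  .assign 31 (.add (.mul (.var 14) (.var 0)) (.get 10 (.mod (.var 30) (.var 1)))) ;;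
  .ite (.distLe (.var 22) (.var 31)) (.assign 22 (.var 31)) .skip

open Classical in
theorem run_forgetStep (h : I.AtPair W ctr t e₁ e₂ σ) {s : Fin I.N} {v : Fin I.n}
    (hctr : ∀ j < I.k, ctr j < I.n)
    (hk : I.decomp.kind t = .forget v s) (hc : I.ChildLoaded s e₁ σ)
    (hd : σ.var 22 < I.n * I.n) :
    Run W I.distArray forgetStep σ fun r τ => r ≤ I.bagBound * 30 + 100 ∧
      I.IsCandidate ctr (σ.arr 15) t e₁ e₂ τ := by
  have hL := h.loaded
  have hbig := hL.big
  obtain ⟨-, -, hvs, hb⟩ := child_forget hk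
  have hsub : I.decomp.bag t ⊆ I.decomp.bag s := hb ▸ Finset.erase_subset _ _
  have h14 : σ.var 14 = v := by rw [h.v14, hk]; rfl
  refine run_assign_seq hL.bdd trivial fun hB1 => run_assign_seq hB1 (show 1 < 2 ^ W by omega)
    fun hB2 => ?_
  simp only [Expr.eval, h14, hc.a13 v hvs] at hB2 ⊢
  have hA : Agree [26, 30] [] σ ((σ.setVar 30 (I.color s e₁ v)).setVar 26 1) :=
    ((agree_setVar 30 _).mono (by simp) (by simp)).trans
      ((agree_setVar 26 _).mono (by simp) (by simp))
  have hP := h.agree hA hB2 (by decide) (by decide)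
  refine Run.seq hB2 (run_forLoop 13 hB2 (fun j ρ => ρ.var 26 =
    if ∃ u ∈ I.decomp.bag t, I.bagIdx t u < j ∧ I.color s e₁ u = I.color s e₁ v then 0 else 1)
    hP.v16 (by decide) (by decide) (by decide) (by simp) ?_
    (Q := fun r ρ => r ≤ I.bagBound * 21 + 6 ∧ ρ.var 26 =
      if ∃ u ∈ I.decomp.bag t, I.color s e₁ u = I.color s e₁ v then 0 else 1) ?_) ?_
  · intro j ρ hj hρ hA' h24 hI
    have hP' := hP.agree hA' hρ (by decide) (by decide)
    have f13 : ρ.arr 13 = σ.arr 13 := by rw [hA'.2 13 (by decide)]; simp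
    have f30 : ρ.var 30 = I.color s e₁ v := by rw [hA'.1 30 (by decide)]; simp
    obtain ⟨u, hu, hbu, hiu⟩ := I.exists_bagAt hj
    have hs := bagEntry_safe hP'.loaded hP'.v10 (p := .var 24) trivial h24 hj
    have hev := eval_bagEntry hP'.loaded hP'.v10 (p := .var 24) h24
    rw [hbu] at hev
    refine run_ite hρ ⟨hs, trivial⟩ (fun hh => run_assign hρ (show 0 < 2 ^ W by omega) ?_)
      (fun hh => run_skip.2 ?_)
    · rw [Test.Holds, eval_get, hev, eval_var, f13, f30, hc.a13 u (hsub hu)] at hh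
      refine ⟨by simp [Test.cost, Expr.cost], ?_⟩
      rw [if_pos ⟨u, hu, by omega, hh⟩]
      simp [Expr.eval]
    · rw [Test.Holds, eval_get, hev, eval_var, f13, f30, hc.a13 u (hsub hu)] at hh
      refine ⟨by simp [Test.cost, Expr.cost], ?_⟩
      simp only [setVar_var, Nat.reduceEqDiff, if_false]
      rw [hI]
      refine if_congr ⟨fun ⟨w, hw, hwj, hwv⟩ => ⟨w, hw, by omega, hwv⟩, fun ⟨w, hw, hwj, hwv⟩ =>
        ⟨w, hw, ?_, hwv⟩⟩ rfl rfl
      refine lt_of_le_of_ne (Nat.lt_succ_iff.1 hwj) fun hwj' => hh ?_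
      rwa [← show w = u from Fin.ext (by rw [← I.bagAt_bagIdx hw, hwj', hbu])]
  · intro r ρ hr _ _ _ hI
    refine ⟨hr.trans (by have := I.card_bag_le t; omega), ?_⟩
    rw [hI]
    exact if_congr ⟨fun ⟨w, hw, _, hwv⟩ => ⟨w, hw, hwv⟩, fun ⟨w, hw, hwv⟩ =>
      ⟨w, hw, I.bagIdx_lt hw, hwv⟩⟩ rfl rfl
  · rintro r ρ ⟨hr, h26⟩ hρ hA'
    have hP' := hP.agree hA' hρ (by decide) (by decide)
    have hA2 : Agree [24, 26, 30] [] σ ρ := (hA.mono (by simp) (by simp)).trans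
      (hA'.mono (by decide) (by decide))
    have f30 : ρ.var 30 = I.color s e₁ v := by rw [hA'.1 30 (by decide)]; simp
    have f25 : ρ.var 25 = I.closedCount e₁ := by rw [hA2.1 25 (by decide), hc.v25]
    have f22 : ρ.var 22 = σ.arr 15 (s * I.states + e₁) - 1 := by rw [hA2.1 22 (by decide), hc.v22]
    have f13 : ρ.arr 13 = σ.arr 13 := hA2.2 13 (by decide)
    obtain ⟨c, hcc⟩ : ∃ c, c = I.closedCount e₁ +
      if ∃ u ∈ I.decomp.bag t, I.color s e₁ u = I.color s e₁ v then 0 else 1 := ⟨_, rfl⟩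
    -- The sum is formed before it is compared with `k`, so the word must be able to hold `k + 1`.
    have hcle : c ≤ I.k + 1 := by
      have := closedCount_le I e₁
      rw [hcc]; split_ifs <;> omega
    have hev : (Expr.add (.var 25) (.var 26)).eval ρ = c := by
      simp only [Expr.eval, f25, h26, hcc]
    have hkW := hL.states_lt
    have hkS := k_lt_states (I := I)
    refine run_assign_seq hρ ⟨trivial, trivial, ?_⟩ fun hB3 => ?_
    · change (Expr.add (.var 25) (.var 26)).eval ρ < _
      omega
    rw [hev] at hB3 ⊢
    refine Run.seq hB3 (R := fun r τ => r ≤ 6 ∧ τ.var 20 = if c ≤ I.k then 1 else 0) ?_ ?_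
    · refine run_ite hB3 ⟨trivial, trivial⟩
        (fun hh => run_assign hB3 (show 0 < 2 ^ W by omega) ?_)
        (fun hh => run_assign hB3 (show 1 < 2 ^ W by omega) ?_)
      all_goals
        simp only [Test.Holds, Expr.eval, setVar_var, Nat.reduceEqDiff, if_true, if_false,
          hP'.loaded.v1] at hh
        refine ⟨by simp [Test.cost, Expr.cost], ?_⟩
        simp [Expr.eval]
        omega
    rintro r' τ ⟨hr', h20⟩ hτ hA3
    have hA4 : Agree [20, 24, 25, 26, 30] [] σ τ := (hA2.mono (by simp) (by simp)).trans
      (((agree_setVar 25 c).mono (by simp) (by simp)).trans (hA3.mono (by decide) (by decide)))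
    have hP4 := h.agree hA4 hτ (by decide) (by decide)
    have g25 : τ.var 25 = c := by rw [hA3.1 25 (by decide)]; simp
    have g30 : τ.var 30 = I.color s e₁ v := by rw [hA3.1 30 (by decide)]; simp [f30]
    have g22 : τ.var 22 = σ.arr 15 (s * I.states + e₁) - 1 := by rw [hA4.1 22 (by decide), hc.v22]
    have g13 : τ.arr 13 = σ.arr 13 := hA4.2 13 (by decide)
    have g14 : τ.var 14 = v := by rw [hP4.v14, hk]; rfl
    have hk0 : 0 < I.k := by have := I.two_le_k; omega
    have hw : (v : ℕ) * I.n + ctr (I.color s e₁ v % I.k) < I.n * I.n :=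
      mul_add_lt_mul v.2 (hctr _ (Nat.mod_lt _ hk0))
    have hev2 : (Expr.add (.mul (.var 14) (.var 0)) (.get 10 (.mod (.var 30) (.var 1)))).eval τ =
        v * I.n + ctr (I.color s e₁ v % I.k) := by
      simp only [Expr.eval, g14, g30, hP4.loaded.v0, hP4.loaded.v1, hP4.loaded.a10]
    refine run_assign_seq hτ ⟨⟨trivial, trivial, ?_⟩, ⟨trivial, trivial⟩, ?_⟩ fun hB5 => ?_
    · simp only [Expr.eval, g14, hP4.loaded.v0]; omega
    · change (Expr.add (.mul (.var 14) (.var 0)) (.get 10 (.mod (.var 30) (.var 1)))).eval τ < _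
      omega
    rw [hev2] at hB5 ⊢
    have hfin : ∀ ρ' : State, ρ'.var 20 = τ.var 20 → ρ'.var 25 = c → ρ'.arr 13 = σ.arr 13 →
        ρ'.var 22 < I.n * I.n → I.distArray (ρ'.var 22) =
          max (I.distArray (σ.arr 15 (s * I.states + e₁) - 1))
            (I.distArray (v * I.n + ctr (I.color s e₁ v % I.k))) →
        I.IsCandidate ctr (σ.arr 15) t e₁ e₂ ρ' := by
      intro ρ' h1 h2 h3 h4 h5
      have hE : I.Enabled (σ.arr 15) t e₁ e₂ ↔ c ≤ I.k := by
        simp only [Enabled, hk, hcc]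
        exact ⟨fun h => h.2, fun h => ⟨hc.ne, h⟩⟩
      refine ⟨by rw [h1, h20, hE]; exact ite_one_zero_iff, fun hE' => ?_⟩
      simp only [Outcome, bottleneck, hk, h2, h3]
      exact ⟨⟨hcc, fun u hu => hc.a13 u (hsub hu)⟩, hE.1 hE', fun u hu => by
        rw [hc.a13 u (hsub hu)]; exact color_lt _ _ _, h4, h5⟩
    have hcost : r + r' ≤ I.bagBound * 21 + 12 := by omega
    refine run_ite hB5 ⟨trivial, trivial⟩ (fun hh => run_assign hB5 trivial ?_)
      (fun hh => run_skip.2 ?_)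
    · simp only [Test.Holds, Expr.eval, setVar_var, Nat.reduceEqDiff, if_true, if_false, g22] at hh
      refine ⟨by simp only [Test.cost, Expr.cost]; omega, hfin _ (by simp) (by simp [g25])
        (by simp [g13]) ?_ ?_⟩
      · simpa [Expr.eval] using hw
      · simp [Expr.eval, hh]
    · simp only [Test.Holds, Expr.eval, setVar_var, Nat.reduceEqDiff, if_true, if_false, g22] at hh
      refine ⟨by simp only [Test.cost, Expr.cost]; omega, hfin _ (by simp) (by simp [g25])
        (by simp [g13]) ?_ ?_⟩
      · simp only [setVar_var, Nat.reduceEqDiff, if_false, g22]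
        rw [← hc.v22]; exact hd
      · simp only [setVar_var, Nat.reduceEqDiff, if_false, g22]
        rw [max_eq_left (not_le.1 hh).le]

end RAM

namespace KCenterInstance

theorem IsJoin.congr_left {V : Type} {B : Finset V} {x y x' y' z : V → ℕ} (h : IsJoin B x y z)
    (hx : ∀ u ∈ B, x u = x' u) (hy : ∀ u ∈ B, y u = y' u) : IsJoin B x' y' z := by
  refine ⟨fun u hu v hv huv => h.1 u hu v hv (by rw [hx u hu, hx v hv, huv]),
    fun u hu v hv huv => h.2.1 u hu v hv (by rw [hy u hu, hy v hv, huv]), fun r h1 h2 => ?_⟩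
  obtain ⟨h3, h4⟩ := h.2.2 r (fun u hu v hv huv => h1 u hu v hv (by rw [← hx u hu, ← hx v hv, huv]))
    (fun u hu v hv huv => h2 u hu v hv (by rw [← hy u hu, ← hy v hv, huv]))
  refine ⟨h3, fun u hu => ?_⟩
  obtain ⟨u', hu', hz, hr⟩ := h4 u hu
  exact ⟨u', hu', by rw [hz, hx u' hu'], hr⟩

theorem Enabled.ne_zero {I : KCenterInstance} {V : ℕ → ℕ} {t : Fin I.N} {e₁ e₂ : ℕ}
    (h : I.Enabled V t e₁ e₂) (hc : (I.decomp.kind t).code ≠ 0) :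
    V ((I.decomp.kind t).child₁ * I.states + e₁) ≠ 0 := by
  cases hk : I.decomp.kind t <;>
    simp only [Enabled, hk, NodeKind.code, ne_eq, not_true_eq_false] at h hc
  exacts [h.1, h, h.1, h.1]

end KCenterInstance

namespace RAM

open KCenterInstance

variable {W : ℕ} {I : KCenterInstance} {ctr : ℕ → ℕ} {σ : State} {t : Fin I.N} {e₁ e₂ : ℕ}

/-- Decodes the state of the second child. -/
def loadSecond : Program :=
  .assign 33 (.sub (.var 33) (.const 1)) ;;
  .ite (.distLe (.var 22) (.var 33)) (.assign 22 (.var 33)) .skip ;;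
  .assign 25 (.add (.var 25) (.mod (.var 19) succK)) ;;
  .assign 23 (.div (.var 19) succK) ;;
  .assign 27 (.var 13) ;;
  .assign 28 (.var 16) ;;
  decodeInto 14

theorem run_loadSecond (h : I.AtPair W ctr t e₁ e₂ σ) {s₁ s₂ : Fin I.N}
    (hk : I.decomp.kind t = .join s₁ s₂) (hc : I.ChildLoaded s₁ e₁ σ)
    (h33 : σ.var 33 = σ.arr 15 (s₂ * I.states + e₂)) :
    Run W I.distArray loadSecond σ fun r τ => r ≤ I.bagBound * 22 + 60 ∧
      (τ.var 22 = σ.arr 15 (s₁ * I.states + e₁) - 1 ∨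
        τ.var 22 = σ.arr 15 (s₂ * I.states + e₂) - 1) ∧
      I.distArray (τ.var 22) = max (I.distArray (σ.arr 15 (s₁ * I.states + e₁) - 1))
        (I.distArray (σ.arr 15 (s₂ * I.states + e₂) - 1)) ∧
      τ.var 25 = I.closedCount e₁ + I.closedCount e₂ ∧
      ∀ v ∈ I.decomp.bag t, τ.arr 14 v = I.color s₂ e₂ v := by
  have hL := h.loaded
  have hbig := hL.big
  have hkS := k_lt_states (I := I)
  have hSW := hL.states_lt
  obtain ⟨-, -, -, -, -, hb⟩ := child_join hk
  refine run_assign_seq hL.bdd ⟨trivial, show 1 < 2 ^ W by omega⟩ fun hB1 => ?_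
  simp only [Expr.eval, h33] at hB1 ⊢
  have hA1 := agree_setVar (σ := σ) 33 (σ.arr 15 (s₂ * I.states + e₂) - 1)
  have hL1 := hL.agree hA1 hB1 (by decide) (by decide)
  refine Run.seq hB1 (R := fun r τ => r ≤ 6 ∧
    (τ.var 22 = σ.arr 15 (s₁ * I.states + e₁) - 1 ∨
      τ.var 22 = σ.arr 15 (s₂ * I.states + e₂) - 1) ∧
    I.distArray (τ.var 22) = max (I.distArray (σ.arr 15 (s₁ * I.states + e₁) - 1))
        (I.distArray (σ.arr 15 (s₂ * I.states + e₂) - 1))) ?_ ?_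
  · refine run_ite hB1 ⟨trivial, trivial⟩ (fun hh => run_assign hB1 trivial ?_)
      (fun hh => run_skip.2 ?_)
    all_goals
      simp only [Test.Holds, Expr.eval, setVar_var, Nat.reduceEqDiff, if_true, if_false, hc.v22] at hh
      simp only [Test.cost, Expr.cost, Expr.eval, setVar_var, Nat.reduceEqDiff, if_true, if_false,
        hc.v22]
    · exact ⟨by omega, .inr trivial, (max_eq_right hh).symm⟩
    · exact ⟨by omega, .inl trivial, (max_eq_left (not_le.1 hh).le).symm⟩
  rintro r τ ⟨hr, h22, h22'⟩ hτ hA2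
  have hA : Agree [22, 33] [] σ τ := (hA1.mono (by simp) (by simp)).trans
    (hA2.mono (by decide) (by decide))
  have hP := h.agree hA hτ (by decide) (by decide)
  have e25 : (Expr.add (.var 25) (.mod (.var 19) succK)).eval τ =
      I.closedCount e₁ + I.closedCount e₂ := by
    rw [eval_add, eval_mod, eval_var, eval_var, eval_succK hP.loaded, hP.v19, hA.1 25 (by decide),
      hc.v25]
    rfl
  have hS2 : 2 * I.states ≤ I.states * I.states := by
    have := I.two_le_k
    exact Nat.mul_le_mul_right _ (by omega)
  have hcc := closedCount_le I e₁
  have hcc' := closedCount_le I e₂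
  refine run_assign_seq hτ ⟨trivial, ⟨trivial, succK_safe hP.loaded⟩, ?_⟩ fun hB3 => ?_
  · change (Expr.add (.var 25) (.mod (.var 19) succK)).eval τ < _
    omega
  rw [e25] at hB3 ⊢
  have hL3 := hP.loaded.agree (agree_setVar 25 _) hB3 (by decide) (by decide)
  refine run_assign_seq hB3 ⟨trivial, succK_safe hL3⟩ fun hB4 => run_assign_seq hB4 trivial fun hB5 =>
    run_assign_seq hB5 trivial fun hB6 => ?_
  have hL4 := hL3.agree (agree_setVar 23 _) hB4 (by decide) (by decide)
  have hL5 := hL4.agree (agree_setVar 27 _) hB5 (by decide) (by decide)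
  have hL6 := hL5.agree (agree_setVar 28 _) hB6 (by decide) (by decide)
  obtain ⟨r', ρ, he, hr', hcol⟩ := run_decodeInto (D := I.distArray) (a := 14) (t := s₂)
    (x := e₂ / (I.k + 1)) hL6 (by decide) (by simp [Expr.eval, hP.v13, hk, NodeKind.child₂])
    (by simp only [setVar_var, Expr.eval]; simp [hP.v16, hb])
    (by simp only [setVar_var, Expr.eval]; simp [hP.v19, hP.loaded.v1])
  have hA' := he.agree
  refine ⟨r', ρ, he, ?_, ?_, ?_, ?_, ?_⟩
  · have := I.card_bag_le s₂
    simp only [Expr.cost]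
    omega
  · rw [hA'.1 22 (by decide)]
    simpa using h22
  · rw [hA'.1 22 (by decide)]
    simpa using h22'
  · rw [hA'.1 25 (by decide)]
    simp
  · rw [← hb]
    exact hcol

/-- Tests if the labels given by the colors in the arrays `13` and `14` agree. -/
def compareLabels : Program :=
  .assign 20 (.const 1) ;;
  .forLoop 24 16
    (.ite (.eq (.mod (.get 13 (bagEntry 10 (.var 24))) (.var 1))
        (.mod (.get 14 (bagEntry 10 (.var 24))) (.var 1)))
      .skip (.assign 20 (.const 0)))

open Classical in
theorem run_compareLabels {D : ℕ → ℝ} (h : I.AtPair W ctr t e₁ e₂ σ) :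
    Run W D compareLabels σ fun r τ => r ≤ I.bagBound * 30 + 10 ∧
      τ.var 20 = if ∀ u ∈ I.decomp.bag t, σ.arr 13 u % I.k = σ.arr 14 u % I.k then 1 else 0 := by
  have hL := h.loaded
  have hbig := hL.big
  refine run_assign_seq hL.bdd (show 1 < 2 ^ W by omega) fun hB1 => ?_
  have hP := h.agree (agree_setVar 20 _) hB1 (by decide) (by decide)
  refine run_forLoop 22 hB1 (fun j ρ => ρ.var 20 = if ∀ u ∈ I.decomp.bag t, I.bagIdx t u < j →
    σ.arr 13 u % I.k = σ.arr 14 u % I.k then 1 else 0) hP.v16 (by decide) (by decide) (by decide)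
    (by simp [Expr.eval]) ?_ ?_
  · intro j ρ hj hρ hA h24 hI
    have hP' := hP.agree hA hρ (by decide) (by decide)
    have f13 : ρ.arr 13 = σ.arr 13 := by rw [hA.2 13 (by decide)]; simp
    have f14 : ρ.arr 14 = σ.arr 14 := by rw [hA.2 14 (by decide)]; simp
    obtain ⟨u, hu, hbu, hiu⟩ := I.exists_bagAt hj
    have hs := bagEntry_safe hP'.loaded hP'.v10 (p := .var 24) trivial h24 hj
    have hev := eval_bagEntry hP'.loaded hP'.v10 (p := .var 24) h24
    rw [hbu] at hev
    refine run_ite hρ ⟨⟨hs, trivial⟩, hs, trivial⟩ (fun hh => run_skip.2 ?_)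
      (fun hh => run_assign hρ (show 0 < 2 ^ W by omega) ?_)
    all_goals
      rw [Test.Holds, eval_mod, eval_mod, eval_get 13, eval_get 14, hev, eval_var, hP'.loaded.v1, f13,
        f14] at hh
      refine ⟨by simp [Test.cost, Expr.cost], ?_⟩
      simp only [setVar_var, Nat.reduceEqDiff, if_false, if_true]
    · rw [hI]
      refine if_congr ⟨fun h w hw hwj => ?_, fun h w hw hwj => h w hw (by omega)⟩ rfl rfl
      obtain hwj | hwj := Nat.lt_succ_iff_lt_or_eq.1 hwj
      · exact h w hw hwj
      · rwa [show w = u from Fin.ext (by rw [← I.bagAt_bagIdx hw, hwj, hbu])]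
    · rw [if_neg fun h => hh (h u hu (by omega))]
      rfl
  · intro r ρ hr _ _ _ hI
    refine ⟨?_, ?_⟩
    · have := I.card_bag_le t
      simp only [Expr.cost]
      omega
    · rw [hI]
      exact if_congr ⟨fun h w hw => h w hw (I.bagIdx_lt hw), fun h w hw _ => h w hw⟩ rfl rfl

/-- Combines the states of two children with the same bag. -/
def joinStep : Program :=
  .assign 20 (.const 0) ;;
  .assign 33 (.get 15 (tableEntry 13 19)) ;;
  .ite (.eq (.var 33) (.const 0)) .skip
    (loadSecond ;; compareLabels ;;
    .ite (.lt (.var 1) (.var 25)) (.assign 20 (.const 0)) .skip ;;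
    joinColors)

/-- Bounds the time for combining two states. -/
def _root_.KCenterInstance.pairTime (I : KCenterInstance) : ℕ :=
  I.bagBound * (I.bagBound * (I.bagBound * 30 + 60) + 20) + I.bagBound * 150 + 400

/-- If both entries are present, the partitions are joined even when the labels disagree or the
count is too large; variable `20` then prevents the result from being used. The slack in the time
bound leaves room for `loadChild` and the tests that select the type of the node. -/
theorem run_joinStep (h : I.AtPair W ctr t e₁ e₂ σ) {s₁ s₂ : Fin I.N}
    (hk : I.decomp.kind t = .join s₁ s₂) (hc : I.ChildLoaded s₁ e₁ σ) :
    Run W I.distArray joinStep σ fun r τ =>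
      r + I.bagBound * 60 + 150 ≤ I.pairTime ∧ I.IsCandidate ctr (σ.arr 15) t e₁ e₂ τ := by
  classical
  have hL := h.loaded
  have hbig := hL.big
  obtain ⟨-, -, -, -, hb1, hb2⟩ := child_join hk
  have h13 : σ.var 13 = s₂ := by rw [h.v13, hk]; rfl
  have hdist : ∀ i, σ.arr 15 i ≠ 0 → σ.arr 15 i - 1 < I.n * I.n := fun i hi => by
    have := h.table i
    omega
  refine run_assign_seq hL.bdd (show 0 < 2 ^ W by omega) fun hB1 => ?_
  simp only [Expr.eval] at hB1 ⊢
  have hA1 := agree_setVar (σ := σ) 20 0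
  have hP1 := h.agree hA1 hB1 (by decide) (by decide)
  have hev := eval_tableEntry hP1.loaded (x := 13) (s := s₂) (by simp [h13]) hP1.v19
  refine run_assign_seq hB1 (tableEntry_safe hP1.loaded (x := 13) (s := s₂) (by simp [h13]) hP1.v19
    h.lt₂) fun hB2 => ?_
  rw [show (Expr.get 15 (tableEntry 13 19)).eval (σ.setVar 20 0) = σ.arr 15 (s₂ * I.states + e₂) by
    rw [eval_get]; exact congrArg _ hev] at hB2 ⊢
  obtain ⟨τ, hτdef⟩ : ∃ τ, τ = ((σ.setVar 20 0).setVar 33 (σ.arr 15 (s₂ * I.states + e₂))) := ⟨_, rfl⟩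
  have hA : Agree [20, 33] [] σ τ := hτdef ▸ (hA1.mono (by simp) (by simp)).trans
    ((agree_setVar 33 _).mono (by simp) (by simp))
  have h33 : τ.var 33 = σ.arr 15 (s₂ * I.states + e₂) := by simp [hτdef]
  have h20 : τ.var 20 = 0 := by simp [hτdef]
  have f15 : τ.arr 15 = σ.arr 15 := hA.2 15 (by decide)
  rw [← hτdef] at hB2 ⊢
  have hP := h.agree hA hB2 (by decide) (by decide)
  refine run_ite hB2 ⟨trivial, show 0 < 2 ^ W by omega⟩ (fun hh => run_skip.2 ?_) (fun hh => ?_)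
  all_goals simp only [Test.Holds, Expr.eval, h33] at hh
  · have hE : ¬ I.Enabled (σ.arr 15) t e₁ e₂ := by simp [Enabled, hk, hh]
    refine ⟨?_, by simp [h20, hE], fun h => absurd h hE⟩
    simp only [Test.cost, Expr.cost, pairTime]
    omega
  have hc' : I.ChildLoaded s₁ e₁ τ := ⟨by rw [hA.1 22 (by decide), f15, hc.v22],
    by rw [hA.1 25 (by decide), hc.v25], by rw [hA.2 13 (by decide)]; exact hc.a13,
    by rw [f15]; exact hc.ne⟩
  refine Run.seq hB2 (run_loadSecond hP hk hc' (by rw [h33, f15])) ?_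
  rintro r₁ τ₁ ⟨hr₁, h22, h22', h25, h14⟩ hτ₁ hA₁
  rw [f15] at h22 h22'
  have hP₁ := hP.agree hA₁ hτ₁ (by decide) (by decide)
  have c13 : ∀ u ∈ I.decomp.bag t, τ₁.arr 13 u = I.color s₁ e₁ u := by
    rw [hA₁.2 13 (by decide), ← hb1]
    exact hc'.a13
  refine Run.seq hτ₁ (run_compareLabels hP₁) ?_
  rintro r₂ τ₂ ⟨hr₂, h20'⟩ hτ₂ hA₂
  have hP₂ := hP₁.agree hA₂ hτ₂ (by decide) (by decide)
  rw [if_congr (Q := ∀ u ∈ I.decomp.bag t, I.color s₁ e₁ u % I.k = I.color s₂ e₂ u % I.k)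
    ⟨fun h u hu => by rw [← c13 u hu, ← h14 u hu]; exact h u hu, fun h u hu => by
      rw [c13 u hu, h14 u hu]; exact h u hu⟩ rfl rfl] at h20'
  have g25 : τ₂.var 25 = I.closedCount e₁ + I.closedCount e₂ := by rw [hA₂.1 25 (by decide), h25]
  refine Run.seq hτ₂ (R := fun r τ => r ≤ 8 ∧ (τ.var 20 = 1 ↔ I.Enabled (σ.arr 15) t e₁ e₂)) ?_ ?_
  · have hE : I.Enabled (σ.arr 15) t e₁ e₂ ↔
        (∀ u ∈ I.decomp.bag t, I.color s₁ e₁ u % I.k = I.color s₂ e₂ u % I.k) ∧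
          I.closedCount e₁ + I.closedCount e₂ ≤ I.k := by
      simp only [Enabled, hk]
      exact ⟨fun h => h.2.2, fun h => ⟨hc.ne, hh, h⟩⟩
    refine run_ite hτ₂ ⟨trivial, trivial⟩
      (fun hh => run_assign hτ₂ (show 0 < 2 ^ W by omega) ?_) (fun hh => run_skip.2 ?_)
    all_goals
      simp only [Test.Holds, Expr.eval, hP₂.loaded.v1, g25] at hh
      refine ⟨by simp [Test.cost, Expr.cost], ?_⟩
      rw [hE]
    · simp [Expr.eval, hh]
    · rw [h20', ite_one_zero_iff]
      exact (and_iff_left (not_lt.1 hh)).symm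
  rintro r₃ τ₃ ⟨hr₃, h20''⟩ hτ₃ hA₃
  have hP₃ := hP₂.agree hA₃ hτ₃ (by decide) (by decide)
  have hA₂₃ : Agree [20, 24] [] τ₁ τ₃ := (hA₂.mono (by decide) (by decide)).trans
    (hA₃.mono (by decide) (by decide))
  obtain ⟨r₄, τ₄, he, hr₄, hJ⟩ := run_joinColors (D := I.distArray) hP₃.loaded hP₃.v10 hP₃.v16
    (I.card_bag_le t)
  have hA₄ := he.agree
  refine ⟨r₄, τ₄, he, ?_, by rw [hA₄.1 20 (by decide), h20''], fun hE => ?_⟩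
  · simp only [Test.cost, Expr.cost, pairTime]
    omega
  rw [hA₂₃.2 13 (by decide), hA₂₃.2 14 (by decide)] at hJ
  have hJ' : IsJoin (I.decomp.bag t) (I.color s₁ e₁) (I.color s₂ e₂) (fun v => τ₄.arr 13 v) :=
    hJ.congr_left c13 h14
  have k25 : τ₄.var 25 = I.closedCount e₁ + I.closedCount e₂ := by
    rw [hA₄.1 25 (by decide), hA₂₃.1 25 (by decide), h25]
  have k22 : τ₄.var 22 = τ₁.var 22 := by rw [hA₄.1 22 (by decide), hA₂₃.1 22 (by decide)]
  simp only [Outcome, bottleneck, Enabled, hk, k25, k22] at hE ⊢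
  refine ⟨⟨trivial, hJ'⟩, hE.2.2.2, fun v hv => ?_, ?_, h22'⟩
  -- Minimality is used with the trivial relation, only to learn that every color of the join is a
  -- color from the first child and hence a valid one.
  · obtain ⟨u, -, hz, -⟩ := (hJ'.2.2 ⊤ (fun _ _ _ _ _ => trivial) (fun _ _ _ _ _ => trivial)).2 v hv
    exact hz.trans_lt (color_lt _ _ _)
  · obtain h | h := h22 <;> rw [h]
    exacts [hdist _ hc.ne, hdist _ hh]

/-- The state of a leaf. -/
def leafStep : Program :=
  .assign 20 (.const 1) ;; .assign 22 (.const 0) ;; .assign 25 (.const 0)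

/-- Combines the states in variables `18` and `19` of the children. -/
def candidate : Program :=
  .ite (.eq (.var 11) (.const 0)) leafStep
    (.ite (.eq (.get 15 (tableEntry 12 18)) (.const 0)) (.assign 20 (.const 0))
      (loadChild ;;
      .ite (.eq (.var 11) (.const 1)) introVertexStep
        (.ite (.eq (.var 11) (.const 2)) introEdgeStep
          (.ite (.eq (.var 11) (.const 3)) forgetStep joinStep))))

theorem run_candidate (h : I.AtPair W ctr t e₁ e₂ σ) (hctr : ∀ j < I.k, ctr j < I.n) :
    Run W I.distArray candidate σ fun r τ =>
      r ≤ I.pairTime ∧ I.IsCandidate ctr (σ.arr 15) t e₁ e₂ τ := by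
  have hL := h.loaded
  have hbig := hL.big
  have hn := I.two_le_n
  have hnn : 4 ≤ I.n * I.n := Nat.mul_le_mul hn hn
  refine run_ite hL.bdd ⟨trivial, show 0 < 2 ^ W by omega⟩ (fun hh => ?_) (fun hh => ?_)
  all_goals simp only [Test.Holds, Expr.eval, h.v11] at hh
  · refine run_assign_seq hL.bdd (show 1 < 2 ^ W by omega) fun hB1 => run_assign_seq hB1
      (show 0 < 2 ^ W by omega) fun hB2 => run_assign hB2 (show 0 < 2 ^ W by omega) ?_
    refine ⟨by simp only [Test.cost, Expr.cost, pairTime]; omega, ?_⟩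
    cases hk : I.decomp.kind t with
    | leaf =>
      refine ⟨by simp [Enabled, hk, Expr.eval], fun _ => ?_⟩
      simp only [Outcome, bottleneck, hk, (leaf_spec hk).2]
      simp [Expr.eval]
      omega
    | _ => simp [hk, NodeKind.code] at hh
  obtain ⟨s, -, hs, -⟩ := exists_children hh
  have h12 : σ.var 12 = s := by rw [h.v12, hs]
  have hev : (Expr.get 15 (tableEntry 12 18)).eval σ = σ.arr 15 (s * I.states + e₁) := by
    rw [eval_get, eval_tableEntry hL h12 h.v18]
  refine run_ite hL.bdd ⟨tableEntry_safe hL h12 h.v18 h.lt₁, show 0 < 2 ^ W by omega⟩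
    (fun hh2 => run_assign hL.bdd (show 0 < 2 ^ W by omega) ?_) (fun hh2 => ?_)
  all_goals rw [Test.Holds, hev] at hh2; simp only [Expr.eval] at hh2
  · refine ⟨by simp only [Test.cost, Expr.cost, pairTime]; omega, ?_⟩
    have hE : ¬ I.Enabled (σ.arr 15) t e₁ e₂ := fun h => h.ne_zero hh (by rw [hs, hh2])
    exact ⟨by simp [hE, Expr.eval], fun h => absurd h hE⟩
  refine Run.seq hL.bdd (run_loadChild h hs hh2) ?_
  rintro r τ ⟨hr, hc⟩ hτ hA
  have hP := h.agree hA hτ (by decide) (by decide)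
  have f15 : τ.arr 15 = σ.arr 15 := hA.2 15 (by decide)
  have hd : τ.var 22 < I.n * I.n := by
    have h1 := hc.v22
    have h2 := hc.ne
    have h3 := hP.table (s * I.states + e₁)
    omega
  rw [← f15]
  have c3 : (3 : ℕ) < 2 ^ W := by omega
  cases hk : I.decomp.kind t with
  | leaf => simp [hk, NodeKind.code] at hh
  | introVertex v s' =>
    have h11 : τ.var 11 = 1 := by rw [hP.v11, hk]; rfl
    obtain rfl : s' = s := by simpa [hk, NodeKind.child₁, Fin.ext_iff] using hs
    refine run_ite hτ ⟨trivial, show 1 < 2 ^ W by omega⟩ (fun _ => ?_) (fun hh3 => absurd h11 hh3)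
    refine (run_introVertexStep hP hk hc hd).mono fun r' ρ hr' => ⟨?_, hr'.2⟩
    have := hr'.1
    simp only [Test.cost, Expr.cost, pairTime]
    omega
  | introEdge u v s' =>
    have h11 : τ.var 11 = 2 := by rw [hP.v11, hk]; rfl
    obtain rfl : s' = s := by simpa [hk, NodeKind.child₁, Fin.ext_iff] using hs
    refine run_ite hτ ⟨trivial, show 1 < 2 ^ W by omega⟩ (fun hh3 => ?_) (fun _ => ?_)
    · simp [Test.Holds, Expr.eval, h11] at hh3
    refine run_ite hτ ⟨trivial, show 2 < 2 ^ W by omega⟩ (fun _ => ?_) (fun hh3 => absurd h11 hh3)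
    refine (run_introEdgeStep hP hk hc hd).mono fun r' ρ hr' => ⟨?_, hr'.2⟩
    have := hr'.1
    simp only [Test.cost, Expr.cost, pairTime]
    omega
  | forget v s' =>
    have h11 : τ.var 11 = 3 := by rw [hP.v11, hk]; rfl
    obtain rfl : s' = s := by simpa [hk, NodeKind.child₁, Fin.ext_iff] using hs
    refine run_ite hτ ⟨trivial, show 1 < 2 ^ W by omega⟩ (fun hh3 => ?_) (fun _ => ?_)
    · simp [Test.Holds, Expr.eval, h11] at hh3
    refine run_ite hτ ⟨trivial, show 2 < 2 ^ W by omega⟩ (fun hh3 => ?_) (fun _ => ?_)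
    · simp [Test.Holds, Expr.eval, h11] at hh3
    refine run_ite hτ ⟨trivial, c3⟩ (fun _ => ?_) (fun hh3 => absurd h11 hh3)
    refine (run_forgetStep hP hctr hk hc hd).mono fun r' ρ hr' => ⟨?_, hr'.2⟩
    have := hr'.1
    simp only [Test.cost, Expr.cost, pairTime]
    omega
  | join s₁ s₂ =>
    have h11 : τ.var 11 = 4 := by rw [hP.v11, hk]; rfl
    obtain rfl : s₁ = s := by simpa [hk, NodeKind.child₁, Fin.ext_iff] using hs
    refine run_ite hτ ⟨trivial, show 1 < 2 ^ W by omega⟩ (fun hh3 => ?_) (fun _ => ?_)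
    · simp [Test.Holds, Expr.eval, h11] at hh3
    refine run_ite hτ ⟨trivial, show 2 < 2 ^ W by omega⟩ (fun hh3 => ?_) (fun _ => ?_)
    · simp [Test.Holds, Expr.eval, h11] at hh3
    refine run_ite hτ ⟨trivial, c3⟩ (fun hh3 => ?_) (fun _ => ?_)
    · simp [Test.Holds, Expr.eval, h11] at hh3
    refine (run_joinStep hP hk hc).mono fun r' ρ hr' => ⟨?_, hr'.2⟩
    have := hr'.1
    simp only [Test.cost, Expr.cost]
    omega

end RAM

/-! ### Filling the tables. -/

namespace KCenterInstance

variable {I : KCenterInstance} {ctr V V' P P' : ℕ → ℕ} {t : Fin I.N} {e₁ e₂ : ℕ}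

theorem Outcome.congr {x y : Fin I.n → ℕ} {c : ℕ} (h : I.Outcome t e₁ e₂ x c)
    (hxy : ∀ v ∈ I.decomp.bag t, x v = y v) : I.Outcome t e₁ e₂ y c := by
  unfold Outcome at *
  cases hk : I.decomp.kind t with
  | leaf => simpa only [hk] using h
  | introVertex v s =>
    simp only [hk] at h ⊢
    obtain ⟨-, -, -, hb⟩ := child_introVertex hk
    refine ⟨h.1, by rw [← hxy v (by simp [hb])]; exact h.2.1, fun u hu => ?_⟩
    rw [← hxy u (by simp [hb, hu])]
    exact h.2.2 u hu
  | introEdge u v s =>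
    simp only [hk] at h ⊢
    exact ⟨h.1, fun a ha => by rw [← hxy a ha]; exact h.2 a ha⟩
  | forget v s =>
    simp only [hk] at h ⊢
    exact ⟨h.1, fun a ha => by rw [← hxy a ha]; exact h.2 a ha⟩
  | join s₁ s₂ =>
    simp only [hk] at h ⊢
    obtain ⟨h1, h2, h3, h4⟩ := h
    refine ⟨h1, fun u hu v hv huv => ?_, fun u hu v hv huv => ?_, fun r hr hr' => ?_⟩
    · rw [← hxy u hu, ← hxy v hv, h2 u hu v hv huv]
    · rw [← hxy u hu, ← hxy v hv, h3 u hu v hv huv]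
    · obtain ⟨h5, h6⟩ := h4 r hr hr'
      refine ⟨fun u hu v hv huv => h5 u hu v hv (by rwa [hxy u hu, hxy v hv]), fun u hu => ?_⟩
      rw [← hxy u hu]
      exact h6 u hu

/-- `Enabled` and `bottleneck` depend only on the rows of the children. -/
theorem enabled_congr (h : ∀ s, I.Child s t → ∀ e < I.states,
    V (s * I.states + e) = V' (s * I.states + e)) (h₁ : e₁ < I.states) (h₂ : e₂ < I.states) :
    (I.Enabled V t e₁ e₂ ↔ I.Enabled V' t e₁ e₂) ∧
      I.bottleneck ctr V t e₁ e₂ = I.bottleneck ctr V' t e₁ e₂ := by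
  unfold Enabled bottleneck
  cases hk : I.decomp.kind t with
  | leaf => simp
  | introVertex v s => simp only [h s (child_introVertex hk).1 e₁ h₁, and_self]
  | introEdge u v s => simp only [h s (child_introEdge hk).1 e₁ h₁, and_self]
  | forget v s => simp only [h s (child_forget hk).1 e₁ h₁, and_self]
  | join s₁ s₂ =>
    simp only [h s₁ (child_join hk).1 e₁ h₁, h s₂ (child_join hk).2.1 e₂ h₂, and_self]

/-- The result of recording the combination of the states `e₁` and `e₂` in the tables. -/
def Recorded (I : KCenterInstance) (ctr V P V' P' : ℕ → ℕ) (t : Fin I.N) (e₁ e₂ : ℕ) : Prop :=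
  (V' = V ∧ P' = P ∧ (I.Enabled V t e₁ e₂ → ∃ e < I.states,
    I.Outcome t e₁ e₂ (I.color t e) (I.closedCount e) ∧ V (t * I.states + e) ≠ 0 ∧
      I.distArray (V (t * I.states + e) - 1) ≤ I.bottleneck ctr V t e₁ e₂)) ∨
  I.Enabled V t e₁ e₂ ∧ ∃ e < I.states, I.Outcome t e₁ e₂ (I.color t e) (I.closedCount e) ∧
    ∃ d < I.n * I.n, I.distArray d = I.bottleneck ctr V t e₁ e₂ ∧
      (V (t * I.states + e) = 0 ∨
        I.bottleneck ctr V t e₁ e₂ ≤ I.distArray (V (t * I.states + e) - 1)) ∧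
      V' = Function.update V (t * I.states + e) (d + 1) ∧
      P' = Function.update P (t * I.states + e) (e₁ * I.states + e₂)

/-- The row of `t` contains only correct entries, and contains entries for all pairs of states
satisfying `R`; the other rows are as in the tables `V₀`, `P₀`. -/
structure RowUpTo (I : KCenterInstance) (ctr V₀ P₀ V P : ℕ → ℕ) (t : Fin I.N) (R : ℕ → ℕ → Prop) :
    Prop where
  table : ∀ i, V i ≤ I.n * I.n
  other : ∀ s : Fin I.N, s ≠ t → ∀ e < I.states, V (s * I.states + e) = V₀ (s * I.states + e) ∧
    P (s * I.states + e) = P₀ (s * I.states + e)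
  sound : ∀ e < I.states, V (t * I.states + e) ≠ 0 → ∃ e₁ < I.states, ∃ e₂ < I.states,
    P (t * I.states + e) = e₁ * I.states + e₂ ∧ I.Enabled V t e₁ e₂ ∧
      I.Outcome t e₁ e₂ (I.color t e) (I.closedCount e) ∧
      I.distArray (V (t * I.states + e) - 1) = I.bottleneck ctr V t e₁ e₂
  complete : ∀ e₁ < I.states, ∀ e₂ < I.states, R e₁ e₂ → I.Enabled V t e₁ e₂ → ∃ e < I.states,
    I.Outcome t e₁ e₂ (I.color t e) (I.closedCount e) ∧ V (t * I.states + e) ≠ 0 ∧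
      I.distArray (V (t * I.states + e) - 1) ≤ I.bottleneck ctr V t e₁ e₂

theorem mul_add_inj {S a b c d : ℕ} (hb : b < S) (hd : d < S) (h : a * S + b = c * S + d) :
    a = c ∧ b = d := by
  have h1 := congrArg (· / S) h
  have h2 := congrArg (· % S) h
  simp only [add_comm _ b, add_comm _ d, Nat.add_mul_div_right _ _ (show 0 < S by omega),
    Nat.div_eq_of_lt hb, Nat.div_eq_of_lt hd, zero_add, Nat.add_mul_mod_self_right,
    Nat.mod_eq_of_lt hb, Nat.mod_eq_of_lt hd] at h1 h2
  exact ⟨h1, h2⟩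

theorem Child.ne {s t : Fin I.N} (h : I.Child s t) : s ≠ t := fun hst => by
  have := h.dist
  rw [hst] at this
  omega

/-- Only the row of `t` changes, while `Enabled` and `bottleneck` at `t` read the rows of its
children; so the other entries remain sound. An existing entry is replaced only by one that is no
larger, so completeness for earlier pairs persists. -/
theorem RowUpTo.step {V₀ P₀ : ℕ → ℕ} {R R' : ℕ → ℕ → Prop} (h : I.RowUpTo ctr V₀ P₀ V P t R)
    (hrec : I.Recorded ctr V P V' P' t e₁ e₂) (h₁ : e₁ < I.states) (h₂ : e₂ < I.states)
    (hR : ∀ a b, a < I.states → b < I.states → R' a b → R a b ∨ a = e₁ ∧ b = e₂) :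
    I.RowUpTo ctr V₀ P₀ V' P' t R' := by
  obtain ⟨rfl, rfl, hrec⟩ | ⟨hen, e, he, hout, d, hd, hdb, hle, rfl, rfl⟩ := hrec
  · refine ⟨h.table, h.other, h.sound, fun a ha b hb hab hE => ?_⟩
    obtain hab | ⟨rfl, rfl⟩ := hR a b ha hb hab
    exacts [h.complete a ha b hb hab hE, hrec hE]
  have hrow : ∀ s : Fin I.N, s ≠ t → ∀ e' < I.states, s * I.states + e' ≠ t * I.states + e :=
    fun s hs e' he' h => hs (Fin.ext (mul_add_inj he' he h).1)
  have hcongr : ∀ {a b}, a < I.states → b < I.states → _ := fun {a b} ha hb =>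
    enabled_congr (ctr := ctr) (V := V) (V' := Function.update V (t * I.states + e) (d + 1)) (t := t)
      (fun s hs e' he' => by rw [Function.update_of_ne (hrow s hs.ne e' he')]) ha hb
  have hself : ∀ e' < I.states, e' ≠ e → t * I.states + e' ≠ t * I.states + e :=
    fun e' _ hne => by omega
  refine ⟨fun i => ?_, fun s hs e' he' => ?_, fun e' he' hne => ?_, fun a ha b hb hab hE => ?_⟩
  · simp only [Function.update_apply]
    split_ifs
    exacts [hd, h.table i]
  · rw [Function.update_of_ne (hrow s hs e' he'), Function.update_of_ne (hrow s hs e' he')]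
    exact h.other s hs e' he'
  · by_cases hee : e' = e
    · subst hee
      refine ⟨e₁, h₁, e₂, h₂, Function.update_self .., (hcongr h₁ h₂).1.1 hen, hout, ?_⟩
      rw [Function.update_self, ← (hcongr h₁ h₂).2]
      exact hdb
    · rw [Function.update_of_ne (hself e' he' hee)] at hne
      obtain ⟨a, ha, b, hb, h3, h4, h5, h6⟩ := h.sound e' he' hne
      refine ⟨a, ha, b, hb, ?_, (hcongr ha hb).1.1 h4, h5, ?_⟩
      · rwa [Function.update_of_ne (hself e' he' hee)]
      · rwa [Function.update_of_ne (hself e' he' hee), ← (hcongr ha hb).2]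
  · rw [← (hcongr ha hb).1] at hE
    rw [← (hcongr ha hb).2]
    obtain hab | ⟨rfl, rfl⟩ := hR a b ha hb hab
    · obtain ⟨e', he', h3, h4, h5⟩ := h.complete a ha b hb hab hE
      by_cases hee : e' = e
      · subst hee
        refine ⟨e', he', h3, by rw [Function.update_self]; omega, ?_⟩
        rw [Function.update_self, Nat.add_sub_cancel, hdb]
        exact (hle.resolve_left h4).trans h5
      · exact ⟨e', he', h3, by rwa [Function.update_of_ne (hself e' he' hee)],
          by rwa [Function.update_of_ne (hself e' he' hee)]⟩
    · exact ⟨e, he, hout, by rw [Function.update_self]; omega, by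
        rw [Function.update_self, Nat.add_sub_cancel, hdb]⟩

theorem RowUpTo.rowCorrect {V₀ P₀ : ℕ → ℕ} {R : ℕ → ℕ → Prop}
    (h : I.RowUpTo ctr V₀ P₀ V P t R) (hR : ∀ a < I.states, ∀ b < I.states, R a b) :
    I.RowCorrect ctr V P t :=
  ⟨h.sound, fun a ha b hb => h.complete a ha b hb (hR a ha b hb)⟩

/-- Correctness of a row involves only this row and the rows of the children, so it survives the
computation of further rows. -/
theorem RowCorrect.congr (h : I.RowCorrect ctr V P t)
    (hV : ∀ s, s = t ∨ I.Child s t → ∀ e < I.states,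
      V' (s * I.states + e) = V (s * I.states + e) ∧ P' (s * I.states + e) = P (s * I.states + e)) :
    I.RowCorrect ctr V' P' t := by
  have hcongr : ∀ {a b}, a < I.states → b < I.states → _ := fun {a b} ha hb =>
    enabled_congr (ctr := ctr) (V := V) (V' := V') (t := t)
      (fun s hs e' he' => (hV s (.inr hs) e' he').1.symm) ha hb
  refine ⟨fun e he hne => ?_, fun a ha b hb hE => ?_⟩
  · obtain ⟨h1, h2⟩ := hV t (.inl rfl) e he
    rw [h1] at hne ⊢
    rw [h2]
    obtain ⟨a, ha, b, hb, h3, h4, h5, h6⟩ := h.sound e he hne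
    exact ⟨a, ha, b, hb, h3, (hcongr ha hb).1.1 h4, h5, by rw [h6, (hcongr ha hb).2]⟩
  · obtain ⟨e, he, h3, h4, h5⟩ := h.complete a ha b hb ((hcongr ha hb).1.2 hE)
    obtain ⟨h1, h2⟩ := hV t (.inl rfl) e he
    exact ⟨e, he, h3, by rwa [h1], by rw [h1, ← (hcongr ha hb).2]; exact h5⟩

end KCenterInstance

namespace RAM

open KCenterInstance

variable {W : ℕ} {I : KCenterInstance} {ctr : ℕ → ℕ} {σ : State} {t : Fin I.N} {e₁ e₂ : ℕ}

/-- Records the candidate in the tables if it is better than the present entry. -/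
def record : Program :=
  encode ;;
  .assign 34 (tableEntry 10 21) ;;
  .ite (.and (.lt (.const 0) (.get 15 (.var 34)))
      (.distLe (.sub (.get 15 (.var 34)) (.const 1)) (.var 22)))
    .skip
    (.store 15 (.var 34) (.add (.var 22) (.const 1)) ;;
    .store 16 (.var 34) (.add (.mul (.var 18) (.var 7)) (.var 19)))

/-- Tries to extend the states in variables `18` and `19` of the children. -/
def tryPair : Program :=
  candidate ;;
  .ite (.eq (.var 20) (.const 1)) record .skip

theorem run_tryPair (h : I.AtPair W ctr t e₁ e₂ σ) (hctr : ∀ j < I.k, ctr j < I.n) :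
    Run W I.distArray tryPair σ fun r τ => r ≤ 2 * I.pairTime ∧
      I.Recorded ctr (σ.arr 15) (σ.arr 16) (τ.arr 15) (τ.arr 16) t e₁ e₂ := by
  have hL := h.loaded
  have hbig := hL.big
  have hn := I.two_le_n
  refine Run.seq hL.bdd (run_candidate h hctr) ?_
  rintro r τ ⟨hr, hc⟩ hτ hA
  have hP := h.agree hA hτ (by decide) (by decide)
  have f15 : τ.arr 15 = σ.arr 15 := hA.2 15 (by decide)
  have f16 : τ.arr 16 = σ.arr 16 := hA.2 16 (by decide)
  rw [← f15] at hc
  rw [← f15, ← f16]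
  refine run_ite hτ ⟨trivial, show 1 < 2 ^ W by omega⟩ (fun hh => ?_) (fun hh => run_skip.2 ?_)
  case refine_2 =>
    exact ⟨by simp only [Test.cost, Expr.cost, pairTime] at *; omega,
      .inl ⟨rfl, rfl, fun hE => absurd (hc.1.2 hE) hh⟩⟩
  change τ.var 20 = 1 at hh
  have hE := hc.1.1 hh
  obtain ⟨hout, h25, hcol, h22, hbot⟩ := hc.2 hE
  refine Run.seq hτ (run_encode hP.loaded hP.v10 hP.v16 rfl h25 hcol) ?_
  rintro r' ρ ⟨hr', hlt, hcolor, hcount⟩ hρ hA'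
  have hP' := hP.agree hA' hρ (by decide) (by decide)
  have hout' : I.Outcome t e₁ e₂ (I.color t (ρ.var 21)) (I.closedCount (ρ.var 21)) := by
    rw [hcount]
    exact hout.congr fun v hv => (hcolor v hv).symm
  have g22 : ρ.var 22 = τ.var 22 := hA'.1 22 (by decide)
  have g15 : ρ.arr 15 = τ.arr 15 := hA'.2 15 (by decide)
  have g16 : ρ.arr 16 = τ.arr 16 := hA'.2 16 (by decide)
  refine run_assign_seq hρ (tableEntry_safe hP'.loaded hP'.v10 rfl hlt) fun hB => ?_
  rw [eval_tableEntry hP'.loaded hP'.v10 rfl] at hB ⊢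
  have hcard := I.card_bag_le t
  have hpos := mul_add_lt_mul h.lt₁ h.lt₂
  refine run_ite hB ⟨⟨show 0 < 2 ^ W by omega, trivial⟩, ⟨trivial, show 1 < 2 ^ W by omega⟩,
    trivial⟩ (fun hh2 => run_skip.2 ?_) (fun hh2 => ?_)
  all_goals
    simp only [Test.Holds, Expr.eval, setVar_var, setVar_arr, Nat.reduceEqDiff, if_true, if_false,
      g15, g22] at hh2
  · refine ⟨by simp only [Test.cost, Expr.cost, pairTime] at *; omega, .inl ⟨g15, g16, fun _ =>
      ⟨_, hlt, hout', by omega, ?_⟩⟩⟩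
    rw [← hbot]
    exact hh2.2
  · have hle : I.n * I.n < 2 ^ W := by omega
    refine run_store_seq hB trivial ⟨trivial, show 1 < 2 ^ W by omega, ?_⟩ fun hB2 =>
      run_store hB2 trivial ⟨⟨trivial, trivial, ?_⟩, trivial, ?_⟩ ?_
    all_goals
      simp only [Expr.eval, setVar_var, setVar_arr, setArr_var, setArr_arr, Nat.reduceEqDiff,
        if_true, if_false, g15, g16, g22, hP'.v18, hP'.v19, hP'.loaded.v7]
    · omega
    · omega
    · omega
    · refine ⟨by simp only [Test.cost, Expr.cost, pairTime] at *; omega, .inr ⟨hE, _, hlt, hout', _,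
        h22, hbot, ?_, rfl, rfl⟩⟩
      rw [← hbot]
      by_cases h0 : τ.arr 15 (t * I.states + ρ.var 21) = 0
      · exact .inl h0
      · exact .inr (not_le.1 fun h => hh2 ⟨by omega, h⟩).le

end RAM

namespace RAM

open KCenterInstance

variable {W : ℕ} {I : KCenterInstance} {ctr : ℕ → ℕ} {σ : State} {t : Fin I.N}

/-- Loads the node number `N - 1 - i` in the enumeration, where variable `8` holds `i`. -/
def loadNode : Program :=
  .assign 10 (.get 12 (.sub (.sub (.var 2) (.const 1)) (.var 8))) ;;
  .assign 11 (.get 1 (.var 10)) ;;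
  .assign 12 (.get 2 (.var 10)) ;;
  .assign 13 (.get 3 (.var 10)) ;;
  .assign 14 (.get 4 (.var 10)) ;;
  .assign 15 (.get 5 (.var 10)) ;;
  .assign 16 (.get 6 (.var 10)) ;;
  .assign 17 (.get 6 (.var 12))

/-- The node `t` has been loaded. -/
structure _root_.KCenterInstance.NodeLoaded (I : KCenterInstance) (t : Fin I.N) (σ : State) :
    Prop where
  v10 : σ.var 10 = t
  v11 : σ.var 11 = (I.decomp.kind t).code
  v12 : σ.var 12 = (I.decomp.kind t).child₁
  v13 : σ.var 13 = (I.decomp.kind t).child₂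
  v14 : σ.var 14 = (I.decomp.kind t).label₁
  v15 : σ.var 15 = (I.decomp.kind t).label₂
  v16 : σ.var 16 = (I.decomp.bag t).card
  v17 : σ.var 17 = I.input.arr 6 (I.decomp.kind t).child₁

theorem run_loadNode {D : ℕ → ℝ} {j : ℕ} (h : I.Loaded W ctr σ) (h8 : σ.var 8 = j)
    (ht : σ.arr 12 (I.N - 1 - j) = t) :
    Run W D loadNode σ fun r τ => r ≤ 40 ∧ I.NodeLoaded t τ := by
  have hbig := h.big
  refine run_assign_seq h.bdd ⟨⟨trivial, show 1 < 2 ^ W by omega⟩, trivial⟩ fun hB1 =>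
    run_assign_seq hB1 trivial fun hB2 => run_assign_seq hB2 trivial fun hB3 =>
    run_assign_seq hB3 trivial fun hB4 => run_assign_seq hB4 trivial fun hB5 =>
    run_assign_seq hB5 trivial fun hB6 => run_assign_seq hB6 trivial fun hB7 =>
    run_assign hB7 trivial ?_
  simp only [Expr.eval, Expr.cost, setVar_arr, h.v2, h8, ht, h.inp 1 (by omega), h.inp 2 (by omega),
    h.inp 3 (by omega), h.inp 4 (by omega), h.inp 5 (by omega), h.inp 6 (by omega)]
  simp only [setVar_var, Nat.reduceEqDiff, if_true, if_false, input_arr_one, input_arr_two,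
    input_arr_three, input_arr_four, input_arr_five, input_arr_six]
  refine ⟨by omega, ?_⟩
  constructor <;> simp

/-- Computes the row of the tables for a node. -/
def processNode : Program :=
  loadNode ;; .forLoop 18 7 (.forLoop 19 7 tryPair)

/-- Bounds the time for computing the row of a node. -/
def _root_.KCenterInstance.nodeTime (I : KCenterInstance) : ℕ :=
  I.states * (I.states * (2 * I.pairTime + 8) + 14) + 46

/-- All pairs of states are tried whatever the type of the node; `Enabled`, `Outcome` and
`bottleneck` ignore the entries that a type does not use. -/
theorem run_processNode {j : ℕ} (h : I.Loaded W ctr σ) (hctr : ∀ j < I.k, ctr j < I.n)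
    (h8 : σ.var 8 = j) (ht : σ.arr 12 (I.N - 1 - j) = t) (htab : ∀ i, σ.arr 15 i ≤ I.n * I.n)
    (hrow : ∀ e < I.states, σ.arr 15 (t * I.states + e) = 0) :
    Run W I.distArray processNode σ fun r τ => r ≤ I.nodeTime ∧
      I.RowUpTo ctr (σ.arr 15) (σ.arr 16) (τ.arr 15) (τ.arr 16) t fun _ _ => True := by
  have hbig := h.big
  refine Run.seq h.bdd (run_loadNode h h8 ht) ?_
  rintro r τ ⟨hr, hN⟩ hτ hA
  have hL := h.agree hA hτ (by decide) (by decide)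
  refine run_forLoop (I.states * (2 * I.pairTime + 8) + 6) hτ
    (fun a ρ => I.RowUpTo ctr (σ.arr 15) (σ.arr 16) (ρ.arr 15) (ρ.arr 16) t fun e₁ _ => e₁ < a)
    hL.v7 (by decide) (by decide) (by decide) ?_ ?_ ?_
  · rw [setVar_arr, hA.2 15 (by decide), hA.2 16 (by decide)]
    exact ⟨htab, fun _ _ _ _ => ⟨rfl, rfl⟩, fun e he h => absurd (hrow e he) h,
      fun _ _ _ _ h => absurd h (Nat.not_lt_zero _)⟩
  · intro a ρ ha hρ hA' h18 hI
    refine run_forLoop (2 * I.pairTime) hρ (fun b π => I.RowUpTo ctr (σ.arr 15) (σ.arr 16)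
      (π.arr 15) (π.arr 16) t fun e₁ e₂ => e₁ < a ∨ e₁ = a ∧ e₂ < b) (c := I.states)
      (by rw [hA'.1 7 (by decide), hL.v7]) (by decide) (by decide) (by decide) ?_ ?_ ?_
    · simpa using hI
    · intro b π hb hπ hA'' h19 hI'
      have hA2 : Agree (18 :: 19 :: tryPair.wv) tryPair.wa τ π :=
        (hA'.mono (by decide) (by decide)).trans (hA''.mono (by decide) (by decide))
      have hP : I.AtPair W ctr t a b π :=
        { loaded := hL.agree hA2 hπ (by decide) (by decide)
          v10 := by rw [hA2.1 10 (by decide), hN.v10]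
          v11 := by rw [hA2.1 11 (by decide), hN.v11]
          v12 := by rw [hA2.1 12 (by decide), hN.v12]
          v13 := by rw [hA2.1 13 (by decide), hN.v13]
          v14 := by rw [hA2.1 14 (by decide), hN.v14]
          v15 := by rw [hA2.1 15 (by decide), hN.v15]
          v16 := by rw [hA2.1 16 (by decide), hN.v16]
          v17 := by rw [hA2.1 17 (by decide), hN.v17]
          v18 := by rw [hA''.1 18 (by decide), h18]
          v19 := h19
          lt₁ := ha
          lt₂ := hb
          table := hI'.table }
      refine (run_tryPair hP hctr).mono fun r' π' hr' => ⟨hr'.1, ?_⟩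
      refine hI'.step hr'.2 ha hb fun x y _ _ hxy => ?_
      omega
    · intro r' π hr' hπ hA'' h19 hI'
      refine ⟨hr', ?_⟩
      rw [setVar_arr]
      refine ⟨hI'.table, hI'.other, hI'.sound, fun x hx y hy hxy =>
        hI'.complete x hx y hy ?_⟩
      omega
  · intro r' ρ hr' hρ hA' h18 hI
    refine ⟨?_, hI.table, hI.other, hI.sound, fun x hx y hy _ => hI.complete x hx y hy hx⟩
    simp only [nodeTime]
    rw [show I.states * (2 * I.pairTime + 8) + 6 + 8 = I.states * (2 * I.pairTime + 8) + 14 from rfl]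
      at hr'
    omega

/-- Computes the tables of all nodes from the leaves to the root. -/
def fillTables : Program := .forLoop 8 2 processNode

/-- The top-down list is read backwards, so children are treated before their parents. Rows still to
come are zero. A finished row stays correct, since the row being written belongs neither to that
node nor to one of its children, which stand later in the list. -/
theorem run_fillTables (h : I.Loaded W ctr σ) (hctr : ∀ j < I.k, ctr j < I.n)
    (hq : I.IsTopDown (σ.arr 12)) (h15 : ∀ i, σ.arr 15 i = 0) :
    Run W I.distArray fillTables σ fun r τ => r ≤ I.N * (I.nodeTime + 8) + 6 ∧
      (∀ t, I.RowCorrect ctr (τ.arr 15) (τ.arr 16) t) ∧ ∀ i, τ.arr 15 i ≤ I.n * I.n := by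
  refine run_forLoop I.nodeTime h.bdd (fun j τ => (∀ i, τ.arr 15 i ≤ I.n * I.n) ∧
    (∀ i < I.N, ∀ t : Fin I.N, σ.arr 12 i = t → if i + j < I.N then
      ∀ e < I.states, τ.arr 15 (t * I.states + e) = 0 else
      I.RowCorrect ctr (τ.arr 15) (τ.arr 16) t)) h.v2 (by decide) (by decide) (by decide) ?_ ?_ ?_
  · refine ⟨fun i => by simp [h15], fun i hi t _ => ?_⟩
    rw [if_pos (by omega)]
    simp [h15]
  · rintro j τ hj hτ hA h8 ⟨hI1, hI2⟩
    have hL := h.agree hA hτ (by decide) (by decide)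
    obtain ⟨t, ht⟩ := hq.node (I.N - 1 - j) (by omega)
    have h0 := hI2 (I.N - 1 - j) (by omega) t ht
    rw [if_pos (by omega)] at h0
    refine (run_processNode hL hctr h8 (by rw [hA.2 12 (by decide), ht]) hI1 h0).mono
      fun r ρ hρ => ⟨hρ.1, hρ.2.table, fun i hi s hs => ?_⟩
    have hrow := hI2 i hi s hs
    simp only [setVar_arr]
    obtain hij | hij | hij := lt_trichotomy (i + j + 1) I.N
    · rw [if_pos (by omega)] at hrow ⊢
      have hst : s ≠ t := by
        rintro rfl
        have := hq.inj i hi (I.N - 1 - j) (by omega) (by rw [hs, ht])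
        omega
      intro e he
      rw [(hρ.2.other s hst e he).1, hrow e he]
    · rw [if_neg (by omega)]
      obtain rfl : s = t := Fin.ext (by rw [← hs, ← ht]; congr 1; omega)
      exact hρ.2.rowCorrect fun _ _ _ _ => trivial
    · rw [if_neg (by omega)] at hrow ⊢
      refine hrow.congr fun p hp e he => hρ.2.other p ?_ e he
      rintro rfl
      obtain rfl | hp := hp
      · have := hq.inj i hi (I.N - 1 - j) (by omega) (by rw [hs, ht])
        omega
      · obtain ⟨i', hi', hlt, hqi'⟩ := hq.child i hi _ _ hs hp
        have := hq.inj i' hi' (I.N - 1 - j) (by omega) (by rw [hqi', ht])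
        omega
  · rintro r τ hr hτ hA h8 ⟨hI1, hI2⟩
    refine ⟨hr, fun t => ?_, hI1⟩
    obtain ⟨i, hi, ht⟩ := hq.exhausted hq.child t
    have := hI2 i hi t ht
    rwa [if_neg (by omega)] at this

end RAM

/-! ### Tracing back an optimal labeling. -/

namespace KCenterInstance

variable {I : KCenterInstance} {ctr V P q : ℕ → ℕ} {t : Fin I.N} {e₀ e₁ e₂ j : ℕ}

/-- The states `E` have been traced back from the state `e₀` of the root through the first `j` nodes
in the list `q`. -/
structure Traced (I : KCenterInstance) (ctr V q : ℕ → ℕ) (e₀ : ℕ) (E : Fin I.N → ℕ) (lab : Fin I.n → ℕ)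
    (j : ℕ) : Prop where
  root : E I.decomp.root = e₀
  run : ∀ i < j, ∀ t : Fin I.N, q i = t → ∃ e₁ e₂, I.Follows E t e₁ e₂ ∧ I.Enabled V t e₁ e₂ ∧
    I.Outcome t e₁ e₂ (I.color t (E t)) (I.closedCount (E t)) ∧
    I.distArray (V (t * I.states + E t) - 1) = I.bottleneck ctr V t e₁ e₂
  ready : ∀ s : Fin I.N, (s = I.decomp.root ∨ ∃ i < j, ∃ t : Fin I.N, q i = t ∧ I.Child s t) →
    E s < I.states ∧ V (s * I.states + E s) ≠ 0
  label : ∀ i < j, ∀ t : Fin I.N, q i = t → ∀ v s, I.decomp.kind t = .forget v s →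
    lab v = I.color s (E s) v % I.k

variable {E E' : Fin I.N → ℕ} {lab lab' : Fin I.n → ℕ}

/-- The parent of entry `j` stands earlier in the list, so the state of this node has already been
determined. -/
theorem Traced.isReady (h : I.Traced ctr V q e₀ E lab j) (hq : I.IsTopDown q) (hj : j < I.N)
    (ht : q j = t) : E t < I.states ∧ V (t * I.states + E t) ≠ 0 := by
  refine h.ready t ?_
  rcases Nat.eq_zero_or_pos j with rfl | h0
  · exact .inl (Fin.ext (by rw [← ht, hq.root]))
  · obtain ⟨j', h1, -, s, t', h3, h4, h5⟩ := hq.parent j hj h0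
    obtain rfl : s = t := Fin.ext (by rw [← h3, ht])
    exact .inr ⟨j', h1, t', h4, h5⟩

theorem Follows.congr {E E' : Fin I.N → ℕ} (h : I.Follows E t e₁ e₂)
    (hE : ∀ s, I.Child s t → E' s = E s) : I.Follows E' t e₁ e₂ := by
  unfold Follows at *
  cases hk : I.decomp.kind t with
  | leaf => trivial
  | introVertex v s => simp only [hk] at h ⊢; rw [hE s (child_introVertex hk).1, h]
  | introEdge u v s => simp only [hk] at h ⊢; rw [hE s (child_introEdge hk).1, h]
  | forget v s => simp only [hk] at h ⊢; rw [hE s (child_forget hk).1, h]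
  | join s₁ s₂ =>
    simp only [hk] at h ⊢
    rw [hE s₁ (child_join hk).1, hE s₂ (child_join hk).2.1]
    exact h

theorem Follows.ready (h : I.Follows E t e₁ e₂) (hen : I.Enabled V t e₁ e₂) (h₁ : e₁ < I.states)
    (h₂ : e₂ < I.states) {s : Fin I.N} (hs : I.Child s t) :
    E s < I.states ∧ V (s * I.states + E s) ≠ 0 := by
  unfold Follows at h
  unfold Enabled at hen
  cases hk : I.decomp.kind t with
  | leaf => exact absurd hs ((leaf_spec hk).1 s)
  | introVertex v s' =>
    simp only [hk] at h hen
    obtain rfl := (child_introVertex hk).2.1 s hs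
    exact h ▸ ⟨h₁, hen.1⟩
  | introEdge u v s' =>
    simp only [hk] at h hen
    obtain rfl := (child_introEdge hk).2.1 s hs
    exact h ▸ ⟨h₁, hen⟩
  | forget v s' =>
    simp only [hk] at h hen
    obtain rfl := (child_forget hk).2.1 s hs
    exact h ▸ ⟨h₁, hen.1⟩
  | join s₁ s₂ =>
    simp only [hk] at h hen
    obtain rfl | rfl := (child_join hk).2.2.1 s hs
    · exact h.1 ▸ ⟨h₁, hen.1⟩
    · exact h.2 ▸ ⟨h₂, hen.2.1⟩

/-- Fixing the states of the children of `t` does not disturb what has been traced: earlier nodes of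
the list are not children of `t`, nor are their children, by uniqueness of parents, and each vertex
is forgotten at one node only. -/
theorem Traced.step (h : I.Traced ctr V q e₀ E lab j) (hq : I.IsTopDown q) (hj : j < I.N)
    (ht : q j = t) (h₁ : e₁ < I.states) (h₂ : e₂ < I.states) (hen : I.Enabled V t e₁ e₂)
    (hout : I.Outcome t e₁ e₂ (I.color t (E t)) (I.closedCount (E t)))
    (hval : I.distArray (V (t * I.states + E t) - 1) = I.bottleneck ctr V t e₁ e₂)
    (hE : ∀ s, ¬ I.Child s t → E' s = E s) (hf : I.Follows E' t e₁ e₂)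
    (hlab : ∀ v, (∀ s, I.decomp.kind t ≠ .forget v s) → lab' v = lab v)
    (hlab' : ∀ v s, I.decomp.kind t = .forget v s → lab' v = I.color s (E' s) v % I.k) :
    I.Traced ctr V q e₀ E' lab' (j + 1) := by
  have hne : ∀ i < j, ∀ r : Fin I.N, q i = r → r ≠ t := by
    rintro i hi r hr rfl
    have := hq.inj i (by omega) j hj (by rw [hr, ht])
    omega
  have hprev : ∀ i < j, ∀ r : Fin I.N, q i = r → E' r = E r := by
    intro i hi r hr
    refine hE r fun hrt => ?_
    obtain ⟨j', h1, h3, h4⟩ := hq.child j hj r t ht hrt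
    have := hq.inj i (by omega) j' h1 (by rw [hr, h4])
    omega
  have hchild : ∀ i < j, ∀ r s : Fin I.N, q i = r → I.Child s r → E' s = E s :=
    fun i hi r s hr hs => hE s fun hst => hne i hi r hr (hs.parent_unique hst)
  have htt : E' t = E t := hE t fun h => h.ne rfl
  have hroot : E' I.decomp.root = E I.decomp.root := hE _ fun h => by
    have := h.dist
    simp at this
  refine ⟨hroot.trans h.root, fun i hi r hr => ?_, fun s hs => ?_, fun i hi r hr v s hk => ?_⟩
  · obtain hi | rfl := Nat.lt_succ_iff_lt_or_eq.1 hi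
    · obtain ⟨a, b, h3, h4, h5, h6⟩ := h.run i hi r hr
      rw [hprev i hi r hr]
      exact ⟨a, b, h3.congr fun s hs => hchild i hi r s hr hs, h4, h5, h6⟩
    · obtain rfl : t = r := Fin.ext (by rw [← ht, hr])
      exact ⟨e₁, e₂, hf, hen, by rwa [htt], by rwa [htt]⟩
  · obtain rfl | ⟨i, hi, r, hr, hs⟩ := hs
    · rw [hroot]
      exact h.ready _ (.inl rfl)
    · obtain hi | rfl := Nat.lt_succ_iff_lt_or_eq.1 hi
      · rw [hchild i hi r s hr hs]
        exact h.ready s (.inr ⟨i, hi, r, hr, hs⟩)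
      · obtain rfl : t = r := Fin.ext (by rw [← ht, hr])
        exact hf.ready hen h₁ h₂ hs
  · obtain hi | rfl := Nat.lt_succ_iff_lt_or_eq.1 hi
    · rw [hlab v fun s' hs' => hne i hi r hr ?_, h.label i hi r hr v s hk,
        hchild i hi r s hr (child_forget hk).1]
      exact (I.decomp.forgotten_once v).unique (by simp [hk, NodeKind.Forgets])
        (by simp [hs', NodeKind.Forgets])
    · obtain rfl : t = r := Fin.ext (by rw [← ht, hr])
      exact hlab' v s hk

theorem Traced.isRun (h : I.Traced ctr V q e₀ E lab I.N) (hq : I.IsTopDown q) : I.IsRun ctr V E :=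
  fun t => let ⟨i, hi, ht⟩ := hq.exhausted hq.child t; h.run i hi t ht

theorem Traced.isLabeling (h : I.Traced ctr V q e₀ E lab I.N) (hq : I.IsTopDown q) :
    IsLabeling E lab :=
  fun t => let ⟨i, hi, ht⟩ := hq.exhausted hq.child t; h.label i hi t ht

open Function in
/-- The states of the nodes after those of the children of `t` have been written. -/
def childUpdate (f : ℕ → ℕ) (t : Fin I.N) (e₁ e₂ : ℕ) : ℕ → ℕ :=
  if (I.decomp.kind t).code = 4 then
    update (update f (I.decomp.kind t).child₁ e₁) (I.decomp.kind t).child₂ e₂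
  else update f (I.decomp.kind t).child₁ e₁

theorem follows_childUpdate (f : ℕ → ℕ) : I.Follows (fun s => childUpdate f t e₁ e₂ s) t e₁ e₂ := by
  unfold Follows childUpdate
  cases hk : I.decomp.kind t with
  | join s₁ s₂ =>
    have hne : (s₁ : ℕ) ≠ s₂ := fun h => (child_join hk).2.2.2.1 (Fin.ext h)
    simp [NodeKind.child₁, NodeKind.child₂, NodeKind.code, Function.update_of_ne hne]
  | _ => simp [NodeKind.child₁, NodeKind.code]

theorem childUpdate_of_not_child (f : ℕ → ℕ) (hc : (I.decomp.kind t).code ≠ 0) {s : Fin I.N}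
    (hs : ¬ I.Child s t) : childUpdate f t e₁ e₂ s = f s := by
  obtain ⟨s₁, h1, h2, -, h4⟩ := exists_children hc
  have hne : ∀ s', I.Child s' t → (s : ℕ) ≠ s' := fun s' hs' h => hs (Fin.ext h ▸ hs')
  unfold childUpdate
  split_ifs with h
  · obtain ⟨s₂, h5, h6, -⟩ := h4 h
    rw [h2, h6, Function.update_of_ne (hne s₂ h5), Function.update_of_ne (hne s₁ h1)]
  · rw [h2, Function.update_of_ne (hne s₁ h1)]

end KCenterInstance

namespace RAM

open KCenterInstance

variable {W e₀ : ℕ} {I : KCenterInstance} {ctr V P : ℕ → ℕ} {σ : State} {t : Fin I.N}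

/-- Sets variable `21` to the best state of the root and variable `20` to one if there is a state. -/
def selectRoot : Program :=
  .assign 20 (.const 0) ;;
  .assign 21 (.const 0) ;;
  .forLoop 18 7
    (.ite (.eq (.get 15 (tableEntry 3 18)) (.const 0)) .skip
      (.ite (.and (.eq (.var 20) (.const 1))
          (.distLe (.sub (.get 15 (tableEntry 3 21)) (.const 1))
            (.sub (.get 15 (tableEntry 3 18)) (.const 1))))
        .skip
        (.assign 21 (.var 18) ;; .assign 20 (.const 1))))

theorem run_selectRoot (h : I.Loaded W ctr σ) (h15 : σ.arr 15 = V) :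
    Run W I.distArray selectRoot σ fun r τ => r ≤ I.states * 60 + 10 ∧
      τ.var 21 < I.states ∧ (τ.var 20 = 1 → V (I.decomp.root * I.states + τ.var 21) ≠ 0) ∧
      ∀ e < I.states, V (I.decomp.root * I.states + e) ≠ 0 → τ.var 20 = 1 ∧
        I.distArray (V (I.decomp.root * I.states + τ.var 21) - 1) ≤
          I.distArray (V (I.decomp.root * I.states + e) - 1) := by
  have hbig := h.big
  have hn := I.two_le_n
  have hnn : 4 ≤ I.n * I.n := Nat.mul_le_mul hn hn
  have c0 : 0 < 2 ^ W := by omega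
  have c1 : 1 < 2 ^ W := by omega
  refine run_assign_seq h.bdd c0 fun hB => ?_
  have hL1 := h.agree (agree_setVar 20 _) hB (by decide) (by decide)
  refine run_assign_seq hB c0 fun hB2 => ?_
  have hL := hL1.agree (agree_setVar 21 _) hB2 (by decide) (by decide)
  refine run_forLoop 45 hB2 (fun j τ => τ.var 21 < I.states ∧
    (τ.var 20 = 1 → V (I.decomp.root * I.states + τ.var 21) ≠ 0) ∧
      ∀ e < j, V (I.decomp.root * I.states + e) ≠ 0 → τ.var 20 = 1 ∧
        I.distArray (V (I.decomp.root * I.states + τ.var 21) - 1) ≤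
          I.distArray (V (I.decomp.root * I.states + e) - 1)) hL.v7
    (by decide) (by decide) (by decide) (by simp [Expr.eval, I.states_pos]) ?_ ?_
  · rintro j τ hj hτ hA h18 ⟨hI0, hI1, hI2⟩
    have hL' := hL.agree hA hτ (by decide) (by decide)
    have f15 : τ.arr 15 = V := by rw [hA.2 15 (by decide)]; simpa using h15
    have hs := tableEntry_safe hL' hL'.v3 h18 hj
    have hs' := tableEntry_safe hL' hL'.v3 rfl hI0
    have hev : (Expr.get 15 (tableEntry 3 18)).eval τ = V (I.decomp.root * I.states + j) := by
      rw [eval_get, eval_tableEntry hL' hL'.v3 h18, f15]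
    have hev' : (Expr.get 15 (tableEntry 3 21)).eval τ = V (I.decomp.root * I.states + τ.var 21) := by
      rw [eval_get, eval_tableEntry hL' hL'.v3 rfl, f15]
    refine run_ite hτ ⟨hs, c0⟩ (fun hh => run_skip.2 ?_) (fun hh => ?_)
    all_goals rw [Test.Holds, hev] at hh; simp only [Expr.eval] at hh
    · refine ⟨by simp [Test.cost, Expr.cost], by simpa using hI0, by simpa using hI1,
        fun e he hne => ?_⟩
      obtain he | rfl := Nat.lt_succ_iff_lt_or_eq.1 he
      · simpa using hI2 e he hne
      · exact absurd hh hne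
    refine run_ite hτ ⟨⟨trivial, c1⟩, ⟨hs', c1⟩, hs, c1⟩ (fun hh2 => run_skip.2 ?_) (fun hh2 => ?_)
    · have hle : I.distArray (V (I.decomp.root * I.states + τ.var 21) - 1) ≤
          I.distArray (V (I.decomp.root * I.states + j) - 1) := by
        rw [← hev, ← hev']
        exact hh2.2
      refine ⟨by simp [Test.cost, Expr.cost], by simpa using hI0, by simpa using hI1,
        fun e he hne => ?_⟩
      obtain he | rfl := Nat.lt_succ_iff_lt_or_eq.1 he
      · simpa using hI2 e he hne
      · simpa using ⟨hh2.1, hle⟩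
    · have hle : τ.var 20 = 1 → I.distArray (V (I.decomp.root * I.states + j) - 1) ≤
          I.distArray (V (I.decomp.root * I.states + τ.var 21) - 1) := by
        intro h20
        rw [← hev, ← hev']
        exact (not_le.1 fun h => hh2 ⟨h20, h⟩).le
      refine run_assign_seq hτ trivial fun hB1 => run_assign hB1 c1 ?_
      refine ⟨by simp [Test.cost, Expr.cost], by simp [Expr.eval, h18, hj],
        by simp [Expr.eval, h18, hh], fun e he hne => ?_⟩
      obtain he | rfl := Nat.lt_succ_iff_lt_or_eq.1 he
      · obtain ⟨h20, h3⟩ := hI2 e he hne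
        simpa [Expr.eval, h18] using (hle h20).trans h3
      · simp [Expr.eval, h18]
  · exact fun r τ hr _ _ _ hI => ⟨by simp only [Expr.cost]; omega, hI⟩

/-- Determines the states of the children of the node number `8` in the enumeration, and the label
of the vertex that it forgets. -/
def traceNode : Program :=
  .assign 10 (.get 12 (.var 8)) ;;
  .assign 11 (.get 1 (.var 10)) ;;
  .assign 12 (.get 2 (.var 10)) ;;
  .assign 33 (.get 17 (.var 10)) ;;
  .assign 33 (.get 16 (tableEntry 10 33)) ;;
  .assign 18 (.div (.var 33) (.var 7)) ;;
  .assign 19 (.mod (.var 33) (.var 7)) ;;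
  .ite (.eq (.var 11) (.const 0)) .skip
    (.store 17 (.var 12) (.var 18) ;;
    .ite (.eq (.var 11) (.const 4)) (.store 17 (.get 3 (.var 10)) (.var 19)) .skip ;;
    .ite (.eq (.var 11) (.const 3))
      (.assign 23 (.div (.var 18) succK) ;;
      .assign 27 (.var 12) ;;
      .assign 28 (.get 6 (.var 12)) ;;
      decodeInto 13 ;;
      .assign 14 (.get 4 (.var 10)) ;;
      .store 18 (.var 14) (.mod (.get 13 (.var 14)) (.var 1)))
      .skip)

/-- The table of origins stores `e₁ * states + e₂`, so division with remainder recovers the pair. By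
soundness of the row it produces the present state with exactly the stored value. -/
theorem run_traceNode {j : ℕ} {q : ℕ → ℕ} (h : I.Loaded W ctr σ) (h8 : σ.var 8 = j)
    (h12 : σ.arr 12 = q) (h16 : σ.arr 16 = P) (hq : I.IsTopDown q)
    (hj : j < I.N) (hrow : ∀ t, I.RowCorrect ctr V P t)
    (hT : I.Traced ctr V q e₀ (fun t => σ.arr 17 t) (fun v => σ.arr 18 v) j) :
    Run W I.distArray traceNode σ fun r τ => r ≤ I.bagBound * 22 + 100 ∧
      I.Traced ctr V q e₀ (fun t => τ.arr 17 t) (fun v => τ.arr 18 v) (j + 1) := by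
  have hbig := h.big
  have hn := I.two_le_n
  have hnn : 4 ≤ I.n * I.n := Nat.mul_le_mul hn hn
  obtain ⟨t, ht⟩ := hq.node j hj
  obtain ⟨hlt, hne⟩ := hT.isReady hq hj ht
  obtain ⟨e₁, h₁, e₂, h₂, hP, hen, hout, hval⟩ := (hrow t).sound _ hlt hne
  have hdiv : (e₁ * I.states + e₂) / I.states = e₁ := by
    rw [add_comm, Nat.add_mul_div_right _ _ I.states_pos, Nat.div_eq_of_lt h₂, zero_add]
  have hmod : (e₁ * I.states + e₂) % I.states = e₂ := by
    rw [add_comm, Nat.add_mul_mod_self_right, Nat.mod_eq_of_lt h₂]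
  have hidx := mul_add_lt_mul t.2 hlt
  -- The state after the seven loading assignments. Variable `33` is written twice: first with the
  -- state of `t`, then with the origin of that state.
  let ρ : State := ((((((σ.setVar 10 t).setVar 11 (I.decomp.kind t).code).setVar 12
    (I.decomp.kind t).child₁).setVar 33 (σ.arr 17 t)).setVar 33 (e₁ * I.states + e₂)).setVar 18
    e₁).setVar 19 e₂
  have hAρ : Agree [10, 11, 12, 18, 19, 33] [] σ ρ :=
    ⟨fun x hx => by simp at hx; simp [ρ, hx], fun _ _ => rfl⟩
  suffices hmain : Bdd W ρ → Run W I.distArray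
      (.ite (.eq (.var 11) (.const 0)) .skip
        (.store 17 (.var 12) (.var 18) ;;
        .ite (.eq (.var 11) (.const 4)) (.store 17 (.get 3 (.var 10)) (.var 19)) .skip ;;
        .ite (.eq (.var 11) (.const 3))
          (.assign 23 (.div (.var 18) succK) ;;
          .assign 27 (.var 12) ;;
          .assign 28 (.get 6 (.var 12)) ;;
          decodeInto 13 ;;
          .assign 14 (.get 4 (.var 10)) ;;
          .store 18 (.var 14) (.mod (.get 13 (.var 14)) (.var 1)))
          .skip)) ρ fun r τ => r ≤ I.bagBound * 22 + 65 ∧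
      I.Traced ctr V q e₀ (fun t => τ.arr 17 t) (fun v => τ.arr 18 v) (j + 1) by
    refine run_assign_seq h.bdd trivial fun hB1 => run_assign_seq hB1 trivial fun hB2 =>
      run_assign_seq hB2 trivial fun hB3 => run_assign_seq hB3 trivial fun hB4 =>
      run_assign_seq hB4 ?_ fun hB5 => run_assign_seq hB5 ⟨trivial, trivial⟩ fun hB6 =>
      run_assign_seq hB6 ⟨trivial, trivial⟩ fun hB7 => ?_
    all_goals
      simp only [Expr.Safe, Expr.eval, Expr.cost, setVar_arr, setVar_var, Nat.reduceEqDiff, if_true,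
        if_false, h8, h12, ht, h.inp 1 (by omega), h.inp 2 (by omega), input_arr_one, input_arr_two,
        h.v7, h16, hP, hdiv, hmod] at *
    · exact ⟨⟨trivial, trivial, by omega⟩, trivial, by omega⟩
    · exact (hmain hB7).mono fun r τ hr => ⟨by omega, hr.2⟩
  intro hρ
  have hL := h.agree hAρ hρ (by decide) (by decide)
  have f10 : ρ.var 10 = t := by simp [ρ]
  have f11 : ρ.var 11 = (I.decomp.kind t).code := by simp [ρ]
  have f12 : ρ.var 12 = (I.decomp.kind t).child₁ := by simp [ρ]
  have f18 : ρ.var 18 = e₁ := by simp [ρ]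
  have f19 : ρ.var 19 = e₂ := by simp [ρ]
  have fa : ρ.arr = σ.arr := rfl
  refine run_ite hρ ⟨trivial, show 0 < 2 ^ W by omega⟩ (fun hh => run_skip.2 ?_) (fun hh => ?_)
  all_goals simp only [Test.Holds, Expr.eval, f11] at hh
  · have hk : I.decomp.kind t = .leaf := by
      cases hk : I.decomp.kind t <;> simp [hk, NodeKind.code] at hh ⊢
    refine ⟨by simp only [Test.cost, Expr.cost]; omega, ?_⟩
    rw [fa]
    exact hT.step hq hj ht h₁ h₂ hen hout hval (fun _ _ => rfl) (by simp [Follows, hk])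
      (fun _ _ => rfl) (fun v s hk' => by simp [hk] at hk')
  obtain ⟨s, hst, hs, -⟩ := exists_children hh
  rw [hs] at f12
  refine run_store_seq hρ trivial trivial fun hB1 => ?_
  simp only [Expr.eval, f12, f18] at hB1 ⊢
  have hA1 : Agree [] [17] ρ (ρ.setArr 17 s e₁) := agree_setArr _ _ _
  have hL1 := hL.agree hA1 hB1 (by decide) (by decide)
  refine Run.seq hB1 (R := fun r τ => r ≤ 12 ∧ τ.arr 17 = childUpdate (σ.arr 17) t e₁ e₂) ?_ ?_
  · refine run_ite hB1 ⟨trivial, show 4 < 2 ^ W by omega⟩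
      (fun hh2 => run_store hB1 trivial trivial ?_) (fun hh2 => run_skip.2 ?_)
    all_goals simp only [Test.Holds, Expr.eval, setArr_var, f11] at hh2
    · have h3 : ρ.arr 3 = I.input.arr 3 := hL.inp 3 (by omega)
      simp [Test.cost, Expr.cost, Expr.eval, f10, f19, h3, input_arr_three, fa, childUpdate, hh2, hs]
    · simp [Test.cost, Expr.cost, fa, childUpdate, hh2, hs]
  rintro r τ ⟨hr, h17⟩ hτ hA
  have hL2 := hL1.agree hA hτ (by decide) (by decide)
  have hA2 : Agree [] [17] ρ τ := (hA1.mono (by simp) (by simp)).trans (hA.mono (by decide) (by decide))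
  have g11 : τ.var 11 = (I.decomp.kind t).code := by rw [hA2.1 11 (by decide), f11]
  have g18 : τ.arr 18 = σ.arr 18 := by rw [hA2.2 18 (by decide), fa]
  have hstep : ∀ τ' : State, τ'.arr 17 = childUpdate (σ.arr 17) t e₁ e₂ →
      (∀ v : Fin I.n, (∀ s, I.decomp.kind t ≠ .forget v s) → τ'.arr 18 v = σ.arr 18 v) →
      (∀ v s, I.decomp.kind t = .forget v s → τ'.arr 18 v = I.color s e₁ v % I.k) →
      I.Traced ctr V q e₀ (fun t => τ'.arr 17 t) (fun v => τ'.arr 18 v) (j + 1) := by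
    intro τ' h17' hlab hlab'
    have hf := follows_childUpdate (t := t) (e₁ := e₁) (e₂ := e₂) (σ.arr 17)
    rw [← h17'] at hf
    refine hT.step hq hj ht h₁ h₂ hen hout hval (fun s hs => ?_) hf hlab fun v s hk => ?_
    · simp only [h17', childUpdate_of_not_child _ hh hs]
    · simp only [hlab' v s hk]
      simp only [Follows, hk] at hf
      rw [hf]
  refine run_ite hτ ⟨trivial, show 3 < 2 ^ W by omega⟩ (fun hh2 => ?_) (fun hh2 => run_skip.2 ?_)
  all_goals simp only [Test.Holds, Expr.eval, g11] at hh2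
  · obtain ⟨v, hk⟩ : ∃ v, I.decomp.kind t = .forget v s := by
      cases hk : I.decomp.kind t <;> simp [hk, NodeKind.code, NodeKind.child₁] at hh2 hs ⊢
      exact Fin.ext hs
    obtain ⟨-, -, hvs, -⟩ := child_forget hk
    refine run_assign_seq hτ ⟨trivial, succK_safe hL2⟩ fun hB3 => run_assign_seq hB3 trivial
      fun hB4 => run_assign_seq hB4 trivial fun hB5 => ?_
    have hL3 := hL2.agree (agree_setVar 23 _) hB3 (by decide) (by decide)
    have hL4 := hL3.agree (agree_setVar 27 _) hB4 (by decide) (by decide)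
    have hL5 := hL4.agree (agree_setVar 28 _) hB5 (by decide) (by decide)
    have g12 : τ.var 12 = s := by rw [hA2.1 12 (by decide), f12]
    have gg18 : τ.var 18 = e₁ := by rw [hA2.1 18 (by decide), f18]
    refine Run.seq hB5 (run_decodeInto (a := 13) (t := s) (x := e₁ / (I.k + 1)) hL5 (by decide)
      (by simp [Expr.eval, g12])
      (by simp only [setVar_var, Expr.eval]; simp [g12, hL2.inp 6, input_arr_six])
      (by simp only [setVar_var, Expr.eval]; simp [gg18, hL2.v1])) ?_
    rintro r' π ⟨hr', hcol⟩ hπ hA3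
    have hL6 := hL5.agree hA3 hπ (by decide) (by decide)
    have k10 : π.var 10 = t := by rw [hA3.1 10 (by decide)]; simp [hA2.1 10, f10]
    refine run_assign_seq hπ trivial fun hB6 => run_store hB6 trivial ⟨trivial, trivial⟩ ?_
    have h4 : π.arr 4 t = v := by rw [hL6.inp 4 (by omega), input_arr_four, hk]; rfl
    have k17 : π.arr 17 = τ.arr 17 := by rw [hA3.2 17 (by decide)]; rfl
    have k18 : π.arr 18 = σ.arr 18 := by rw [hA3.2 18 (by decide), ← g18]; rfl
    simp only [Expr.eval, k10, h4, setVar_var, setVar_arr, if_true, Nat.reduceEqDiff, if_false,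
      hL6.v1, hcol v hvs]
    refine ⟨?_, hstep _ (by simp [k17, h17]) (fun u hu => ?_) fun u s' hk' => ?_⟩
    · have := I.card_bag_le s
      simp only [Test.cost, Expr.cost]
      omega
    · have huv : (u : ℕ) ≠ v := fun h => hu s (by rw [hk, Fin.ext h])
      simp [k18, Function.update_of_ne huv]
    · rw [hk] at hk'
      simp only [NodeKind.forget.injEq] at hk'
      obtain ⟨rfl, rfl⟩ := hk'
      simp [color]
  · refine ⟨by simp only [Test.cost, Expr.cost]; omega, hstep τ h17 (fun v _ => by rw [g18])
      fun v s hk => ?_⟩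
    simp [hk, NodeKind.code] at hh2

/-- Determines the labels of all vertices from the tables. -/
def traceBack : Program :=
  .store 17 (.var 3) (.var 21) ;; .forLoop 8 2 traceNode

theorem run_traceBack {q : ℕ → ℕ} (h : I.Loaded W ctr σ)
    (h12 : σ.arr 12 = q) (h16 : σ.arr 16 = P) (hq : I.IsTopDown q)
    (hrow : ∀ t, I.RowCorrect ctr V P t) (h21 : σ.var 21 < I.states)
    (hne : V (I.decomp.root * I.states + σ.var 21) ≠ 0) :
    Run W I.distArray traceBack σ fun r τ => r ≤ I.N * (I.bagBound * 22 + 108) + 10 ∧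
      ∃ E, I.IsRun ctr V E ∧ IsLabeling E (fun v => τ.arr 18 v) ∧ E I.decomp.root = σ.var 21 := by
  refine run_store_seq h.bdd trivial trivial fun hB => ?_
  have hL := h.agree (agree_setArr 17 _ _) hB (by decide) (by decide)
  simp only [Expr.eval, h.v3] at hB hL ⊢
  refine run_forLoop (I.bagBound * 22 + 100) hB (fun j τ => I.Traced ctr V q (σ.var 21)
    (fun t => τ.arr 17 t) (fun v => τ.arr 18 v) j) hL.v2 (by decide) (by decide) (by decide) ?_ ?_ ?_
  · refine ⟨by simp, fun i hi => absurd hi (by omega), fun s hs => ?_,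
      fun i hi => absurd hi (by omega)⟩
    obtain rfl | ⟨i, hi, -⟩ := hs
    · simpa using ⟨h21, hne⟩
    · omega
  · intro j τ hj hτ hA h8 hI
    have hL' := hL.agree hA hτ (by decide) (by decide)
    exact run_traceNode hL' h8 (by rw [hA.2 12 (by decide)]; simpa using h12)
      (by rw [hA.2 16 (by decide)]; simpa using h16) hq hj hrow hI
  · refine fun r τ hr _ _ _ hI => ⟨?_, _, hI.isRun hq, hI.isLabeling hq, hI.root⟩
    rw [show I.bagBound * 22 + 100 + 8 = I.bagBound * 22 + 108 from rfl] at hr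
    simp only [Expr.cost]
    omega

end RAM

/-! ### Setting up the parameters. -/

namespace KCenterInstance

variable (I : KCenterInstance)

/-- Some bag is nonempty, so the truncated subtraction in the width loses nothing and the machine
obtains `w + 1` as the largest bag size. -/
theorem bagBound_eq : I.bagBound = Finset.univ.sup fun t => (I.decomp.bag t).card := by
  have hn := I.two_le_n
  obtain ⟨t, ht⟩ := I.decomp.cover_vertex ⟨0, by omega⟩
  have h1 := Finset.card_pos.2 ⟨_, ht⟩
  have h2 := Finset.le_sup (f := fun t => (I.decomp.bag t).card) (Finset.mem_univ t)
  simp only [bagBound, w, TreeDecomposition.width]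
  omega

theorem arrayOf_lt {m b : ℕ} {f : Fin m → ℕ} (hf : ∀ i, f i < b) (hb : 0 < b) (a : ℕ) :
    arrayOf f a < b := by
  unfold arrayOf
  split_ifs
  exacts [hf _, hb]

/-- The partial products by which `setup` computes `states` fit into words. -/
theorem mul_pow_le_states {j : ℕ} (hj : j ≤ I.bagBound) : (I.k + 1) * I.colors ^ j ≤ I.states := by
  rw [mul_comm]
  exact Nat.mul_le_mul_right _ (Nat.pow_le_pow_right I.colors_pos hj)

theorem N_pos : 0 < I.N := (Nat.zero_le _).trans_lt I.decomp.root.2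

theorem input_bdd {W : ℕ} (h : 8 + I.N + I.n * I.n ≤ 2 ^ W) : RAM.Bdd W I.input := by
  have hn := I.two_le_n
  have hk := I.k_le_n
  have hN := I.N_pos
  have hr := I.decomp.root.2
  have hnn := Nat.le_mul_self I.n
  have hcode : ∀ t, (I.decomp.kind t).code < 2 ^ W := fun t => by
    cases I.decomp.kind t <;> simp only [NodeKind.code] <;> omega
  have h1 : ∀ t, (I.decomp.kind t).child₁ < 2 ^ W := fun t => by
    cases I.decomp.kind t <;> simp only [NodeKind.child₁] <;> omega
  have h2 : ∀ t, (I.decomp.kind t).child₂ < 2 ^ W := fun t => by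
    cases I.decomp.kind t <;> simp only [NodeKind.child₂] <;> omega
  have h3 : ∀ t, (I.decomp.kind t).label₁ < 2 ^ W := fun t => by
    cases I.decomp.kind t <;> simp only [NodeKind.label₁] <;> omega
  have h4 : ∀ t, (I.decomp.kind t).label₂ < 2 ^ W := fun t => by
    cases I.decomp.kind t <;> simp only [NodeKind.label₂] <;> omega
  have h5 : ∀ t, (I.decomp.bag t).card < 2 ^ W := fun t => by
    have := I.card_bag_le_n t
    omega
  have h0 : 0 < 2 ^ W := by omega
  refine ⟨fun x => ?_, fun a i => ?_⟩
  · unfold input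
    dsimp only
    split <;> omega
  · unfold input
    dsimp only
    split
    · dsimp only
      split_ifs <;> omega
    · exact arrayOf_lt hcode h0 i
    · exact arrayOf_lt h1 h0 i
    · exact arrayOf_lt h2 h0 i
    · exact arrayOf_lt h3 h0 i
    · exact arrayOf_lt h4 h0 i
    · exact arrayOf_lt h5 h0 i
    · refine arrayOf_lt (fun t => ?_) h0 _
      rw [List.getD_eq_getElem?_getD]
      cases hx : (((I.decomp.bag t).sort (· ≤ ·)).map Fin.val)[i % I.n]? with
      | none => simp
      | some x =>
        have := List.mem_of_getElem? hx
        simp only [List.mem_map] at this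
        obtain ⟨v, -, rfl⟩ := this
        simp only [Option.getD_some]
        omega
    · exact h0

end KCenterInstance

namespace RAM

open KCenterInstance

variable {W : ℕ} {D : ℕ → ℝ} {I : KCenterInstance} {ctr : ℕ → ℕ} {σ : State}

/-- Computes the parameters of the dynamic program. -/
def setup : Program :=
  .assign 5 (.const 0) ;;
  .forLoop 8 2
    (.ite (.lt (.var 5) (.get 6 (.var 8))) (.assign 5 (.get 6 (.var 8))) .skip) ;;
  .assign 6 (.mul (.var 1) (.var 5)) ;;
  .assign 7 (.add (.var 1) (.const 1)) ;;
  .forLoop 8 5 (.assign 7 (.mul (.var 7) (.var 6)))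

theorem run_setup (hbig : 8 + I.N + I.n * I.n + I.N * I.n + I.N * I.states + I.states * I.states ≤
    2 ^ W) : Run W D setup I.input fun r τ =>
      r ≤ I.N * 20 + I.bagBound * 20 + 40 ∧ I.Loaded W (fun _ => 0) τ := by
  have hI := I.input_bdd (W := W) (by omega)
  have hS := Nat.le_mul_self I.states
  have hcS := I.colors_le_states
  have hkS := k_lt_states (I := I)
  have c0 : 0 < 2 ^ W := by omega
  have i0 : I.input.var 0 = I.n := rfl
  have i1 : I.input.var 1 = I.k := rfl
  have i2 : I.input.var 2 = I.N := rfl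
  have i3 : I.input.var 3 = I.decomp.root := rfl
  refine run_assign_seq hI c0 fun hB => ?_
  refine Run.seq hB (run_forLoop 10 hB (fun j τ => (∀ t : Fin I.N, (t : ℕ) < j →
    (I.decomp.bag t).card ≤ τ.var 5) ∧ τ.var 5 ≤ I.bagBound) (c := I.N) (by simp [i2]) (by decide)
    (by decide) (by decide) (by simp [Expr.eval]) ?_
    (Q := fun r τ => r ≤ I.N * 18 + 6 ∧ τ.var 5 = I.bagBound) ?_) ?_
  · rintro j τ hj hτ hA h8 ⟨hI1, hI2⟩
    have e6 : τ.arr 6 j = (I.decomp.bag ⟨j, hj⟩).card := by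
      rw [hA.2 6 (by decide)]
      exact input_arr_six ⟨j, hj⟩
    have hcard := I.card_bag_le ⟨j, hj⟩
    have hnew : ∀ c, τ.var 5 ≤ c → (I.decomp.bag ⟨j, hj⟩).card ≤ c →
        ∀ t : Fin I.N, (t : ℕ) < j + 1 → (I.decomp.bag t).card ≤ c := by
      intro c h1 h2 t ht
      obtain ht | ht := Nat.lt_succ_iff_lt_or_eq.1 ht
      · exact (hI1 t ht).trans h1
      · rwa [show t = ⟨j, hj⟩ from Fin.ext ht]
    refine run_ite hτ ⟨trivial, trivial⟩ (fun hh => run_assign hτ trivial ?_)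
      (fun hh => run_skip.2 ?_)
    all_goals
      simp only [Test.Holds, Expr.eval, h8, e6] at hh
      simp only [Test.cost, Expr.cost, Expr.eval, setVar_var, Nat.reduceEqDiff, if_true, if_false,
        h8, e6]
    · exact ⟨by omega, hnew _ hh.le le_rfl, hcard⟩
    · exact ⟨by omega, hnew _ le_rfl (not_lt.1 hh), hI2⟩
  · rintro r τ hr hτ hA h8 ⟨hI1, hI2⟩
    refine ⟨hr, le_antisymm hI2 ?_⟩
    rw [I.bagBound_eq]
    exact Finset.sup_le fun t _ => hI1 t t.2
  rintro r τ ⟨hr, h5⟩ hτ hA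
  have a1 : τ.var 1 = I.k := by rw [hA.1 1 (by decide)]; rfl
  have hcol : τ.var 1 * τ.var 5 = I.colors := by rw [a1, h5]; rfl
  refine run_assign_seq hτ ⟨trivial, trivial, show τ.var 1 * τ.var 5 < 2 ^ W by omega⟩ fun hB2 => ?_
  refine run_assign_seq hB2 ⟨trivial, show 1 < 2 ^ W by omega, by simp [Expr.eval, a1]; omega⟩
    fun hB3 => ?_
  simp only [Expr.eval, hcol] at hB2 hB3 ⊢
  simp only [setVar_var, Nat.reduceEqDiff, if_false, a1] at hB3 ⊢
  refine run_forLoop 6 hB3 (fun j ρ => ρ.var 7 = (I.k + 1) * I.colors ^ j) (c := I.bagBound)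
    (by simp [h5]) (by decide) (by decide) (by decide) (by simp) ?_ ?_
  · intro j ρ hj hρ hA' h8 hI'
    have b6 : ρ.var 6 = I.colors := by rw [hA'.1 6 (by decide)]; simp
    have hle := I.mul_pow_le_states (show j + 1 ≤ I.bagBound from hj)
    have hev : (Expr.mul (.var 7) (.var 6)).eval ρ = (I.k + 1) * I.colors ^ (j + 1) := by
      simp only [Expr.eval, hI', b6, pow_succ, mul_assoc]
    refine run_assign hρ ⟨trivial, trivial, ?_⟩ ?_
    · change (Expr.mul (.var 7) (.var 6)).eval ρ < _
      omega
    · rw [hev]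
      simp [Expr.cost]
  · intro r' ρ hr' hρ hA' h8 hI'
    have hA2 : Agree [5, 6, 7, 8] [] I.input ρ := by
      refine Agree.trans (σ₂ := τ) ?_ (Agree.trans (σ₂ := (τ.setVar 6 I.colors).setVar 7 (I.k + 1))
        ?_ (hA'.mono (by decide) (by decide)))
      · exact ((agree_setVar 5 _).mono (by simp) (by simp)).trans (hA.mono (by decide) (by decide))
      · exact ((agree_setVar 6 _).mono (by simp) (by simp)).trans
          ((agree_setVar 7 _).mono (by simp) (by simp))
    refine ⟨by simp only [Expr.cost]; omega, ?_⟩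
    exact
      { bdd := hρ
        v0 := by rw [hA2.1 0 (by decide), i0]
        v1 := by rw [hA2.1 1 (by decide), i1]
        v2 := by rw [hA2.1 2 (by decide), i2]
        v3 := by rw [hA2.1 3 (by decide), i3]
        v5 := by rw [hA'.1 5 (by decide)]; simp [h5]
        v6 := by rw [hA'.1 6 (by decide)]; simp
        v7 := by rw [hI', mul_comm]; rfl
        inp := fun a _ => hA2.2 a (by simp)
        a10 := by rw [hA2.2 10 (by simp)]; rfl
        big := hbig }

end RAM

/-! ### The approximation guarantee. -/

namespace KCenterInstance

variable (I : KCenterInstance)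

theorem d_comm (u v : Fin I.n) : I.d u v = I.d v u := by
  let _ := I.metric
  exact dist_comm u v

theorem d_triangle (u v w : Fin I.n) : I.d u w ≤ I.d u v + I.d v w := by
  let _ := I.metric
  exact dist_triangle u v w

theorem d_self (u : Fin I.n) : I.d u u = 0 := by
  let _ := I.metric
  exact dist_self u

theorem d_nonneg (u v : Fin I.n) : 0 ≤ I.d u v := by
  let _ := I.metric
  exact dist_nonneg

variable {I}

theorem d_le_radius (S : ConnectedClustering I.G I.k) (v : Fin I.n) :
    I.d v (S.center (S.cluster v)) ≤ I.radius S :=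
  le_ciSup (f := fun v => I.d v (S.center (S.cluster v))) (Set.finite_range _).bddAbove v

theorem radius_le {S : ConnectedClustering I.G I.k} {r : ℝ}
    (h : ∀ v, I.d v (S.center (S.cluster v)) ≤ r) : I.radius S ≤ r := by
  have : Nonempty (Fin I.n) := ⟨⟨0, by have := I.two_le_n; omega⟩⟩
  exact ciSup_le h

theorem radius_nonneg (S : ConnectedClustering I.G I.k) : 0 ≤ I.radius S :=
  (I.d_nonneg _ _).trans (d_le_radius S ⟨0, by have := I.two_le_n; omega⟩)

/-- Points in the same cluster are close. -/
theorem d_le_two_mul (S : ConnectedClustering I.G I.k) {u v : Fin I.n}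
    (h : S.cluster u = S.cluster v) : I.d u v ≤ 2 * I.radius S := by
  have h1 := I.d_triangle u (S.center (S.cluster u)) v
  have h2 := d_le_radius S u
  have h3 := d_le_radius S v
  rw [I.d_comm v, ← h] at h3
  linarith

/-- Centers chosen farthest first are close to all vertices. -/
theorem exists_near (S : ConnectedClustering I.G I.k) {c : Fin I.k → Fin I.n}
    (hc : ∀ v, ∃ i, ∀ a b, a < b → I.d v (c i) ≤ I.d (c b) (c a)) (v : Fin I.n) :
    ∃ i, I.d v (c i) ≤ 2 * I.radius S := by
  by_cases hinj : Function.Injective fun i => S.cluster (c i)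
  · obtain ⟨i, hi⟩ := Finite.surjective_of_injective hinj (S.cluster v)
    exact ⟨i, d_le_two_mul S hi.symm⟩
  · obtain ⟨i, hi⟩ := hc v
    simp only [Function.Injective] at hinj
    push Not at hinj
    obtain ⟨a, b, hab, hne⟩ := hinj
    obtain h | h := lt_or_gt_of_ne hne
    · exact ⟨i, (hi a b h).trans (d_le_two_mul S hab.symm)⟩
    · exact ⟨i, (hi b a h).trans (d_le_two_mul S hab)⟩

/-- A labeling that is constant on the clusters has few components. -/
theorem ncard_component_le (S : ConnectedClustering I.G I.k) (f : Fin I.k → ℕ) :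
    (Set.univ : Set (labelGraph I.G fun v => f (S.cluster v)).ConnectedComponent).ncard ≤ I.k := by
  have hreach : ∀ v, (labelGraph I.G fun v => f (S.cluster v)).Reachable v
      (S.center (S.cluster v)) := by
    intro v
    have h := (S.connected (S.cluster v)).preconnected ⟨v, rfl⟩
      ⟨S.center (S.cluster v), S.center_mem _⟩
    let φ : I.G.induce {u | S.cluster u = S.cluster v} →g
        labelGraph I.G fun v => f (S.cluster v) :=
      ⟨Subtype.val, fun {a b} hab => ⟨hab, congrArg f (a.2.trans b.2.symm)⟩⟩
    exact h.map φ
  have hsurj : (Set.univ : Set (labelGraph I.G fun v => f (S.cluster v)).ConnectedComponent) =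
      Set.range fun i => (labelGraph I.G fun v => f (S.cluster v)).connectedComponentMk
        (S.center i) := by
    refine (Set.eq_univ_of_forall fun x => ?_).symm
    induction x using SimpleGraph.ConnectedComponent.ind with
    | h v => exact ⟨S.cluster v, SimpleGraph.ConnectedComponent.sound (hreach v).symm⟩
  rw [hsurj, ← Set.image_univ]
  exact (Set.ncard_image_le (Set.toFinite _)).trans (by simp [Set.ncard_univ])

/-- A bag with at most one vertex cannot cover an edge. -/
theorem not_adj_of_w_eq_zero (h : I.bagBound ≤ 1) (u v : Fin I.n) : ¬ I.G.Adj u v := by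
  intro huv
  obtain ⟨t, hu, hv⟩ := I.decomp.cover_edge u v huv
  have := (I.card_bag_le t).trans h
  exact huv.ne (Finset.card_le_one.1 this u hu v hv)

/-- Connected clusters of an edgeless graph are singletons, so every feasible solution has radius
zero. -/
theorem eq_center_of_edgeless (h : ∀ u v, ¬ I.G.Adj u v) (S : ConnectedClustering I.G I.k)
    (v : Fin I.n) : S.center (S.cluster v) = v := by
  have hr := (S.connected (S.cluster v)).preconnected ⟨v, rfl⟩
    ⟨S.center (S.cluster v), S.center_mem _⟩
  rw [SimpleGraph.reachable_iff_reflTransGen] at hr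
  obtain hr | ⟨c, hc, -⟩ := Relation.ReflTransGen.cases_head hr
  · exact (congrArg Subtype.val hr).symm
  · exact absurd hc (h _ _)

/-- Bounds the time of the dynamic program. -/
def labelTime (I : KCenterInstance) : ℕ :=
  I.N * (I.nodeTime + I.bagBound * 22 + 166) + I.states * 60 + 60

/-- Bounds the time of the algorithm. -/
def totalTime (I : KCenterInstance) : ℕ :=
  (I.N * 20 + I.bagBound * 20 + 40) + (I.k * (45 * I.n + 25) + 6) +
    ((if 1 < I.bagBound then I.labelTime else 0) + 6) + (64 * I.n * I.n + 100 * I.n + 100) +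
    (40 * I.n + 40)

end KCenterInstance

namespace RAM

open KCenterInstance

variable {W : ℕ} {I : KCenterInstance} {ctr : ℕ → ℕ} {σ : State}

/-- Labels the vertices with the centers in array `10`. -/
def labelVertices : Program :=
  enumerateNodes ;; fillTables ;; selectRoot ;; .ite (.eq (.var 20) (.const 1)) traceBack .skip

/-- The computed labeling is compared with an arbitrary competitor `lam` of cost at most `ρ`. By
`exists_state` the competitor guarantees a state at the root of value at most `ρ`, hence so does the
selected one; `IsRun.exists_hitting` and `IsRun.dist_le` then apply to the traced run. Without a
competitor nothing is claimed about array `18`. -/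
theorem run_labelVertices (h : I.Loaded W ctr σ) (hctr : ∀ j < I.k, ctr j < I.n)
    (h15 : ∀ i, σ.arr 15 i = 0) :
    Run W I.distArray labelVertices σ fun r τ => r ≤ I.labelTime ∧
      ∀ (lam : Fin I.n → ℕ) (ρ : ℝ), (∀ v, lam v < I.k) → I.distArray 0 ≤ ρ →
        (∀ v : Fin I.n, I.distArray (v * I.n + ctr (lam v)) ≤ ρ) →
        (Set.univ : Set (labelGraph I.G lam).ConnectedComponent).ncard ≤ I.k →
        (∃ Z : Finset (Fin I.n), Z.card ≤ I.k ∧ ∀ v, ∃ z ∈ Z,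
          (labelGraph I.G fun v => τ.arr 18 v).Reachable v z) ∧
        ∀ v : Fin I.n, τ.arr 18 v < I.k ∧ I.distArray (v * I.n + ctr (τ.arr 18 v)) ≤ ρ := by
  have hbig := h.big
  have hk := I.two_le_k
  have c1 : 1 < 2 ^ W := by omega
  have hcost : I.labelTime = I.N * I.nodeTime + I.N * (I.bagBound * 22 + 108) + I.N * 58 +
    I.states * 60 + 60 := by
    simp only [labelTime]
    ring
  refine Run.seq h.bdd (run_enumerateNodes h) ?_
  rintro r₁ τ₁ ⟨hr₁, hq⟩ hτ₁ hA₁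
  have hL₁ := h.agree hA₁ hτ₁ (by decide) (by decide)
  refine Run.seq hτ₁ (run_fillTables hL₁ hctr hq (by rw [hA₁.2 15 (by decide)]; exact h15)) ?_
  rintro r₂ τ₂ ⟨hr₂, hrow, -⟩ hτ₂ hA₂
  rw [mul_add] at hr₂
  have hL₂ := hL₁.agree hA₂ hτ₂ (by decide) (by decide)
  refine Run.seq hτ₂ (run_selectRoot hL₂ rfl) ?_
  rintro r₃ τ₃ ⟨hr₃, h21, hne, hbest⟩ hτ₃ hA₃
  have hL₃ := hL₂.agree hA₃ hτ₃ (by decide) (by decide)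
  have hex : ∀ (lam : Fin I.n → ℕ) (ρ : ℝ), (∀ v, lam v < I.k) → I.distArray 0 ≤ ρ →
      (∀ v : Fin I.n, I.distArray (v * I.n + ctr (lam v)) ≤ ρ) →
      (Set.univ : Set (labelGraph I.G lam).ConnectedComponent).ncard ≤ I.k → τ₃.var 20 = 1 ∧
        I.distArray (τ₂.arr 15 (I.decomp.root * I.states + τ₃.var 21) - 1) ≤ ρ := by
    intro lam ρ h1 h2 h3 h4
    obtain ⟨e, he, hne, hle, -⟩ := exists_state hrow h1 h2 h3 h4 I.decomp.root
    obtain ⟨h5, h6⟩ := hbest e he hne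
    exact ⟨h5, h6.trans hle⟩
  refine run_ite hτ₃ ⟨trivial, c1⟩ (fun hh => ?_) (fun hh => run_skip.2 ?_)
  · change τ₃.var 20 = 1 at hh
    refine (run_traceBack (q := τ₁.arr 12) (V := τ₂.arr 15) (P := τ₂.arr 16) hL₃
      (by rw [hA₃.2 12 (by decide), hA₂.2 12 (by decide)])
      (by rw [hA₃.2 16 (by decide)]) hq hrow h21 (hne hh)).mono ?_
    rintro r₄ τ₄ ⟨hr₄, E, hrun, hlab, hroot⟩
    refine ⟨by simp only [Test.cost, Expr.cost]; omega, fun lam ρ h1 h2 h3 h4 =>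
      ⟨hrun.exists_hitting hlab, fun v => ⟨?_, ?_⟩⟩⟩
    · obtain ⟨t, s, hk⟩ := exists_forget v
      have h5 : τ₄.arr 18 v = _ := hlab t v s hk
      rw [h5]
      exact Nat.mod_lt _ (by omega)
    · refine (hrun.dist_le hlab v).trans ?_
      rw [hroot]
      exact (hex lam ρ h1 h2 h3 h4).2
  · refine ⟨by simp only [Test.cost, Expr.cost]; omega, fun lam ρ h1 h2 h3 h4 => ?_⟩
    exact absurd (hex lam ρ h1 h2 h3 h4).1 hh

/-- The approximation algorithm for connected `k`-center. -/
def connectedKCenter : Program :=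
  setup ;; farthestFirst ;; .ite (.lt (.const 1) (.var 5)) labelVertices .skip ;;
  mergeClusters ;; outputClusters

/-- The merging phase needs two facts about the labels, both conditional on a feasible `S'`: at most
`k` components, and closeness of equally labelled vertices. The dynamic program provides them if
there are bags with two vertices; otherwise the absence of edges does. -/
theorem run_connectedKCenter (hbig : 8 + I.N + I.n * I.n + I.N * I.n + I.N * I.states +
    I.states * I.states ≤ 2 ^ W) :
    Run W I.distArray connectedKCenter I.input fun r τ => r ≤ I.totalTime ∧ I.Solves 6 τ := by
  have hn := I.two_le_n
  have hk := I.two_le_k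
  have hnW : I.n * I.n < 2 ^ W := by omega
  have hI := I.input_bdd (W := W) (by omega)
  refine Run.seq hI (run_setup hbig) ?_
  rintro r₁ τ₁ ⟨hr₁, hL₁⟩ hτ₁ hA₁
  refine Run.seq hτ₁ (run_farthestFirst hτ₁ (by omega) hL₁.v0 hL₁.v1 hnW) ?_
  rintro r₂ τ₂ ⟨hr₂, hctr, hfar⟩ hτ₂ hA₂
  have hL₂ : I.Loaded W (τ₂.arr 10) τ₂ :=
    { bdd := hτ₂
      v0 := by rw [hA₂.1 0 (by decide), hL₁.v0]
      v1 := by rw [hA₂.1 1 (by decide), hL₁.v1]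
      v2 := by rw [hA₂.1 2 (by decide), hL₁.v2]
      v3 := by rw [hA₂.1 3 (by decide), hL₁.v3]
      v5 := by rw [hA₂.1 5 (by decide), hL₁.v5]
      v6 := by rw [hA₂.1 6 (by decide), hL₁.v6]
      v7 := by rw [hA₂.1 7 (by decide), hL₁.v7]
      inp := fun a ha => by
        rw [hA₂.2 a (by simp [farthestFirst, Program.forLoop, Program.wa]; omega), hL₁.inp a ha]
      a10 := rfl
      big := hbig }
  let c : Fin I.k → Fin I.n := fun i => ⟨τ₂.arr 10 i, hctr i i.2⟩
  have hc : ∀ v, ∃ i, ∀ a b, a < b → I.d v (c i) ≤ I.d (c b) (c a) := by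
    intro v
    obtain ⟨i, hi, h⟩ := hfar (by omega) v v.2
    refine ⟨⟨i, hi⟩, fun a b hab => ?_⟩
    have := h b b.2 a hab
    rwa [show v * I.n + τ₂.arr 10 i = v * I.n + c ⟨i, hi⟩ from rfl,
      show τ₂.arr 10 b * I.n + τ₂.arr 10 a = c b * I.n + c a from rfl, I.distArray_eq,
      I.distArray_eq] at this
  refine Run.seq hτ₂ (R := fun r τ => r ≤ (if 1 < I.bagBound then I.labelTime else 0) + 6 ∧
    ∀ S' : ConnectedClustering I.G I.k,
      (∃ Z : Finset (Fin I.n), Z.card ≤ I.k ∧ ∀ v, ∃ z ∈ Z,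
        (labelGraph I.G fun v => τ.arr 18 v).Reachable v z) ∧
      ∀ S : ConnectedClustering I.G I.k,
        (∀ v : Fin I.n, τ.arr 18 v = τ.arr 18 (S.center (S.cluster v))) →
        I.radius S ≤ 6 * I.radius S') ?_ ?_
  · refine run_ite hτ₂ ⟨show 1 < 2 ^ W by nlinarith, trivial⟩ (fun hh => ?_) (fun hh => run_skip.2 ?_)
    all_goals simp only [Test.Holds, Expr.eval, hL₂.v5] at hh
    · refine (run_labelVertices hL₂ hctr fun i => ?_).mono ?_
      · rw [hA₂.2 15 (by decide), hA₁.2 15 (by decide)]; rfl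
      rintro r τ ⟨hr, hlab⟩
      refine ⟨by rw [if_pos hh]; simp only [Test.cost, Expr.cost]; omega, fun S' => ?_⟩
      -- The competitor labels each cluster of `S'` by a selected point within twice the radius of
      -- its center, hence within three times the radius of all its vertices.
      choose f hf using fun i => exists_near S' hc (S'.center i)
      have hρ := radius_nonneg S'
      have h0 : I.distArray 0 = 0 := by
        have := I.distArray_eq ⟨0, by omega⟩ ⟨0, by omega⟩
        simpa [I.d_self] using this
      have hlam : ∀ v : Fin I.n, I.distArray (v * I.n + τ₂.arr 10 (f (S'.cluster v))) ≤
          3 * I.radius S' := by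
        intro v
        rw [show τ₂.arr 10 (f (S'.cluster v)) = c (f (S'.cluster v)) from rfl, I.distArray_eq]
        have h1 := I.d_triangle v (S'.center (S'.cluster v)) (c (f (S'.cluster v)))
        have h2 := d_le_radius S' v
        have h3 := hf (S'.cluster v)
        linarith
      obtain ⟨hZ, hd⟩ := hlab (fun v => f (S'.cluster v)) (3 * I.radius S') (fun v => (f _).2)
        (by rw [h0]; linarith) hlam (ncard_component_le S' fun i => f i)
      refine ⟨hZ, fun S hS => radius_le fun v => ?_⟩
      obtain ⟨hlt, hv⟩ := hd v
      -- A vertex and its center share a label, and both are within three times the radius of `S'`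
      -- of the corresponding point; this is where the factor 6 arises.
      have hz := (hd (S.center (S.cluster v))).2
      rw [← hS v, show τ₂.arr 10 (τ.arr 18 v) = c ⟨_, hlt⟩ from rfl, I.distArray_eq] at hz
      rw [show τ₂.arr 10 (τ.arr 18 v) = c ⟨_, hlt⟩ from rfl, I.distArray_eq] at hv
      have := I.d_triangle v (c ⟨_, hlt⟩) (S.center (S.cluster v))
      rw [I.d_comm] at hz
      linarith
    · have hadj := not_adj_of_w_eq_zero (I := I) (not_lt.1 hh)
      refine ⟨by simp only [Test.cost, Expr.cost]; omega, fun S' => ⟨⟨Finset.univ.image S'.center,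
        Finset.card_image_le.trans (by simp), fun v => ⟨v, ?_, .refl _⟩⟩, fun S _ =>
        radius_le fun v => ?_⟩⟩
      · exact Finset.mem_image.2 ⟨_, Finset.mem_univ _, eq_center_of_edgeless hadj S' v⟩
      · rw [eq_center_of_edgeless hadj S v, I.d_self]
        have := radius_nonneg S'
        linarith
  rintro r₃ τ₃ ⟨hr₃, happ⟩ hτ₃ hA₃
  have hL₃ := hL₂.agree hA₃ hτ₃ (by decide) (by decide)
  refine Run.seq hτ₃ (run_mergeClusters (G := I.G) hτ₃ hL₃.v0 hL₃.v1 I.k_le_n hnW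
    (fun u v => by rw [hL₃.inp 0 (by omega)]; exact I.input_arr_zero u v) rfl) ?_
  rintro r₄ τ₄ ⟨hr₄, hk9, hm, h9⟩ hτ₄ hA₄
  have hL₄ := hL₃.agree hA₄ hτ₄ (by decide) (by decide)
  refine (run_outputClusters hτ₄ hL₄.v0 hL₄.v1 (by omega) hnW rfl hm).mono ?_
  rintro r₅ τ₅ ⟨hr₅, h4, hout⟩
  refine ⟨by simp only [totalTime]; omega, fun ⟨S'⟩ => ?_, fun hemp => ?_⟩
  · have hck : τ₄.var 9 = I.k := by
      obtain h | h := h9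
      · exact h
      · obtain ⟨⟨Z, hZ, hr⟩, -⟩ := happ S'
        exact le_antisymm ((hm.le_card_of_hitting h hr).trans hZ) hk9
    obtain ⟨S, h1, h2, h3⟩ := hout hck
    exact ⟨by rw [h4, if_pos hck], S, ⟨h1, h2⟩, fun S'' => (happ S'').2 S h3⟩
  -- Ending with exactly `k` clusters would itself produce a feasible solution.
  · rw [h4, if_neg fun h => ?_]
    obtain ⟨S, -⟩ := hout h
    exact hemp.false S

end RAM

/-! ### Bounds for the running time and the word length. -/

namespace KCenterInstance

variable {I : KCenterInstance} {A : ℕ}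

/-- Bounds the parameters of the dynamic program. -/
theorem param_le (hw : 0 < I.w) : I.bagBound ^ 3 ≤ (I.w * I.k) ^ (6 * I.w) ∧
    I.states ≤ (I.w * I.k) ^ (6 * I.w) := by
  have hk := I.two_le_k
  obtain ⟨M, hM⟩ : ∃ M, M = I.w * I.k := ⟨_, rfl⟩
  have hM2 : 2 ≤ M := hM ▸ (Nat.mul_le_mul hw hk)
  have hwM : I.w ≤ M := hM ▸ Nat.le_mul_of_pos_right _ (by omega)
  have hkM : I.k ≤ M := hM ▸ Nat.le_mul_of_pos_left _ hw
  -- Since `M ≥ 2`, constant factors are absorbed into one more power: `w + 1`, `k + 1` and `k * (w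
  -- + 1)` are all at most `M ^ 2`.
  have hMM : 2 * M ≤ M ^ 2 := by nlinarith
  have hB : I.bagBound ≤ M ^ 2 := by simp only [bagBound]; omega
  have hc : I.colors ≤ M ^ 2 := by
    calc I.k * (I.w + 1) ≤ I.k * (2 * I.w) := Nat.mul_le_mul_left _ (by omega)
      _ = 2 * M := by rw [hM]; ring
      _ ≤ M ^ 2 := hMM
  rw [← hM]
  constructor
  · calc I.bagBound ^ 3 ≤ (M ^ 2) ^ 3 := Nat.pow_le_pow_left hB 3
      _ = M ^ 6 := by ring
      _ ≤ M ^ (6 * I.w) := Nat.pow_le_pow_right (by omega) (by omega)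
  · calc I.states ≤ (M ^ 2) ^ I.bagBound * M ^ 2 :=
        Nat.mul_le_mul (Nat.pow_le_pow_left hc _) (by omega)
      _ = M ^ (2 * I.bagBound + 2) := by rw [pow_add, pow_mul]
      -- The exponent is `2 * (w + 1) + 2 = 2 * w + 4`, at most `6 * w` because `w ≥ 1`.
      _ ≤ M ^ (6 * I.w) := Nat.pow_le_pow_right (by omega) (by simp only [bagBound]; omega)

theorem one_le_pow (I : KCenterInstance) (c : ℕ) : 1 ≤ (I.w * I.k) ^ (c * I.w) := by
  rcases Nat.eq_zero_or_pos I.w with h | h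
  · simp [h]
  · exact Nat.one_le_pow _ _ (Nat.mul_pos h (by have := I.two_le_k; omega))

/-- With `X = (wk) ^ (6w)` bounding both `states` and `bagBound ^ 3`, a node costs a constant times
`X ^ 3` (two loops over the states and the cubic work per pair), and there are at most `A * n * X`
nodes; this gives `X ^ 4 = (wk) ^ (24w)`. For `w = 0` the power is 1 although there are `k * (k +
1)` states, so the bound relies on the program skipping the dynamic program. -/
theorem totalTime_le (hN : I.N ≤ A * (I.n * (I.w + 1))) :
    I.totalTime ≤ 500 * I.n ^ 2 + 3000 * A * (I.n * (I.w * I.k) ^ (24 * I.w)) := by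
  have hn := I.two_le_n
  have hkn := I.k_le_n
  have hA : 1 ≤ A := Nat.pos_of_ne_zero fun h => by
    have := I.N_pos
    simp [h] at hN
    omega
  have hbase : I.k * (45 * I.n + 25) + 64 * I.n * I.n + 100 * I.n + 40 * I.n + 200 ≤
      500 * I.n ^ 2 := by
    have := Nat.mul_le_mul_right (45 * I.n + 25) hkn
    nlinarith
  rcases Nat.eq_zero_or_pos I.w with h | h
  · have hB : I.bagBound = 1 := by simp [bagBound, h]
    simp only [totalTime, hB, h] at hN ⊢
    have hAn : I.n ≤ A * I.n := Nat.le_mul_of_pos_left _ hA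
    simp only [zero_add, mul_one, zero_mul, mul_zero, pow_zero, lt_self_iff_false, if_false,
      mul_assoc] at hN hbase ⊢
    omega
  obtain ⟨hB3, hS⟩ := I.param_le h
  obtain ⟨X, hX⟩ : ∃ X, X = (I.w * I.k) ^ (6 * I.w) := ⟨_, rfl⟩
  have hX4 : (I.w * I.k) ^ (24 * I.w) = X ^ 4 := by
    rw [hX, ← pow_mul]
    congr 1
    ring
  have hX1 : 1 ≤ X := hX ▸ I.one_le_pow 6
  rw [← hX] at hB3 hS
  rw [hX4]
  have hB0 := I.bagBound_pos
  have hB1 : I.bagBound ≤ I.bagBound ^ 3 := Nat.le_self_pow (by omega) _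
  have hB2 : I.bagBound ^ 2 ≤ I.bagBound ^ 3 := Nat.pow_le_pow_right hB0 (by omega)
  have hpair : I.pairTime ≤ 660 * X := by
    have : I.pairTime = 30 * I.bagBound ^ 3 + 60 * I.bagBound ^ 2 + 170 * I.bagBound + 400 := by
      simp only [pairTime]
      ring
    omega
  have hX2 : X ≤ X ^ 2 := Nat.le_self_pow (by omega) _
  have hX3 : X ≤ X ^ 3 := Nat.le_self_pow (by omega) _
  have hX34 : X ^ 3 ≤ X ^ 4 := Nat.pow_le_pow_right hX1 (by omega)
  have hnode : I.nodeTime ≤ 1400 * X ^ 3 := by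
    calc I.nodeTime ≤ X * (X * (2 * (660 * X) + 8) + 14) + 46 := by
          simp only [nodeTime]
          gcongr
      _ = 1320 * X ^ 3 + 8 * X ^ 2 + 14 * X + 46 := by ring
      _ ≤ 1400 * X ^ 3 := by
          have : X ^ 2 ≤ X ^ 3 := Nat.pow_le_pow_right hX1 (by omega)
          omega
  have hNX : I.N ≤ A * (I.n * X) :=
    hN.trans (Nat.mul_le_mul_left _ (Nat.mul_le_mul_left _ (by
      have : I.w + 1 = I.bagBound := rfl
      omega)))
  have hlabel : I.labelTime ≤ 1600 * A * (I.n * X ^ 4) + 120 * X ^ 4 := by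
    calc I.labelTime ≤ A * (I.n * X) * (1600 * X ^ 3) + 120 * X := by
          have : I.N * (I.nodeTime + I.bagBound * 22 + 166) ≤ A * (I.n * X) * (1600 * X ^ 3) :=
            Nat.mul_le_mul hNX (by omega)
          simp only [labelTime]
          omega
      _ = 1600 * A * (I.n * X ^ 4) + 120 * X := by ring
      _ ≤ _ := by omega
  have hNX4 : I.N ≤ A * (I.n * X ^ 4) := hNX.trans (by gcongr; omega)
  have hXA : X ^ 4 ≤ A * (I.n * X ^ 4) := by
    have := Nat.mul_le_mul_right (X ^ 4) (Nat.mul_le_mul hA (show 1 ≤ I.n by omega))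
    simpa [mul_assoc] using this
  rw [mul_assoc] at hlabel ⊢
  have hite : (if 1 < I.bagBound then I.labelTime else 0) ≤ I.labelTime := by
    split_ifs <;> omega
  simp only [totalTime]
  omega

/-- Everything stored, including table positions and encoded pairs of states, is polynomial in `T`,
the main term of the running time; so words of logarithmic length suffice. The case `w = 0` is
separate because there `states = k * (k + 1)` is bounded by the term `n ^ 2` of `T` instead of by
`X`. -/
theorem space_le (hN : I.N ≤ A * (I.n * (I.w + 1))) :
    8 + I.N + I.n * I.n + I.N * I.n + I.N * I.states + I.states * I.states ≤
      40 * A * (I.n ^ 2 + I.n * (I.w * I.k) ^ (24 * I.w)) ^ 4 := by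
  have hn := I.two_le_n
  have hkn := I.k_le_n
  have hk := I.two_le_k
  have hA : 1 ≤ A := Nat.pos_of_ne_zero fun h => by
    have := I.N_pos
    simp [h] at hN
    omega
  obtain ⟨X, hX⟩ : ∃ X, X = (I.w * I.k) ^ (6 * I.w) := ⟨_, rfl⟩
  have hX4 : (I.w * I.k) ^ (24 * I.w) = X ^ 4 := by
    rw [hX, ← pow_mul]
    congr 1
    ring
  have hX1 : 1 ≤ X := hX ▸ I.one_le_pow 6
  obtain ⟨T, hT⟩ : ∃ T, T = I.n ^ 2 + I.n * (I.w * I.k) ^ (24 * I.w) := ⟨_, rfl⟩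
  have hnT : I.n ^ 2 ≤ T := hT ▸ Nat.le_add_right _ _
  have hn1 : I.n ≤ I.n ^ 2 := Nat.le_self_pow (by omega) _
  have hXT : I.n * X ≤ T := by
    rw [hT, hX4]
    have : I.n * X ≤ I.n * X ^ 4 := Nat.mul_le_mul_left _ (Nat.le_self_pow (by omega) _)
    omega
  have hXT' : X ≤ T := (Nat.le_mul_of_pos_left _ (by omega)).trans hXT
  have hT1 : 1 ≤ T := hX1.trans hXT'
  have hT2 : T ≤ T ^ 2 := Nat.le_self_pow (by omega) _
  have hT24 : T ^ 2 ≤ T ^ 4 := Nat.pow_le_pow_right hT1 (by omega)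
  have hT34 : T ^ 3 ≤ T ^ 4 := Nat.pow_le_pow_right hT1 (by omega)
  have hS : I.states ≤ 2 * T ∧ I.N ≤ A * T := by
    rcases Nat.eq_zero_or_pos I.w with h | h
    · constructor
      · simp only [states, colors, bagBound, h, zero_add, mul_one, pow_one]
        nlinarith
      · simp only [h, zero_add, mul_one] at hN
        exact hN.trans (Nat.mul_le_mul_left _ (by omega))
    · obtain ⟨hB3, hS⟩ := I.param_le h
      rw [← hX] at hB3 hS
      have hB1 : I.bagBound ≤ I.bagBound ^ 3 := Nat.le_self_pow (by omega) _
      refine ⟨by omega, hN.trans (Nat.mul_le_mul_left _ (le_trans ?_ hXT))⟩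
      exact Nat.mul_le_mul_left _ (hB1.trans hB3)
  obtain ⟨hS, hNT⟩ := hS
  rw [← hT]
  calc 8 + I.N + I.n * I.n + I.N * I.n + I.N * I.states + I.states * I.states ≤
      8 + A * T + T + A * T * T + A * T * (2 * T) + 2 * T * (2 * T) := by
        gcongr
        · rwa [← sq]
        · omega
    _ = 8 + A * T + T + 3 * (A * T ^ 2) + 4 * T ^ 2 := by ring
    _ ≤ 40 * A * T ^ 4 := by
        have h1 : A * T ≤ A * T ^ 4 := Nat.mul_le_mul_left _ (by omega)
        have h2 : A * T ^ 2 ≤ A * T ^ 4 := Nat.mul_le_mul_left _ (by omega)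
        have h3 : T ^ 4 ≤ A * T ^ 4 := Nat.le_mul_of_pos_left _ hA
        rw [mul_assoc]
        omega

end KCenterInstance

/-- The function in the bound for the parameterized running time. -/
theorem computable_bound (a b c : ℕ) : Computable fun m : ℕ => a + b * (m * m) ^ (c * m) := by
  have hpow : Primrec₂ fun x y : ℕ => x ^ y := Primrec₂.unpaired'.1 Nat.Primrec.pow
  exact (Primrec.nat_add.comp (Primrec.const a) (Primrec.nat_mul.comp (Primrec.const b)
    (hpow.comp (Primrec.nat_mul.comp Primrec.id Primrec.id)
      (Primrec.nat_mul.comp (Primrec.const c) Primrec.id)))).to_comp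

namespace KCenterInstance

variable {I : KCenterInstance}

/-- As `n ≥ 2`, `log n ≥ log 2 > 1 / 2`: the logarithmic factors cost at most the factor 2 in `C /
2`, and the running time need not contain them. -/
theorem le_timeBound {C : ℕ} (hC : 24 ≤ C) :
    (C : ℝ) / 2 * ((I.n ^ 2 + I.n * (I.w * I.k) ^ (24 * I.w) : ℕ) : ℝ) ≤ I.timeBound C := by
  have hn : (2 : ℝ) ≤ I.n := by exact_mod_cast I.two_le_n
  have hlog : 1 / 2 ≤ Real.log I.n := by
    have h1 := Real.log_le_log (by norm_num) hn
    have h2 := Real.log_two_gt_d9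
    linarith
  have hpow : (I.w * I.k) ^ (24 * I.w) ≤ (I.w * I.k) ^ (C * I.w) := by
    rcases Nat.eq_zero_or_pos I.w with h | h
    · simp [h]
    · exact Nat.pow_le_pow_right (Nat.mul_pos h (by have := I.two_le_k; omega))
        (Nat.mul_le_mul_right _ hC)
  have hpow' : ((I.w * I.k : ℝ)) ^ (24 * I.w) ≤ (I.w * I.k : ℝ) ^ (C * I.w) := by
    exact_mod_cast hpow
  have h0 : (0 : ℝ) ≤ (I.w * I.k : ℝ) ^ (24 * I.w) := by positivity
  have h1 : (I.n : ℝ) ^ 2 * (1 / 2) ≤ (I.n : ℝ) ^ 2 * Real.log I.n := by gcongr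
  have h2 : (I.n : ℝ) * (1 / 2) * (I.w * I.k : ℝ) ^ (24 * I.w) ≤
      I.n * Real.log I.n * (I.w * I.k : ℝ) ^ (C * I.w) := by gcongr
  rw [timeBound, div_mul_eq_mul_div, mul_div_assoc]
  refine mul_le_mul_of_nonneg_left ?_ (Nat.cast_nonneg C)
  push_cast
  linarith

end KCenterInstance

/-- There is one program that computes a 6-approximation of connected `k`-center, given a nice tree
decomposition of width `w` with `O(n(w + 1))` nodes (`A` is the constant in this bound), in time
`O(n² log n + n log n (wk)^O(w))` on words whose length is logarithmic in the running time; its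
running time is fixed-parameter tractable in `max(w, k)`. -/
theorem mainTheorem5 :
    ∃ P : RAM.Program, ∀ A : ℕ, ∃ (C c : ℕ) (f : ℕ → ℕ), Computable f ∧
      ∀ I : KCenterInstance, I.N ≤ A * (I.n * (I.w + 1)) →
        ∃ (W t : ℕ) (σ : RAM.State),
          RAM.Exec W I.distArray P I.input t σ ∧
          (W : ℝ) ≤ C * Real.log (I.timeBound C) ∧
          (t : ℝ) ≤ I.timeBound C ∧
          t ≤ f (max I.w I.k) * I.n ^ c ∧
          I.Solves 6 σ := by
  -- Half of `C = 6000 * A + 1000` is the sum of the two constants in `totalTime_le`. The exponent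
  -- `c = 2` covers both terms because `n ≤ n ^ 2`.
  refine ⟨RAM.connectedKCenter, fun A => ⟨6000 * A + 1000, 2,
    fun m => 500 + 3000 * A * (m * m) ^ (24 * m), computable_bound _ _ _, fun I hN => ?_⟩⟩
  obtain ⟨T, hT⟩ : ∃ T, T = I.n ^ 2 + I.n * (I.w * I.k) ^ (24 * I.w) := ⟨_, rfl⟩
  have hn := I.two_le_n
  have hspace := KCenterInstance.space_le hN
  have htime := KCenterInstance.totalTime_le hN
  have hbound := KCenterInstance.le_timeBound (I := I) (C := 6000 * A + 1000) (by omega)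
  rw [← hT] at hspace hbound
  obtain ⟨Q, hQ⟩ : ∃ Q, Q = 40 * A * T ^ 4 := ⟨_, rfl⟩
  rw [← hQ] at hspace
  -- `W` is chosen with `Q < 2 ^ W`, where `Q` bounds the space.
  obtain ⟨t, σ, he, ht, hsol⟩ := RAM.run_connectedKCenter (I := I) (W := Nat.log 2 Q + 1)
    (hspace.trans (Nat.lt_pow_succ_log_self (by omega) Q).le)
  have hn4 : 4 ≤ I.n ^ 2 := by nlinarith
  have hT4 : 4 ≤ T := by omega
  have hTR : (4 : ℝ) ≤ T := by exact_mod_cast hT4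
  have hA0 : (0 : ℝ) ≤ A := Nat.cast_nonneg A
  obtain ⟨B, hB⟩ : ∃ B, B = I.timeBound (6000 * A + 1000) := ⟨_, rfl⟩
  rw [← hB] at hbound ⊢
  push_cast at hbound
  refine ⟨Nat.log 2 Q + 1, t, σ, he, ?_, ?_, ?_, hsol⟩
  · have hQ0 : 0 < Q := by omega
    -- Change of base, with `1 / log 2 < 2`.
    have h1 : ((Nat.log 2 Q : ℕ) : ℝ) ≤ 2 * Real.log Q := by
      have h := Real.natLog_le_logb Q 2
      have h2 := Real.log_two_gt_d9
      have h3 : 0 ≤ Real.log Q := Real.log_natCast_nonneg Q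
      refine h.trans ?_
      rw [Real.logb, div_le_iff₀ (by push_cast; linarith)]
      push_cast
      nlinarith
    have hTB : (T : ℝ) ≤ B := by nlinarith
    have hAB : 40 * (A : ℝ) ≤ B := by nlinarith
    have hB0 : 0 < B := by linarith
    have h3B : Real.exp 1 ≤ B := by linarith [Real.exp_one_lt_d9]
    have hlogB : 1 ≤ Real.log B := (Real.le_log_iff_exp_le hB0).2 h3B
    -- Both `40 * A` and `T` are at most `B`, so `Q ≤ B ^ 5`. Together with `1 ≤ log B` this gives
    -- `W ≤ 11 * log B`, far below `C * log B`.
    have h2 : Real.log Q ≤ 5 * Real.log B := by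
      have h4 : (Q : ℝ) ≤ B ^ 5 := by
        rw [hQ]
        push_cast
        calc 40 * (A : ℝ) * (T : ℝ) ^ 4 ≤ B * B ^ 4 := by gcongr
          _ = B ^ 5 := by ring
      have h5 := Real.log_le_log (by exact_mod_cast hQ0) h4
      rw [Real.log_pow] at h5
      exact_mod_cast h5
    push_cast
    nlinarith
  · have h1 : t ≤ 500 * T + 3000 * A * T := by
      refine ht.trans (htime.trans (Nat.add_le_add (Nat.mul_le_mul_left _ (by omega))
        (Nat.mul_le_mul_left _ (by omega))))
    have h2 : (t : ℝ) ≤ 500 * T + 3000 * A * T := by exact_mod_cast h1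
    linarith
  · refine ht.trans (htime.trans ?_)
    obtain ⟨m, hm⟩ : ∃ m, m = max I.w I.k := ⟨_, rfl⟩
    have hwm : I.w ≤ m := hm ▸ le_max_left _ _
    have hkm : I.k ≤ m := hm ▸ le_max_right _ _
    have hk := I.two_le_k
    rw [← hm]
    have h1 : (I.w * I.k) ^ (24 * I.w) ≤ (m * m) ^ (24 * m) :=
      (Nat.pow_le_pow_left (Nat.mul_le_mul hwm hkm) _).trans
        (Nat.pow_le_pow_right (Nat.mul_pos (by omega) (by omega)) (by omega))
    have h2 : I.n * (I.w * I.k) ^ (24 * I.w) ≤ (m * m) ^ (24 * m) * I.n ^ 2 := by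
      rw [mul_comm]
      exact Nat.mul_le_mul h1 (Nat.le_self_pow (by omega) _)
    calc 500 * I.n ^ 2 + 3000 * A * (I.n * (I.w * I.k) ^ (24 * I.w)) ≤
        500 * I.n ^ 2 + 3000 * A * ((m * m) ^ (24 * m) * I.n ^ 2) := by gcongr
      _ = _ := by ring
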